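/- Let $\Bbbk$ be an algebraically closed field and let $\mathcal C$ be a fiat 2-category over $\Bbbk$. That is: $\mathcal C$ is a strict 2-category with finitely many objects; every $\mathcal C(\mathtt i,\mathtt j)$ is an additive, idempotent complete, $\Bbbk$-linear category with finite-dimensional morphism spaces and finitely many indecomposable objects up to isomorphism; horizontal composition is $\Bbbk$-bilinear; every identity 1-morphism $\mathbb 1_{\mathtt i}$ is indecomposable; and there is a weak involution $F\mapsto F^*$, $\mathcal C(\mathtt i,\mathtt j)\to\mathcal C(\mathtt j,\mathtt i)$, reversing composition of 1-morphisms, such that each $F$ and $F^*$ are related by adjunction 2-morphisms $F\circ F^*\to\mathbb 1_{\mathtt j}$ and $\mathbb 1_{\mathtt i}\to F^*\circ F$. A 2-representation $\mathbf M$ of $\mathcal C$ is a strict 2-functor from $\mathcal C$ to categories, all values $\mathbf M(\mathtt j)$ of which are equivalent to categories of finitely generated modules over finite-dimensional $\Bbbk$-algebras; write $F\,X$ for $\mathbf M(F)(X)$. For a 2-morphism $u:F_1\to F_0$ in $\mathcal C(\mathtt i,\mathtt j)$ let $\mathrm{Coker}(u)$ be the formal cokernel, with $\mathrm{Coker}(u)\,X:=\mathrm{Coker}(F_1X\xrightarrow{u_X}F_0X)$.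 The category $\hat{\mathcal C}(\mathtt i,\mathtt j)$ has the $\mathrm{Coker}(u)$ as objects, and its morphisms $\mathrm{Coker}(u)\to\mathrm{Coker}(v)$ are those induced by commutative squares $u\to v$ in $\mathcal C(\mathtt i,\mathtt j)$. An object $M\in\mathbf M(\mathtt i)$ generates $\mathbf M$ if for all $\mathtt j$ and all $X,Y\in\mathbf M(\mathtt j)$ there are $F,G\in\hat{\mathcal C}(\mathtt i,\mathtt j)$ with $F\,M\cong X$, $G\,M\cong Y$ such that the evaluation map $\mathrm{Hom}_{\hat{\mathcal C}(\mathtt i,\mathtt j)}(F,G)\to\mathrm{Hom}_{\mathbf M(\mathtt j)}(F\,M,G\,M)$ is surjective. $\mathbf M$ is cyclic if some object generates it, and quasi-simple if it is nontrivial and generated by some simple object. For an object $\mathtt i$ of $\mathcal C$, the principal 2-representation $\mathbf P_{\mathtt i}$ sends $\mathtt j$ to the category $\overline{\mathcal C}(\mathtt i,\mathtt j)$ whose objects are the 2-morphisms $F_1\to F_0$ of $\mathcal C(\mathtt i,\mathtt j)$ and whose morphisms are commutative squares modulo those whose component between the targets factors through the target 2-morphism; $\mathcal C$ acts by composition on the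 left. Put $P_F:=(0\to F)$ and, for $F$ indecomposable, let $L_F$ be the simple top of $P_F$. For 1-morphisms $F,G$ with the same source write $F\le_R G$ if $G$ is a direct summand of $H\circ F$ for some 1-morphism $H$. A right cell $\mathcal R$ is an equivalence class of indecomposable 1-morphisms for the corresponding equivalence relation; all its elements have the same source, say $\mathtt i$. There is a subobject $K\subset P_{\mathbb 1_{\mathtt i}}$ such that every $F\in\mathcal R$ annihilates every simple subquotient of $P_{\mathbb 1_{\mathtt i}}/K$, and such that $K$ has simple top $L_{G_{\mathcal R}}$ for some indecomposable $G_{\mathcal R}\in\mathcal C(\mathtt i,\mathtt i)$, with $F\,L_{G_{\mathcal R}}\ne0$ for all $F\in\mathcal R$. The cell 2-representation $\mathbf C_{\mathcal R}$ is the restriction of $\mathbf P_{\mathtt i}$ to the full subcategories $\mathbf C_{\mathcal R}(\mathtt j)\subset\mathbf P_{\mathtt i}(\mathtt j)$ of all $X$ having a presentation $X_1\to X_0\to X\to0$ with $X_1,X_0$ direct summands of finite direct sums of objects $F\,L_{G_{\mathcal R}}$, $F\in\mathcal R\cap\mathcal C(\mathtt i,\mathtt j)$; these subcategories are stable under the action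 of $\mathcal C$. The simple object of $\mathbf C_{\mathcal R}(\mathtt i)$ labelled by $L_{G_{\mathcal R}}$ is the simple object of the category $\mathbf C_{\mathcal R}(\mathtt i)$ which, as an object of $\mathbf P_{\mathtt i}(\mathtt i)$, has simple top $L_{G_{\mathcal R}}$. Then the following hold. (a) For every object $\mathtt i$ of $\mathcal C$, $\mathbf P_{\mathtt i}$ is a 2-representation which is cyclic and generated by $P_{\mathbb 1_{\mathtt i}}$. (b) For every right cell $\mathcal R$ of $\mathcal C$, a subobject $K$ as above exists, and for each such $K$, $\mathbf C_{\mathcal R}$ is a well-defined 2-representation which is cyclic and generated by the simple object of $\mathbf C_{\mathcal R}(\mathtt i)$ labelled by $L_{G_{\mathcal R}}$ (which exists). In particular $\mathbf C_{\mathcal R}$ is quasi-simple. -/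

import Mathlib

attribute [-instance] CategoryTheory.catToReflQuiver
open CategoryTheory CategoryTheory.Limits CategoryTheory.Bicategory CategoryTheory.Preadditive

universe w v u v₁ v₂ v₃ u₁ u₂ u₃

set_option linter.checkUnivs false

namespace Fiat

section Freyd

variable {V : Type u₁} [Category.{v₁} V] [Preadditive V]
  {W : Type u₂} [Category.{v₂} W] [Preadditive W]
  {W' : Type u₃} [Category.{v₃} W'] [Preadditive W']

/-- The functor between right Freyd categories induced by an additive functor. -/
def freydMap (T : V ⥤ W) [T.Additive] : RightFreyd V ⥤ RightFreyd W :=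
  CategoryTheory.Quotient.lift _ (T.mapArrow ⋙ RightFreyd.quotient W) (by
    rintro a b f g ⟨h⟩
    refine RightFreyd.eq_of_rightHomotopy _ _ ⟨T.map h.hom, ?_⟩
    have := congrArg T.map h.comm
    rw [T.map_sub, T.map_comp] at this
    exact this)

/-- The natural transformation between induced functors induced by a natural transformation. -/
def freydMapNat {T T' : V ⥤ W} [T.Additive] [T'.Additive] (τ : T ⟶ T') :
    freydMap T ⟶ freydMap T' :=
  CategoryTheory.Quotient.natTransLift _
    (Functor.whiskerRight ((Functor.mapArrowFunctor V W).map τ) (RightFreyd.quotient W))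

theorem freydMapNat_id (T : V ⥤ W) [T.Additive] : freydMapNat (𝟙 T) = 𝟙 (freydMap T) := by
  ext ⟨X⟩
  exact (RightFreyd.quotient W).map_id _

theorem freydMapNat_comp {T T' T'' : V ⥤ W} [T.Additive] [T'.Additive] [T''.Additive]
    (τ : T ⟶ T') (σ : T' ⟶ T'') :
    freydMapNat (τ ≫ σ) = freydMapNat τ ≫ freydMapNat σ := by
  ext ⟨X⟩
  exact (RightFreyd.quotient W).map_comp (((Functor.mapArrowFunctor V W).map τ).app X)
    (((Functor.mapArrowFunctor V W).map σ).app X)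

/-- The natural isomorphism between induced functors induced by a natural isomorphism. -/
def freydMapIso {T T' : V ⥤ W} [T.Additive] [T'.Additive] (e : T ≅ T') :
    freydMap T ≅ freydMap T' where
  hom := freydMapNat e.hom
  inv := freydMapNat e.inv
  hom_inv_id := by rw [← freydMapNat_comp, e.hom_inv_id, freydMapNat_id]
  inv_hom_id := by rw [← freydMapNat_comp, e.inv_hom_id, freydMapNat_id]

theorem freydMap_id : freydMap (𝟭 V) = 𝟭 (RightFreyd V) := by
  refine CategoryTheory.Functor.hext (fun X => rfl) ?_
  rintro ⟨X⟩ ⟨Y⟩ ⟨f⟩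
  rfl

theorem freydMap_comp (T : V ⥤ W) [T.Additive] (S : W ⥤ W') [S.Additive] :
    freydMap (T ⋙ S) = freydMap T ⋙ freydMap S := by
  refine CategoryTheory.Functor.hext (fun X => rfl) ?_
  rintro ⟨X⟩ ⟨Y⟩ ⟨f⟩
  rfl

theorem freydMapNat_eqToHom {T T' : V ⥤ W} [T.Additive] [T'.Additive] (h : T = T') :
    freydMapNat (eqToHom h) = eqToHom (by subst h; rfl : freydMap T = freydMap T') := by
  subst h
  exact freydMapNat_id _

end Freyd

/-- Horizontal composition is biadditive. -/
class IsBiadditive (C : Type u) [Bicategory.{w, v} C] [∀ i j : C, Preadditive (i ⟶ j)] : Prop where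
  whiskerLeft_add {i j k : C} (F : i ⟶ j) {G H : j ⟶ k} (α β : G ⟶ H) :
    F ◁ (α + β) = F ◁ α + F ◁ β
  add_whiskerRight {i j k : C} {F G : i ⟶ j} (α β : F ⟶ G) (H : j ⟶ k) :
    (α + β) ▷ H = α ▷ H + β ▷ H

section

variable {C : Type u} [Bicategory.{w, v} C]

/-- A strict 2-functor from `C` to categories, all of whose values are preadditive. -/
structure PreTwoRep (C : Type u) [Bicategory.{w, v} C] extends
    StrictPseudofunctor C Cat.{v₁, u₁} where
  /-- the additive structure on the values -/
  preadditive : ∀ j : C, Preadditive (obj j)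

attribute [instance] PreTwoRep.preadditive

instance [∀ i j : C, Preadditive (i ⟶ j)] [IsBiadditive C] (i : C) {j k : C} (F : j ⟶ k) : (postcomp i F).Additive :=
  ⟨fun {_ _ f g} => IsBiadditive.add_whiskerRight f g F⟩

theorem postcomp_id [Bicategory.Strict C] (i j : C) : postcomp i (𝟙 j) = 𝟭 (i ⟶ j) := by
  refine CategoryTheory.Functor.ext (fun X => Bicategory.Strict.comp_id X) ?_
  intro X Y f
  have h : f ▷ 𝟙 j = (ρ_ X).hom ≫ f ≫ (ρ_ Y).inv := by simp
  simp only [Bicategory.Strict.rightUnitor_eqToIso] at h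
  exact h

theorem postcomp_comp [Bicategory.Strict C] (i : C) {j k l : C} (F : j ⟶ k) (G : k ⟶ l) :
    postcomp i (F ≫ G) = postcomp i F ⋙ postcomp i G := by
  refine CategoryTheory.Functor.ext (fun X => (Bicategory.Strict.assoc X F G).symm) ?_
  intro X Y f
  have h : f ▷ (F ≫ G) = (α_ X F G).inv ≫ f ▷ F ▷ G ≫ (α_ Y F G).hom := by simp
  simp only [Bicategory.Strict.associator_eqToIso] at h
  exact h



end

section

variable {V : Type u₁} [Category.{v₁} V] [Preadditive V]

/-- The object `A ⟶ B` of the right Freyd category. -/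
def frObj {A B : V} (a : A ⟶ B) : RightFreyd V := (RightFreyd.quotient V).obj (Arrow.mk a)

/-- The morphism of the right Freyd category given by a commutative square. -/
def frHom {A B A' B' : V} (a : A ⟶ B) (a' : A' ⟶ B') (l : A ⟶ A') (r : B ⟶ B')
    (w : l ≫ a' = a ≫ r) : frObj a ⟶ frObj a' :=
  (RightFreyd.quotient V).map (Arrow.homMk' l r w)

theorem frHom_comp {A B A' B' A'' B'' : V} (a : A ⟶ B) (a' : A' ⟶ B') (a'' : A'' ⟶ B'')
    (l : A ⟶ A') (r : B ⟶ B') (w : l ≫ a' = a ≫ r)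
    (l' : A' ⟶ A'') (r' : B' ⟶ B'') (w' : l' ≫ a'' = a' ≫ r') :
    frHom a a' l r w ≫ frHom a' a'' l' r' w' =
      frHom a a'' (l ≫ l') (r ≫ r') (by rw [Category.assoc, w', reassoc_of% w]) := by
  exact ((RightFreyd.quotient V).map_comp (Arrow.homMk' l r w) (Arrow.homMk' l' r' w')).symm

theorem frHom_congr {A B A' B' : V} (a : A ⟶ B) (a' : A' ⟶ B') {l l' : A ⟶ A'} {r r' : B ⟶ B'}
    {w : l ≫ a' = a ≫ r} {w' : l' ≫ a' = a ≫ r'} (hl : l = l') (hr : r = r') :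
    frHom a a' l r w = frHom a a' l' r' w' := by
  subst hl hr; rfl

theorem frHom_eq_comp₃ {A B A' B' A'' B'' Z Z' : V} (a : A ⟶ B) (a' : A' ⟶ B') (a'' : A'' ⟶ B'')
    (z : Z ⟶ Z') (l : A ⟶ A') (r : B ⟶ B') (w : l ≫ a' = a ≫ r)
    (l' : A' ⟶ A'') (r' : B' ⟶ B'') (w' : l' ≫ a'' = a' ≫ r')
    (l'' : A'' ⟶ Z) (r'' : B'' ⟶ Z') (w'' : l'' ≫ z = a'' ≫ r'')
    (m : A ⟶ Z) (n : B ⟶ Z') (hw : m ≫ z = a ≫ n) (hm : m = l ≫ l' ≫ l'') (hn : n = r ≫ r' ≫ r'') :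
    frHom a z m n hw =
      frHom a a' l r w ≫ frHom a' a'' l' r' w' ≫ frHom a'' z l'' r'' w'' := by
  subst hm hn
  rw [frHom_comp, frHom_comp]

theorem frHom_id {A B : V} (a : A ⟶ B) : 𝟙 (frObj a) = frHom a a (𝟙 A) (𝟙 B) (by simp) :=
  ((RightFreyd.quotient V).map_id _).symm

end

section

variable {C : Type u} [Bicategory.{w, v} C] [∀ i j : C, Preadditive (i ⟶ j)] [IsBiadditive C]

/-- The transformation induced by a 2-morphism. -/
def whiskNat (i : C) {j k : C} {F G : j ⟶ k} (α : F ⟶ G) :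
    freydMap (postcomp i F) ⟶ freydMap (postcomp i G) :=
  freydMapNat (T := postcomp i F) (T' := postcomp i G) ((postcomposing i j k).map α)

theorem whiskNat_app (i : C) {j k : C} {F G : j ⟶ k} (α : F ⟶ G) {X Y : i ⟶ j} (a : X ⟶ Y) :
    (whiskNat i α).app (frObj a) =
      frHom (a ▷ F) (a ▷ G) (X ◁ α) (Y ◁ α) (whisker_exchange a α).symm.symm := rfl

theorem freydMap_app (i : C) {j k : C} (F : j ⟶ k) {X Y X' Y' : i ⟶ j} (a : X ⟶ Y) (a' : X' ⟶ Y')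
    (l : X ⟶ X') (r : Y ⟶ Y') (w : l ≫ a' = a ≫ r) :
    (freydMap (postcomp i F)).map (frHom a a' l r w) =
      frHom (a ▷ F) (a' ▷ F) (l ▷ F) (r ▷ F)
        (by rw [← comp_whiskerRight, ← comp_whiskerRight, w]) := rfl

theorem freydMap_congr {V : Type u₁} [Category.{v₁} V] [Preadditive V]
    {W : Type u₂} [Category.{v₂} W] [Preadditive W] {T T' : V ⥤ W} [T.Additive] [T'.Additive]
    (h : T = T') : freydMap T = freydMap T' := by
  subst h; rfl

theorem principal_map_id [Bicategory.Strict C] (i j : C) :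
    freydMap (postcomp i (𝟙 j)) = 𝟭 (RightFreyd (i ⟶ j)) :=
  (freydMap_congr (postcomp_id i j)).trans freydMap_id

theorem principal_map_comp [Bicategory.Strict C] (i : C) {j k l : C} (F : j ⟶ k) (G : k ⟶ l) :
    freydMap (postcomp i (F ≫ G)) = freydMap (postcomp i F) ⋙ freydMap (postcomp i G) :=
  (freydMap_congr (postcomp_comp i F G)).trans (freydMap_comp _ _)

theorem principal_eqToHom_id [Bicategory.Strict C] (i j : C) {X Y : i ⟶ j} (a : X ⟶ Y) :
    (eqToHom (principal_map_id i j)).app (frObj a) =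
      frHom (a ▷ 𝟙 j) a (ρ_ X).hom (ρ_ Y).hom (by simp) := by
  have h1 : (eqToHom (freydMap_id (V := i ⟶ j))).app (frObj a) = 𝟙 _ := by
    rw [eqToHom_app]; rfl
  have h3 : (eqToHom (postcomp_id i j)) = (rightUnitorNatIso i j).hom := by
    ext Y
    rw [eqToHom_app]
    simp [Bicategory.Strict.rightUnitor_eqToIso]
    rfl
  rw [← eqToHom_trans (freydMap_congr (postcomp_id i j)) freydMap_id, NatTrans.comp_app, h1,
    ← freydMapNat_eqToHom (postcomp_id i j), h3]
  exact Category.comp_id _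

theorem principal_eqToHom_comp [Bicategory.Strict C] (i : C) {j k l : C} (F : j ⟶ k) (G : k ⟶ l)
    {X Y : i ⟶ j} (a : X ⟶ Y) :
    (eqToHom (principal_map_comp i F G)).app (frObj a) =
      frHom (a ▷ (F ≫ G)) ((a ▷ F) ▷ G) (α_ X F G).inv (α_ Y F G).inv (by simp) := by
  have h1 : (eqToHom (freydMap_comp (postcomp i F) (postcomp i G))).app (frObj a) = 𝟙 _ := by
    rw [eqToHom_app]; rfl
  have h3 : (eqToHom (postcomp_comp i F G)) = (associatorNatIsoLeft i F G).inv := by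
    ext Y
    rw [eqToHom_app]
    simp [Bicategory.Strict.associator_eqToIso]
    rfl
  rw [← eqToHom_trans (freydMap_congr (postcomp_comp i F G))
    (freydMap_comp (postcomp i F) (postcomp i G)), NatTrans.comp_app, h1,
    ← freydMapNat_eqToHom (postcomp_comp i F G), h3]
  exact Category.comp_id _

theorem principal_eqToHom_comp_symm [Bicategory.Strict C] (i : C) {j k l : C} (F : j ⟶ k)
    (G : k ⟶ l) {X Y : i ⟶ j} (a : X ⟶ Y) :
    (eqToHom (principal_map_comp i F G).symm).app (frObj a) =
      frHom ((a ▷ F) ▷ G) (a ▷ (F ≫ G)) (α_ X F G).hom (α_ Y F G).hom (by simp) := by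
  have h2 : (eqToHom (principal_map_comp i F G).symm).app (frObj a) ≫
      (eqToHom (principal_map_comp i F G)).app (frObj a) = 𝟙 _ := by
    rw [← NatTrans.comp_app]; simp
  have h4 : frHom (a ▷ (F ≫ G)) ((a ▷ F) ▷ G) (α_ X F G).inv (α_ Y F G).inv (by simp) ≫ 
     frHom ((a ▷ F) ▷ G) (a ▷ (F ≫ G)) (α_ X F G).hom (α_ Y F G).hom (by simp) = 𝟙 _ := by
    rw [frHom_comp, frHom_id]
    exact frHom_congr _ _ (by simp) (by simp)
  rw [principal_eqToHom_comp] at h2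
  calc _ = (eqToHom (principal_map_comp i F G).symm).app (frObj a) ≫ 𝟙 _ := (Category.comp_id _).symm
    _ = (eqToHom (principal_map_comp i F G).symm).app (frObj a) ≫ _ ≫ _ :=
      congrArg (fun z => (eqToHom (principal_map_comp i F G).symm).app (frObj a) ≫ z) h4.symm
    _ = 𝟙 _ ≫ _ := by rw [← h2]; exact (Category.assoc _ _ _).symm
    _ = _ := Category.id_comp _

theorem whiskNat_eqToHom (i : C) {j k : C} {F G : j ⟶ k} (h : F = G) :
    (whiskNat i (eqToHom h)).toCatHom₂ =
      eqToHom (by rw [h] : (freydMap (postcomp i F)).toCatHom = (freydMap (postcomp i G)).toCatHom)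
      := by
  subst h
  apply Cat.Hom₂.ext
  change freydMapNat _ = _
  rw [eqToHom_refl, (postcomposing i j k).map_id]
  exact freydMapNat_id _

/-- The strict 2-functor underlying the principal 2-representation at `i`: on objects it is
`j ↦` the right Freyd category of `C(i, j)`, a 1-morphism `F` acts by composing with `F` afterwards,
and similarly for 2-morphisms. -/
def principalFunctor [Bicategory.Strict C] (i : C) : StrictPseudofunctor C Cat.{w, max w v} :=
  StrictPseudofunctor.mk' {
    obj j := Cat.of (RightFreyd (i ⟶ j))
    map {j k} F := (freydMap (postcomp i F)).toCatHom
    map₂ {j k F G} α := (whiskNat i α).toCatHom₂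
    map₂_id := by
      intro j k F
      ext1
      change freydMapNat _ = _
      simp
      exact freydMapNat_id _
    map₂_comp := by
      intro j k F G H α β
      ext1
      change freydMapNat _ = _
      rw [Functor.map_comp]
      exact freydMapNat_comp (T := postcomp i F) (T' := postcomp i G) (T'' := postcomp i H) _ _
    map_id := by
      intro j
      ext1
      exact principal_map_id i j
    map_comp := by
      intro j k l F G
      ext1
      exact principal_map_comp i F G
    map₂_whisker_left := by
      intro j k l F G G' η
      apply Cat.Hom₂.ext
      ext ⟨X⟩
      simp
      change (whiskNat i (F ◁ η)).app (frObj X.hom) = (eqToHom (principal_map_comp i F G)).app (frObj X.hom) ≫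
         (whiskNat i η).app (frObj (X.hom ▷ F)) ≫ (eqToHom (principal_map_comp i F G').symm).app (frObj X.hom)
      rw [principal_eqToHom_comp, principal_eqToHom_comp_symm, whiskNat_app, whiskNat_app]
      exact frHom_eq_comp₃ _ _ _ _ _ _ _ _ _ _ _ _ _ _ _ _ (by simp) (by simp)
    map₂_whisker_right := by
      intro j k l F F' η G
      apply Cat.Hom₂.ext
      ext ⟨X⟩
      simp
      change (whiskNat i (η ▷ G)).app (frObj X.hom) = (eqToHom (principal_map_comp i F G)).app (frObj X.hom) ≫
         (freydMap (postcomp i G)).map ((whiskNat i η).app (frObj X.hom)) ≫ (eqToHom (principal_map_comp i F' G).symm).app (frObj X.hom)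
      rw [principal_eqToHom_comp, principal_eqToHom_comp_symm, whiskNat_app, whiskNat_app]
      exact frHom_eq_comp₃ _ _ _ _ _ _ _ _ _ _ _ _ _ _ _ _ (whisker_assoc_symm _ _ _)
        (whisker_assoc_symm _ _ _)
    map₂_left_unitor := by
      intro j k F
      simp only [Bicategory.Strict.leftUnitor_eqToIso, eqToIso.hom, eqToHom_trans]
      exact whiskNat_eqToHom i _
    map₂_right_unitor := by
      intro j k F
      simp only [Bicategory.Strict.rightUnitor_eqToIso, eqToIso.hom, eqToHom_trans]
      exact whiskNat_eqToHom i _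
    map₂_associator := by
      intro j k l m F G H
      simp only [Bicategory.Strict.associator_eqToIso, eqToIso.hom, eqToHom_trans]
      exact whiskNat_eqToHom i _ }



/-- The principal 2-representation at `i`. -/
def principal [Bicategory.Strict C] (i : C) : PreTwoRep C where
  toStrictPseudofunctor := principalFunctor i
  preadditive j := inferInstanceAs (Preadditive (RightFreyd (i ⟶ j)))

section

variable {C : Type u} [Bicategory.{w, v} C]

theorem fullSubcategory_eq {X : Type u₁} [Category.{v₁} X] {Y : Type u₂} [Category.{v₂} Y]
    {P : ObjectProperty Y} {S T : X ⥤ P.FullSubcategory} (e : S ≅ T)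
    (h : ∀ x, (S.obj x).obj = (T.obj x).obj) (he : ∀ x, (e.hom.app x).hom = eqToHom (h x)) :
    ∃ hST : S = T, e = eqToIso hST := by
  have key : ∀ x, e.hom.app x = eqToHom (ObjectProperty.FullSubcategory.ext (h x)) := by
    intro x
    apply P.hom_ext
    rw [he x]
    generalize_proofs h1 h2
    revert h1 h2
    generalize S.obj x = s
    generalize T.obj x = t
    intro h1 h2
    subst h2
    rfl
  have hST : S = T := by
    refine CategoryTheory.Functor.ext (fun x => ObjectProperty.FullSubcategory.ext (h x)) ?_
    intro x y f
    have h1 := e.hom.naturality f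
    rw [key, key] at h1
    rw [← Category.assoc, ← h1]
    simp
  refine ⟨hST, ?_⟩
  ext x
  rw [key, eqToIso.hom, eqToHom_app]

theorem cat_eq {X Y : Cat.{v₁, u₁}} {P : ObjectProperty X} {Q : ObjectProperty Y}
    {S T : P.FullSubcategory ⥤ Q.FullSubcategory}
    (e : S ≅ T) (A B : X ⟶ Y) (h : A = B) (hA : ∀ x, (S.obj x).obj = A.toFunctor.obj x.obj)
    (hB : ∀ x, (T.obj x).obj = B.toFunctor.obj x.obj)
    (he : ∀ x, (e.hom.app x).hom = eqToHom (hA x) ≫ (eqToHom h).toNatTrans.app x.obj ≫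
      eqToHom (hB x).symm) :
    ∃ hST : (Cat.Hom.ofFunctor S : Cat.of P.FullSubcategory ⟶ Cat.of Q.FullSubcategory) =
        Cat.Hom.ofFunctor T, Cat.Hom.isoMk e =
          eqToIso (C := Cat.of P.FullSubcategory ⟶ Cat.of Q.FullSubcategory) hST := by
  subst h
  obtain ⟨h1, h2⟩ := fullSubcategory_eq e (fun x => (hA x).trans (hB x).symm) (by
    intro x; rw [he x]; simp)
  subst h1
  exact ⟨rfl, by rw [h2]; ext; rfl⟩

section
variable (M : StrictPseudofunctor C Cat.{v₁, u₁}) (P : M.toPseudofunctor.ObjectProperty)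
    [P.IsClosedUnderMapObj]

theorem restrict_mapId (X : C) : ∃ h : P.fullsubcategory.map (𝟙 X) = 𝟙 _,
    P.fullsubcategory.mapId X = eqToIso h :=
  cat_eq (X := M.obj X) (Y := M.obj X) (P := P.prop X) (Q := P.prop X) (P.mapId X) _ _ (M.map_id X)
    (fun _ => rfl) (fun _ => rfl) (fun x => by
      rw [P.mapId_hom_app, M.mapId_eq_eqToIso X]
      simp
      exact (eqToHom_trans _ _).symm)

theorem restrict_mapComp {X Y Z : C} (f : X ⟶ Y) (g : Y ⟶ Z) :
    ∃ h : P.fullsubcategory.map (f ≫ g) = P.fullsubcategory.map f ≫ P.fullsubcategory.map g,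
      P.fullsubcategory.mapComp f g = eqToIso h :=
  cat_eq (X := M.obj X) (Y := M.obj Z) (P := P.prop X) (Q := P.prop Z) (P.mapComp f g) _ _
    (M.map_comp f g) (fun _ => rfl) (fun _ => rfl) (fun x => by
      rw [P.mapComp_hom_app, M.mapComp_eq_eqToIso f g]
      simp
      exact (eqToHom_trans _ _).symm)

/-- The strict 2-functor obtained by restricting to full subcategories stable under the action. -/
def restrictStrict : StrictPseudofunctor C Cat.{v₁, u₁} where
  toPseudofunctor := P.fullsubcategory
  map_id X := (restrict_mapId M P X).1
  map_comp f g := (restrict_mapComp M P f g).1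
  mapId_eq_eqToIso X := (restrict_mapId M P X).2
  mapComp_eq_eqToIso f g := (restrict_mapComp M P f g).2

end

end

/-- The restriction of `M` to full subcategories `D j` stable under the action. -/
def PreTwoRep.restrict (M : PreTwoRep C) (D : ∀ j : C, ObjectProperty (M.obj j))
    (h : ∀ (j l : C) (F : j ⟶ l) (X : M.obj j), D j X → D l ((M.map F).toFunctor.obj X)) :
    PreTwoRep C :=
  haveI : (⟨D⟩ : M.toPseudofunctor.ObjectProperty).IsClosedUnderMapObj :=
    ⟨fun {_ _ X} hX F => h _ _ F X hX⟩
  { toStrictPseudofunctor := restrictStrict M.toStrictPseudofunctor ⟨D⟩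
    preadditive := fun j => inferInstanceAs (Preadditive (D j).FullSubcategory) }

end

/-! ### Finitary and fiat 2-categories -/

section

variable (k : Type*) [Field k] (C : Type u) [Bicategory.{w, v} C]
  [∀ i j : C, Preadditive (i ⟶ j)] [∀ i j : C, Linear k (i ⟶ j)]
  [∀ i j : C, HasZeroObject (i ⟶ j)] [∀ i j : C, HasBinaryBiproducts (i ⟶ j)] [IsBiadditive C]

/-- `C` (whose categories of 1-morphisms are additive and `k`-linear, with biadditive horizontal
composition) is `k`-finitary. -/
class IsFinitary : Prop where
  finite_objects : Finite C
  isIdempotentComplete (i j : C) : IsIdempotentComplete (i ⟶ j)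
  finite_hom {i j : C} (F G : i ⟶ j) : Module.Finite k (F ⟶ G)
  finite_indecomposables (i j : C) : ∃ s : Set (i ⟶ j), s.Finite ∧
    ∀ F : i ⟶ j, Indecomposable F → ∃ G ∈ s, Nonempty (F ≅ G)
  whiskerLeft_smul {i j l : C} (F : i ⟶ j) {G H : j ⟶ l} (c : k) (α : G ⟶ H) :
    F ◁ (c • α) = c • (F ◁ α)
  smul_whiskerRight {i j l : C} {F G : i ⟶ j} (c : k) (α : F ⟶ G) (H : j ⟶ l) :
    (c • α) ▷ H = c • (α ▷ H)
  indecomposable_id (i : C) : Indecomposable (𝟙 i)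

/-- `C` is fiat: it is finitary and has a weak involution `F ↦ F*`, reversing 1-morphisms, together
with adjunction 2-morphisms `F ∘ F* ⟶ 𝟙` and `𝟙 ⟶ F* ∘ F` for every 1-morphism `F`. (The action of
the involution on 2-morphisms is given by taking mates under these adjunctions.) -/
class IsFiat : Prop extends IsFinitary k C where
  exists_star : ∃ star : ∀ {i j : C}, (i ⟶ j) → (j ⟶ i),
    (∀ {i j : C} (F : i ⟶ j), Nonempty (star (star F) ≅ F)) ∧
    (∀ {i j l : C} (F : i ⟶ j) (G : j ⟶ l), Nonempty (star (F ≫ G) ≅ star G ≫ star F)) ∧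
    (∀ i : C, Nonempty (star (𝟙 i) ≅ 𝟙 i)) ∧
    ∀ {i j : C} (F : i ⟶ j), Nonempty (Bicategory.Adjunction F (star F))

end

/-! ### 2-representations, generation, cyclicity -/

section

variable {C : Type u} [Bicategory.{w, v} C]

/-- Every value of `M` is equivalent to the category of finitely generated modules over a
finite dimensional `k`-algebra. -/
def IsTwoRep (k : Type*) [Field k] (M : PreTwoRep.{w, v, u, v₁, u₁} C) : Prop :=
  ∀ j : C, ∃ (A : Type v₁) (_ : Ring A) (_ : Algebra k A),
    Module.Finite k A ∧ Nonempty (M.obj j ≌ FGModuleCat.{v₁} A)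

namespace PreTwoRep

variable (M : PreTwoRep C)

/-- The object `F X` of `M j`, for a 1-morphism `F : i ⟶ j` and an object `X` of `M i`. -/
abbrev act {i j : C} (F : i ⟶ j) (X : M.obj i) : M.obj j := (M.map F).toFunctor.obj X

/-- The morphism `α_X : F X ⟶ G X`, for a 2-morphism `α : F ⟶ G` and an object `X` of `M i`. -/
abbrev act₂ {i j : C} {F G : i ⟶ j} (α : F ⟶ G) (X : M.obj i) : M.act F X ⟶ M.act G X :=
  (M.map₂ α).toNatTrans.app X

theorem act₂_comp {i j : C} {F G H : i ⟶ j} (α : F ⟶ G) (β : G ⟶ H) (X : M.obj i) :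
    M.act₂ (α ≫ β) X = M.act₂ α X ≫ M.act₂ β X := by
  simp [act₂]

variable {M}

/-- A 1-morphism `i ⟶ j` of the abelian envelope of `C` is the formal cokernel `Coker u` of a
2-morphism `u : F ⟶ G` between 1-morphisms `i ⟶ j`. It sends an object `X` of `M i` to the cokernel
of `u_X : F X ⟶ G X`; a term of `EnvelopeValue X u Z` exhibits `Z` as this cokernel. -/
structure EnvelopeValue {i j : C} (X : M.obj i) (u : Arrow (i ⟶ j)) (Z : M.obj j) where
  /-- the projection -/
  π : M.act u.right X ⟶ Z
  condition : M.act₂ u.hom X ≫ π = 0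
  /-- the universal property of the cokernel -/
  isColimit : IsColimit (CokernelCofork.ofπ π condition)

/-- A 2-morphism `Coker u ⟶ Coker v` of the abelian envelope is induced by a commutative square
`φ : u ⟶ v` of 2-morphisms of `C`. This is its evaluation at `X`, from the value `Z` of `Coker u`
at `X` to the value `W` of `Coker v` at `X`. -/
def envelopeEval {i j : C} {X : M.obj i} {u v : Arrow (i ⟶ j)} {Z W : M.obj j}
    (p : EnvelopeValue X u Z) (q : EnvelopeValue X v W) (φ : u ⟶ v) : Z ⟶ W :=
  p.isColimit.desc (CokernelCofork.ofπ (M.act₂ φ.right X ≫ q.π) (by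
    have h : u.hom ≫ φ.right = φ.left ≫ v.hom := (Arrow.w φ).symm
    rw [← Category.assoc, ← act₂_comp, h, act₂_comp, Category.assoc, q.condition, comp_zero]))

theorem π_envelopeEval {i j : C} {X : M.obj i} {u v : Arrow (i ⟶ j)} {Z W : M.obj j}
    (p : EnvelopeValue X u Z) (q : EnvelopeValue X v W) (φ : u ⟶ v) :
    p.π ≫ envelopeEval p q φ = M.act₂ φ.right X ≫ q.π :=
  p.isColimit.fac _ WalkingParallelPair.one

variable (M)

/-- The object `X` of `M i` generates `M`: any two objects `Z`, `W` of any `M j` are values at `X` of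
1-morphisms `Coker u`, `Coker v` of the abelian envelope such that every morphism `Z ⟶ W` is the
evaluation at `X` of a 2-morphism `Coker u ⟶ Coker v`. -/
def Generates {i : C} (X : M.obj i) : Prop :=
  ∀ (j : C) (Z W : M.obj j), ∃ (u v : Arrow (i ⟶ j)) (p : EnvelopeValue X u Z)
    (q : EnvelopeValue X v W), Function.Surjective (envelopeEval p q)

/-- `M` is cyclic. -/
def IsCyclic : Prop := ∃ (i : C) (X : M.obj i), M.Generates X

/-- `M` is quasi-simple: it is nontrivial and generated by a simple object. -/
def IsQuasiSimple : Prop :=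
  (∃ (i : C) (X : M.obj i), ¬ IsZero X) ∧ ∃ (i : C) (X : M.obj i), Simple X ∧ M.Generates X

end PreTwoRep

end

/-! ### Right cells -/

section

variable {C : Type u} [Bicategory.{w, v} C] [∀ i j : C, Preadditive (i ⟶ j)]
  [∀ i j : C, HasZeroObject (i ⟶ j)] [∀ i j : C, HasBinaryBiproducts (i ⟶ j)]

/-- The right preorder: `F ≤ G` if `G` is a direct summand of `H ∘ F` for some 1-morphism `H`. -/
def LeR {i j l : C} (F : i ⟶ j) (G : i ⟶ l) : Prop := ∃ H : j ⟶ l, Nonempty (Retract G (F ≫ H))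

/-- `R` (a class of 1-morphisms with source `i`) is a right cell, that is, an equivalence class of
indecomposable 1-morphisms for the right preorder. -/
def IsRightCell {i : C} (R : ∀ j : C, ObjectProperty (i ⟶ j)) : Prop :=
  ∃ (j : C) (F : i ⟶ j), Indecomposable F ∧
    ∀ (l : C) (G : i ⟶ l), R l G ↔ Indecomposable G ∧ LeR F G ∧ LeR G F

end

/-! ### Cell 2-representations -/

section

/-- `p : K ⟶ L` is the projection of `K` onto its simple top `L`: `L` is simple, and all proper
subobjects of `K` lie in the kernel of the epimorphism `p`. -/
def IsSimpleTop {D : Type u₁} [Category.{v₁} D] [HasZeroMorphisms D] {K L : D} (p : K ⟶ L) : Prop :=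
  Simple L ∧ Epi p ∧ ∀ (Y : D) (f : Y ⟶ K), ¬ Epi f → f ≫ p = 0

/-- `X` is a direct summand of a finite direct sum of objects in `S`. -/
def addClosure {D : Type u₁} [Category.{v₁} D] [HasZeroMorphisms D] (S : ObjectProperty D) :
    ObjectProperty D := fun X =>
  ∃ (n : ℕ) (f : Fin n → D) (b : Bicone f), (∀ a, S (f a)) ∧ Nonempty b.IsBilimit ∧
    Nonempty (Retract X b.pt)

variable {C : Type u} [Bicategory.{w, v} C] [Bicategory.Strict C]
  [∀ i j : C, Preadditive (i ⟶ j)] [∀ i j : C, HasZeroObject (i ⟶ j)] [IsBiadditive C]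

/-- The object `P_F = (0 ⟶ F)` of the principal 2-representation. -/
noncomputable def principalObj {i j : C} (F : i ⟶ j) : (principal i).obj j :=
  (RightFreyd.functor (i ⟶ j)).obj F

/-- `ι : K ⟶ P_𝟙` is a subobject with the properties which characterise the one attached to the right
cell `R`, `p : K ⟶ L` is the projection onto its simple top, and `L` is the simple object `L_G`
(the simple quotient of `P_G`) for the indecomposable 1-morphism `G`. -/
structure IsCellSubobject [∀ i j : C, HasBinaryBiproducts (i ⟶ j)] {i : C}
    (R : ∀ j : C, ObjectProperty (i ⟶ j)) {K L : (principal i).obj i}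
    (ι : K ⟶ principalObj (𝟙 i)) (p : K ⟶ L) (G : i ⟶ i) : Prop where
  mono : Mono ι
  /-- every simple subquotient `S` of `P_𝟙 / K` is annihilated by every `F` in `R` -/
  annihilated {Q A S : (principal i).obj i} (q : principalObj (𝟙 i) ⟶ Q) (hq : ι ≫ q = 0)
    (_ : Nonempty (IsColimit (CokernelCofork.ofπ q hq))) (m : A ⟶ Q) (_ : Mono m)
    (e : A ⟶ S) (_ : Epi e) (_ : Simple S) (j : C) (F : i ⟶ j) (_ : R j F) :
    IsZero ((principal i).act F S)
  isSimpleTop : IsSimpleTop p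
  indecomposable : Indecomposable G
  exists_epi : ∃ e : principalObj G ⟶ L, Epi e
  not_annihilated (j : C) (F : i ⟶ j) (_ : R j F) : ¬ IsZero ((principal i).act F L)

/-- The objects of the cell 2-representation attached to `R` and `L = L_{G_R}`: those `X` which have
a presentation `X₁ ⟶ X₀ ⟶ X ⟶ 0` in `P_i(j)` with `X₁`, `X₀` direct summands of finite direct sums of
objects `F L` with `F` in `R`. -/
def cellProp {i : C} (R : ∀ j : C, ObjectProperty (i ⟶ j)) (L : (principal i).obj i) (j : C) :
    ObjectProperty ((principal i).obj j) := fun X =>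
  ∃ (X₁ X₀ : (principal i).obj j) (a : X₁ ⟶ X₀) (π : X₀ ⟶ X) (w : a ≫ π = 0),
    addClosure (fun Y => ∃ F : i ⟶ j, R j F ∧ Nonempty (Y ≅ (principal i).act F L)) X₁ ∧
    addClosure (fun Y => ∃ F : i ⟶ j, R j F ∧ Nonempty (Y ≅ (principal i).act F L)) X₀ ∧
    Nonempty (IsColimit (CokernelCofork.ofπ π w))

/-- The subcategories of objects of the cell 2-representation are stable under the action of `C`. -/
def IsCellStable {i : C} (R : ∀ j : C, ObjectProperty (i ⟶ j)) (L : (principal i).obj i) : Prop :=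
  ∀ (j l : C) (F : j ⟶ l) (X : (principal i).obj j),
    cellProp R L j X → cellProp R L l ((principal i).act F X)

/-- The cell 2-representation attached to `R` and `L = L_{G_R}`: the restriction of the principal
2-representation to the full subcategories given by `cellProp`. -/
def cellRep {i : C} (R : ∀ j : C, ObjectProperty (i ⟶ j)) (L : (principal i).obj i)
    (h : IsCellStable R L) : PreTwoRep C :=
  (principal i).restrict (cellProp R L) h

/-- `S` is the simple object of the cell 2-representation labelled by `L = L_{G_R}`: it is simple in
the category `C_R(i)`, and its top as an object of `P_i(i)` is `L`. (As an object of the bigger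
category `P_i(i)` it need not be simple, and `L` need not lie in the full subcategory `C_R(i)`; if
`L` does, then `S` is `L`.) -/
def IsCellSimple {i : C} {R : ∀ j : C, ObjectProperty (i ⟶ j)} {L : (principal i).obj i}
    {h : IsCellStable R L} (S : (cellRep R L h).obj i) : Prop :=
  Simple S ∧ ∃ p : ObjectProperty.FullSubcategory.obj (P := cellProp R L i) S ⟶ L, IsSimpleTop p

end

end Fiat

set_option linter.checkUnivs true

/-! Both halves rest on one criterion, `IsPresenting`. Let Φ be an additive functor from a finitary
category to D and T an additively closed class of its objects. Suppose Φ is full on T, every object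
of D is a cokernel of some Φ(α) with α between members of T, such cokernels exist, and Hom(ΦH, -) is
exact on these presentations for H in T. Then an additive generator E of T gives a progenerator ΦE,
so D is equivalent to finitely generated modules over End(ΦE)ᵒᵖ (`IsPresenting.exists_equivalence`),
and every morphism of D is induced by a square in the source of Φ
(`IsPresenting.exists_generating`). When Φ is evaluation at an object X, these two conclusions say
that the values are module categories and that X generates.

For the principal 2-representation, evaluation at P_𝟙 is, up to isomorphism, the embedding of C(i,j)
into its Freyd category as projective objects, and T is everything.

For a cell, put P = P_𝟙, let rad K be the kernel of p : K → L, and let T consist of the 1-morphisms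
annihilating P/K, so that FP = FK maps onto FL for F in T. The central fact is
`map_kernel_comp_eq_zero`: every morphism HP → L kills H(rad K). Otherwise fullness of evaluation at
P and locality of End(G) make G(rad K) → GP epi, forcing GL = 0. By adjunction, every morphism from
FP to an object presented by values at L kills F(rad K). Hence, for F in T, FL is projective
relative to such objects, and evaluation at L is full on T.

L itself need not lie in C_R(i). It is replaced by S, the image of GL → L formed inside C_R(i). For
H in T the map Hom(HL, S) → Hom(HL, L) is bijective, so by adjunction FS ≅ FL for all F in T
(`isIso_map`), and evaluation at S is presenting.

Two points link this to the cell. The indecomposable F in T with FL ≠ 0 are exactly the members of R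
(`mem_of_ann`), so the presented objects are those of C_R. A suitable K is a minimal subobject of P
with FK = FP for one F in R; locality of End(F) gives it a simple top. -/

set_option linter.unusedSectionVars false

namespace Fiat

/-! ### Local endomorphism rings and decomposition into indecomposables -/

section Krull

/-- Fitting's argument in the commutative artinian algebra k[a]: the powers of a stabilise, x^n =
x^(n+1) y, so x^n y^n is idempotent. If it is 0 then a is nilpotent; if it is 1 then a is
invertible. -/
theorem isUnit_or_isUnit_one_sub {k E : Type*} [Field k] [Ring E] [Algebra k E] [Module.Finite k E]
    (h : ∀ e : E, e * e = e → e = 0 ∨ e = 1) (a : E) : IsUnit a ∨ IsUnit (1 - a) := by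
  let A := Algebra.adjoin k {a}
  have : IsMulCommutative A := Algebra.isMulCommutative_adjoin k (by
    rintro x hx y hy
    rw [Set.mem_singleton_iff] at hx hy
    rw [hx, hy])
  have : IsNoetherian k E := inferInstance
  have : Module.Finite k A := Module.Finite.of_injective A.val.toLinearMap Subtype.val_injective
  have : IsArtinianRing A := IsArtinianRing.of_finite k A
  let x : A := ⟨a, Algebra.self_mem_adjoin_singleton k a⟩
  obtain ⟨n, y, hy⟩ := IsArtinian.exists_pow_succ_smul_dvd x (1 : A)
  simp only [smul_eq_mul, mul_one] at hy
  have key : ∀ m, x ^ n = x ^ (n + m) * y ^ m := by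
    intro m
    induction m with
    | zero => simp
    | succ m ih =>
      rw [ih]
      calc x ^ (n + m) * y ^ m = x ^ n * (x ^ m * y ^ m) := by ring
        _ = (x ^ n.succ * y) * (x ^ m * y ^ m) := by rw [hy]
        _ = _ := by rw [Nat.succ_eq_add_one]; ring
  have hidem : (x ^ n * y ^ n) * (x ^ n * y ^ n) = x ^ n * y ^ n := by
    conv_rhs => rw [key n]
    ring
  have hval : ((x ^ n * y ^ n : A) : E) * ((x ^ n * y ^ n : A) : E) = ((x ^ n * y ^ n : A) : E) :=
    congrArg Subtype.val hidem
  rcases h _ hval with h0 | h1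
  · right
    have h0' : x ^ n * y ^ n = 0 := Subtype.ext h0
    have : x ^ n = 0 := by
      rw [key n, pow_add, mul_assoc, h0', mul_zero]
    have hn : a ^ n = 0 := congrArg Subtype.val this
    exact IsNilpotent.isUnit_one_sub ⟨n, hn⟩
  · left
    -- For n = 0 the idempotent is an empty product and says nothing; invertibility then comes from
    -- `hy` directly.
    by_cases hn : n = 0
    · subst hn
      have h2 : x * y = 1 := by simpa using hy
      have h3 : y * x = 1 := by rw [mul_comm, h2]
      exact ⟨⟨a, y, congrArg Subtype.val h2, congrArg Subtype.val h3⟩, rfl⟩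
    · obtain ⟨m, rfl⟩ := Nat.exists_eq_succ_of_ne_zero hn
      have h1' : x ^ (m + 1) * y ^ (m + 1) = 1 := Subtype.ext h1
      have h2 : x * (x ^ m * y ^ (m + 1)) = 1 := by rw [← h1']; ring
      have h3 : (x ^ m * y ^ (m + 1)) * x = 1 := by rw [← h1']; ring
      exact ⟨⟨a, _, congrArg Subtype.val h2, congrArg Subtype.val h3⟩, rfl⟩

variable {V : Type u₁} [Category.{v₁} V] [Preadditive V] [HasBinaryBiproducts V]

/-- Splitting e and 1 - e writes X as a direct sum of their images, one of which must vanish. -/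
theorem eq_zero_or_eq_id_of_indecomposable [IsIdempotentComplete V] {X : V} (hX : Indecomposable X)
    (e : X ⟶ X) (he : e ≫ e = e) : e = 0 ∨ e = 𝟙 X := by
  obtain ⟨Y, i, p, hip, hpi⟩ := IsIdempotentComplete.idempotents_split X e he
  obtain ⟨Z, j, q, hjq, hqj⟩ := IsIdempotentComplete.idempotents_split X (𝟙 X - e) (by
    simp [he])
  have hiq : i ≫ q = 0 := by
    have : (i ≫ q) ≫ j = 0 := by
      rw [Category.assoc, hqj, comp_sub, ← hpi, ← Category.assoc, hip]; simp
    calc i ≫ q = (i ≫ q) ≫ (j ≫ q) := by rw [hjq, Category.comp_id]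
      _ = ((i ≫ q) ≫ j) ≫ q := by simp
      _ = 0 := by rw [this, zero_comp]
  have hjp : j ≫ p = 0 := by
    have : (j ≫ p) ≫ i = 0 := by
      rw [Category.assoc, hpi]
      have h1 : j ≫ (𝟙 X - e) = j := by rw [← hqj, ← Category.assoc, hjq, Category.id_comp]
      rw [comp_sub, Category.comp_id] at h1
      simpa using h1
    calc j ≫ p = (j ≫ p) ≫ (i ≫ p) := by rw [hip, Category.comp_id]
      _ = ((j ≫ p) ≫ i) ≫ p := by simp
      _ = 0 := by rw [this, zero_comp]
  have f : X ≅ Y ⊞ Z :=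
    { hom := biprod.lift p q
      inv := biprod.desc i j
      hom_inv_id := by rw [biprod.lift_desc, hpi, hqj]; abel
      inv_hom_id := by
        apply biprod.hom_ext' <;> apply biprod.hom_ext <;> simp [hip, hiq, hjp, hjq] }
  rcases hX.2 Y Z f with h | h
  · left
    rw [← hpi, h.eq_of_tgt p 0, zero_comp]
  · right
    rw [h.eq_of_tgt q 0, zero_comp] at hqj
    exact (sub_eq_zero.mp hqj.symm).symm

variable (k : Type*) [Field k] [Linear k V]

theorem isIso_or_isIso_of_isIso_add [IsIdempotentComplete V] {X : V}
    [Module.Finite k (X ⟶ X)] (hX : Indecomposable X) (a b : X ⟶ X) (h : IsIso (a + b)) :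
    IsIso a ∨ IsIso b := by
  have : Module.Finite k (End X) := inferInstanceAs (Module.Finite k (X ⟶ X))
  have key := isUnit_or_isUnit_one_sub (k := k) (E := End X) (fun e he => by
    exact eq_zero_or_eq_id_of_indecomposable hX e he) (a ≫ inv (a + b))
  rcases key with h1 | h1
  · left
    have h2 : IsIso (a ≫ inv (a + b)) := (isUnit_iff_isIso _).mp h1
    exact IsIso.of_isIso_comp_right a (inv (a + b))
  · right
    have h2 : IsIso (𝟙 X - a ≫ inv (a + b)) := (isUnit_iff_isIso _).mp h1
    have h3 : 𝟙 X - a ≫ inv (a + b) = b ≫ inv (a + b) := by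
      have : (a + b) ≫ inv (a + b) = 𝟙 X := by simp
      rw [← this, add_comp]; abel
    rw [h3] at h2
    exact IsIso.of_isIso_comp_right b (inv (a + b))

/-- Induction on dim End X: End Y × End Z embeds in End (Y ⊞ Z), and both factors are nonzero when Y
and Z are, so each summand has a smaller endomorphism space. -/
theorem indecomposable_induction [HasZeroObject V]
    (hfin : ∀ X Y : V, Module.Finite k (X ⟶ Y)) (Pr : V → Prop)
    (iso : ∀ X Y, Nonempty (X ≅ Y) → Pr X → Pr Y) (zero : ∀ X, IsZero X → Pr X)
    (sum : ∀ X Y, Pr X → Pr Y → Pr (X ⊞ Y)) (indec : ∀ X, Indecomposable X → Pr X) (X : V) :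
    Pr X := by
  have key : ∀ (n : ℕ) (X : V), Module.finrank k (X ⟶ X) = n → Pr X := by
    intro n
    induction n using Nat.strong_induction_on with
    | _ n ih =>
      intro X hn
      by_cases h0 : IsZero X
      · exact zero X h0
      by_cases h1 : Indecomposable X
      · exact indec X h1
      have h2 : ∃ Y Z, ∃ _ : X ≅ Y ⊞ Z, ¬ IsZero Y ∧ ¬ IsZero Z := by
        by_contra hcon
        push Not at hcon
        refine h1 ⟨h0, fun Y Z e => ?_⟩
        by_cases hY : IsZero Y
        · exact Or.inl hY
        · exact Or.inr (hcon Y Z e hY)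
      obtain ⟨Y, Z, e, hY, hZ⟩ := h2
      have hpos : ∀ W : V, ¬ IsZero W → 0 < Module.finrank k (W ⟶ W) := by
        intro W hW
        have := hfin W W
        have : Nontrivial (W ⟶ W) := ⟨𝟙 W, 0, fun h => hW ((IsZero.iff_id_eq_zero W).mpr h)⟩
        exact Module.finrank_pos
      let φ : ((Y ⟶ Y) × (Z ⟶ Z)) →ₗ[k] (X ⟶ X) :=
        { toFun := fun f => e.hom ≫ biprod.map f.1 f.2 ≫ e.inv
          map_add' := fun f g => by
            rw [← comp_add, ← add_comp]
            congr 2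
            apply biprod.hom_ext' <;> simp
          map_smul' := fun c f => by
            simp only [RingHom.id_apply]
            rw [← Linear.comp_smul, ← Linear.smul_comp]
            congr 2
            apply biprod.hom_ext' <;> simp }
      have hφ : Function.Injective φ := by
        rintro ⟨f, g⟩ ⟨f', g'⟩ h
        have h1 : biprod.map f g = biprod.map f' g' := by
          have : e.hom ≫ biprod.map f g ≫ e.inv = e.hom ≫ biprod.map f' g' ≫ e.inv := h
          simpa using this
        have h2 := congrArg (fun z => biprod.inl ≫ z ≫ biprod.fst) h1
        have h3 := congrArg (fun z => biprod.inr ≫ z ≫ biprod.snd) h1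
        simp at h2 h3
        rw [h2, h3]
      have := hfin Y Y
      have := hfin Z Z
      have := hfin X X
      have hle := LinearMap.finrank_le_finrank_of_injective hφ
      rw [Module.finrank_prod, hn] at hle
      have hY' := hpos Y hY
      have hZ' := hpos Z hZ
      exact iso _ _ ⟨e.symm⟩ (sum _ _ (ih _ (by omega) Y rfl) (ih _ (by omega) Z rfl))
  exact key _ X rfl

end Krull

/-! ### Morita theory for a progenerator -/

section Progenerator

variable {D : Type u₁} [Category.{v₁} D] [Preadditive D] {Q : D}

/-- `P` is a direct summand of a finite direct sum of copies of `Q`. -/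
def SumRetract (Q P : D) : Prop :=
  ∃ (n : ℕ) (s : Fin n → (P ⟶ Q)) (r : Fin n → (Q ⟶ P)), ∑ a, s a ≫ r a = 𝟙 P

/-- The object `Q` behaves like a progenerator of the category `D`: every object is a cokernel of
a morphism between objects in the class `T` of direct summands of sums of copies of `Q`, the
functor `Hom(Q, -)` is exact on these presentations, and such cokernels exist. -/
structure IsProgenerator (Q : D) (T : ObjectProperty D) : Prop where
  sumRetract (P : D) : T P → SumRetract Q P
  power (n : ℕ) : ∃ (P : D) (ι : Fin n → (Q ⟶ P)) (π : Fin n → (P ⟶ Q)), T P ∧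
    (∀ a b, ι a ≫ π b = if a = b then 𝟙 Q else 0) ∧ ∑ a, π a ≫ ι a = 𝟙 P
  presentation (X : D) : ∃ (P₁ P₀ : D) (α : P₁ ⟶ P₀) (π : P₀ ⟶ X) (w : α ≫ π = 0),
    T P₁ ∧ T P₀ ∧ Nonempty (IsColimit (CokernelCofork.ofπ π w))
  lift {P₁ P₀ X : D} (α : P₁ ⟶ P₀) (π : P₀ ⟶ X) (w : α ≫ π = 0) : T P₁ → T P₀ →
    Nonempty (IsColimit (CokernelCofork.ofπ π w)) → ∀ f : Q ⟶ X, ∃ g : Q ⟶ P₀, g ≫ π = f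
  exact {P₁ P₀ X : D} (α : P₁ ⟶ P₀) (π : P₀ ⟶ X) (w : α ≫ π = 0) : T P₁ → T P₀ →
    Nonempty (IsColimit (CokernelCofork.ofπ π w)) → ∀ g : Q ⟶ P₀, g ≫ π = 0 →
      ∃ h : Q ⟶ P₁, h ≫ α = g
  hasCokernel {P₁ P₀ : D} (α : P₁ ⟶ P₀) : T P₁ → T P₀ → HasCokernel α

namespace IsProgenerator

variable {T : ObjectProperty D} (hQ : IsProgenerator Q T)

include hQ

theorem separates {X Y : D} (f : X ⟶ Y) (h : ∀ x : Q ⟶ X, x ≫ f = 0) : f = 0 := by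
  obtain ⟨P₁, P₀, α, π, w, h₁, h₀, ⟨hc⟩⟩ := hQ.presentation X
  have : Epi π := Cofork.IsColimit.epi hc
  obtain ⟨n, s, r, hsr⟩ := hQ.sumRetract P₀ h₀
  rw [← cancel_epi π, comp_zero, ← Category.id_comp (π ≫ f), ← hsr, sum_comp]
  refine Finset.sum_eq_zero fun a _ => ?_
  rw [Category.assoc, ← Category.assoc (r a), h, comp_zero]

/-- Fullness of Hom(Q, -). Since P₀ is a summand of a sum of copies of Q, θ prescribes a morphism P₀
→ Y; it kills α because this can be tested on morphisms Q → P₁, so it descends to X. -/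
theorem exists_of_linearMap {X Y : D} (θ : (Q ⟶ X) →ₗ[(End Q)ᵐᵒᵖ] (Q ⟶ Y)) :
    ∃ f : X ⟶ Y, ∀ x : Q ⟶ X, x ≫ f = θ x := by
  have hθ : ∀ (c : Q ⟶ Q) (x : Q ⟶ X), θ (c ≫ x) = c ≫ θ x := fun c x =>
    θ.map_smul (MulOpposite.op (c : End Q)) x
  obtain ⟨P₁, P₀, α, π, w, h₁, h₀, ⟨hc⟩⟩ := hQ.presentation X
  obtain ⟨n, s, r, hsr⟩ := hQ.sumRetract P₀ h₀
  have hsum : ∀ x : Q ⟶ P₀, x ≫ ∑ a, s a ≫ θ (r a ≫ π) = θ (x ≫ π) := by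
    intro x
    rw [comp_sum]
    have : x ≫ π = ∑ a, (x ≫ s a) ≫ r a ≫ π := by
      conv_lhs => rw [← Category.id_comp π, ← hsr, sum_comp, comp_sum]
      simp
    rw [this, map_sum]
    refine Finset.sum_congr rfl fun a _ => ?_
    rw [hθ, Category.assoc]
  have hz : α ≫ ∑ a, s a ≫ θ (r a ≫ π) = 0 := by
    obtain ⟨n₁, s₁, r₁, hsr₁⟩ := hQ.sumRetract P₁ h₁
    rw [← Category.id_comp (α ≫ _), ← hsr₁, sum_comp]
    refine Finset.sum_eq_zero fun a _ => ?_
    have := hsum (r₁ a ≫ α)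
    simp only [Category.assoc] at this ⊢
    rw [this, w, comp_zero, map_zero, comp_zero]
  refine ⟨hc.desc (CokernelCofork.ofπ _ hz), fun x => ?_⟩
  obtain ⟨g, rfl⟩ := hQ.lift α π w h₁ h₀ ⟨hc⟩ x
  have hfac : π ≫ hc.desc (CokernelCofork.ofπ _ hz) = _ := hc.fac _ WalkingParallelPair.one
  rw [Category.assoc, hfac]
  exact hsum g

theorem finite_hom (X : D) : Module.Finite (End Q)ᵐᵒᵖ (Q ⟶ X) := by
  classical
  obtain ⟨P₁, P₀, α, π, w, h₁, h₀, hc⟩ := hQ.presentation X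
  obtain ⟨n, s, r, hsr⟩ := hQ.sumRetract P₀ h₀
  refine ⟨⟨Finset.univ.image fun a => r a ≫ π, ?_⟩⟩
  rw [eq_top_iff]
  intro x _
  obtain ⟨g, rfl⟩ := hQ.lift α π w h₁ h₀ hc x
  have : g ≫ π = ∑ a, MulOpposite.op (show End Q from g ≫ s a) • (r a ≫ π) := by
    conv_lhs => rw [← Category.id_comp π, ← hsr, sum_comp, comp_sum]
    refine Finset.sum_congr rfl fun a _ => ?_
    change _ = (g ≫ s a) ≫ (r a ≫ π)
    simp
  rw [this]
  exact Submodule.sum_mem _ fun a _ => Submodule.smul_mem _ _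
    (Submodule.subset_span (by simp))

/-- Essential surjectivity of Hom(Q, -). A presentation Aᵐ → Aⁿ → Y → 0 exists because A is
noetherian; its matrix is a morphism α between sums of copies of Q, and exactness of Hom(Q, -)
identifies Hom(Q, coker α) with Y. -/
theorem exists_linearEquiv [IsNoetherianRing (End Q)ᵐᵒᵖ] (Y : Type v₁) [AddCommGroup Y]
    [Module (End Q)ᵐᵒᵖ Y] [Module.Finite (End Q)ᵐᵒᵖ Y] :
    ∃ X : D, Nonempty ((Q ⟶ X) ≃ₗ[(End Q)ᵐᵒᵖ] Y) := by
  classical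
  let A := (End Q)ᵐᵒᵖ
  obtain ⟨n, p, hp⟩ := Module.Finite.exists_fin' A Y
  have : Module.Finite A (LinearMap.ker p) := inferInstance
  obtain ⟨m, q, hq⟩ := Module.Finite.exists_fin' A (LinearMap.ker p)
  obtain ⟨P₀, ι, π, hT, hιπ, hπι⟩ := hQ.power n
  obtain ⟨P₁, ι₁, π₁, hT₁, hιπ₁, hπι₁⟩ := hQ.power m
  -- coordinates
  let e : (Q ⟶ P₀) →ₗ[A] (Fin n → A) :=
    { toFun := fun x a => MulOpposite.op (show End Q from x ≫ π a)
      map_add' := fun x y => by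
        funext a
        exact congrArg MulOpposite.op (add_comp _ _ _ x y (π a))
      map_smul' := fun c x => by
        funext a
        exact congrArg MulOpposite.op (Category.assoc (MulOpposite.unop c : Q ⟶ Q) x (π a)) }
  have he : Function.Surjective e := by
    intro c
    refine ⟨∑ a, (MulOpposite.unop (c a) : Q ⟶ Q) ≫ ι a, ?_⟩
    funext b
    change MulOpposite.op (show End Q from (∑ a, (MulOpposite.unop (c a) : Q ⟶ Q) ≫ ι a) ≫ π b) = _
    have : (∑ a, (MulOpposite.unop (c a) : Q ⟶ Q) ≫ ι a) ≫ π b = MulOpposite.unop (c b) := by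
      rw [sum_comp, Finset.sum_eq_single b]
      · rw [Category.assoc, hιπ, if_pos rfl, Category.comp_id]
      · intro a _ hab
        rw [Category.assoc, hιπ, if_neg hab, comp_zero]
      · simp
    rw [this]
    rfl
  have he' : ∀ x, e x = 0 → x = 0 := by
    intro x hx
    rw [← Category.comp_id x, ← hπι, comp_sum]
    refine Finset.sum_eq_zero fun a _ => ?_
    have : x ≫ π a = 0 := congrArg MulOpposite.unop (congrFun hx a)
    rw [← Category.assoc, this, zero_comp]
  have hei : Function.Injective e := (injective_iff_map_eq_zero e).mpr he'
  choose ρ hρ using fun b : Fin m => he ((q (Pi.single b 1) : LinearMap.ker p) : Fin n → A)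
  let α : P₁ ⟶ P₀ := ∑ b, π₁ b ≫ ρ b
  -- the image of `Hom(Q, α)` is the kernel of `p ∘ e`
  have hα : ∀ y : Q ⟶ P₁, e (y ≫ α) =
      (q (fun b => MulOpposite.op (show End Q from y ≫ π₁ b)) : LinearMap.ker p) := by
    intro y
    have h1 : (fun b => MulOpposite.op (show End Q from y ≫ π₁ b) : Fin m → A) =
        ∑ b, MulOpposite.op (show End Q from y ≫ π₁ b) • Pi.single b (1 : A) := by
      funext c
      rw [Finset.sum_apply, Finset.sum_eq_single c]
      · simp
      · intro b _ hb; simp [hb.symm]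
      · simp
    rw [h1, map_sum, Submodule.coe_sum]
    have h2 : y ≫ α = ∑ b, MulOpposite.op (show End Q from y ≫ π₁ b) • ρ b := by
      simp only [α, comp_sum]
      refine Finset.sum_congr rfl fun b _ => ?_
      exact (Category.assoc _ _ _).symm
    rw [h2, map_sum]
    refine Finset.sum_congr rfl fun b _ => ?_
    rw [map_smul, map_smul, hρ]
    rfl
  have := hQ.hasCokernel α hT₁ hT
  have hcol : Nonempty (IsColimit (CokernelCofork.ofπ (cokernel.π α) (cokernel.condition α))) :=
    ⟨cokernelIsCokernel α⟩
  refine ⟨cokernel α, ⟨?_⟩⟩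
  let r : (Q ⟶ P₀) →ₗ[A] (Q ⟶ cokernel α) := ((preadditiveCoyonedaObj Q).map (cokernel.π α)).hom
  have hr : Function.Surjective r := fun f =>
    hQ.lift α _ _ hT₁ hT hcol f
  have hker : LinearMap.ker r = LinearMap.ker (p ∘ₗ e) := by
    ext x
    rw [LinearMap.mem_ker, LinearMap.mem_ker]
    constructor
    · intro hx
      obtain ⟨y, rfl⟩ := hQ.exact α _ _ hT₁ hT hcol x hx
      rw [LinearMap.comp_apply, hα]
      exact (q _).2
    · intro hx
      obtain ⟨c, hc⟩ := hq ⟨e x, hx⟩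
      let y : Q ⟶ P₁ := ∑ b, (MulOpposite.unop (c b) : Q ⟶ Q) ≫ ι₁ b
      have hy : (fun b => MulOpposite.op (show End Q from y ≫ π₁ b)) = c := by
        funext b
        have : y ≫ π₁ b = MulOpposite.unop (c b) := by
          simp only [y]
          rw [sum_comp, Finset.sum_eq_single b]
          · rw [Category.assoc, hιπ₁, if_pos rfl, Category.comp_id]
          · intro a _ hab
            rw [Category.assoc, hιπ₁, if_neg hab, comp_zero]
          · simp
        rw [this]
        rfl
      have : x = y ≫ α := hei (by rw [hα, hy, hc])
      rw [this]
      change (y ≫ α) ≫ cokernel.π α = 0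
      rw [Category.assoc, cokernel.condition, comp_zero]
  exact ((r.quotKerEquivOfSurjective hr).symm.trans (Submodule.quotEquivOfEq _ _ hker)).trans
    ((p ∘ₗ e).quotKerEquivOfSurjective (hp.comp he))

/-- The functor represented by a progenerator, with values in finitely generated modules. -/
noncomputable def toFG : D ⥤ FGModuleCat.{v₁} (End Q)ᵐᵒᵖ :=
  (ModuleCat.isFG _).lift (preadditiveCoyonedaObj Q) hQ.finite_hom

theorem isEquivalence_toFG [IsNoetherianRing (End Q)ᵐᵒᵖ] : hQ.toFG.IsEquivalence where
  faithful := ⟨fun {X Y f g} h => by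
    rw [← sub_eq_zero]
    refine hQ.separates _ fun x => ?_
    have h1 : ((preadditiveCoyonedaObj Q).map f).hom x = ((preadditiveCoyonedaObj Q).map g).hom x :=
      congrArg (fun z => z.hom.hom x) h
    rw [comp_sub]
    exact sub_eq_zero.mpr h1⟩
  full := ⟨fun {X Y} φ => by
    obtain ⟨f, hf⟩ := hQ.exists_of_linearMap φ.hom.hom
    refine ⟨f, ?_⟩
    apply FGModuleCat.hom_ext
    ext x
    exact hf x⟩
  essSurj := ⟨fun Y => by
    obtain ⟨X, ⟨e⟩⟩ := hQ.exists_linearEquiv Y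
    exact ⟨X, ⟨(ModuleCat.isFG _).isoMk e.toModuleIso⟩⟩⟩

/-- D is only preadditive, so End Q carries no scalars of its own: its k-structure and its finite
dimension are both inherited from B along the surjection φ. -/
theorem exists_equivalence {k B : Type*} [Field k] [Ring B] [Algebra k B] [Module.Finite k B]
    (φ : B →+* End Q) (hφ : Function.Surjective φ) :
    ∃ (A : Type v₁) (_ : Ring A) (_ : Algebra k A), Module.Finite k A ∧
      Nonempty (D ≌ FGModuleCat.{v₁} A) := by
  let _ : Algebra k (End Q) := (φ.comp (algebraMap k B)).toAlgebra' fun c x => by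
    obtain ⟨b, rfl⟩ := hφ x
    change φ (algebraMap k B c) * φ b = φ b * φ (algebraMap k B c)
    rw [← map_mul, ← map_mul, Algebra.commutes]
  let ψ : B →ₐ[k] End Q := { φ with commutes' := fun c => rfl }
  have h1 : Module.Finite k (End Q) := Module.Finite.of_surjective ψ.toLinearMap hφ
  have h2 : Module.Finite k (End Q)ᵐᵒᵖ := Module.Finite.equiv (MulOpposite.opLinearEquiv k)
  have h3 : IsNoetherianRing (End Q)ᵐᵒᵖ := IsNoetherianRing.of_finite k _
  have := hQ.isEquivalence_toFG
  exact ⟨(End Q)ᵐᵒᵖ, inferInstance, inferInstance, h2, ⟨hQ.toFG.asEquivalence⟩⟩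

end IsProgenerator

end Progenerator

/-! ### Abelian categories of finite length -/

section FiniteLength

/-- A preadditive category is an abelian category all of whose objects have finite length. -/
class IsFiniteLength (D : Type u₁) [Category.{v₁} D] [Preadditive D] : Prop where
  hasFiniteProducts : HasFiniteProducts D
  hasKernels : HasKernels D
  hasCokernels : HasCokernels D
  isNormalMono : IsNormalMonoCategory D
  isNormalEpi : IsNormalEpiCategory D
  isNoetherian (X : D) : IsNoetherianObject X
  isArtinian (X : D) : IsArtinianObject X

attribute [instance] IsFiniteLength.isNoetherian IsFiniteLength.isArtinian

/-- The abelian structure of a category of finite length. -/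
@[reducible]
def IsFiniteLength.abelian (D : Type u₁) [Category.{v₁} D] [Preadditive D] [h : IsFiniteLength D] :
    Abelian D where
  toIsNormalMonoCategory := h.isNormalMono
  toIsNormalEpiCategory := h.isNormalEpi
  has_finite_products := h.hasFiniteProducts
  has_kernels := h.hasKernels
  has_cokernels := h.hasCokernels

instance (priority := 50) (D : Type u₁) [Category.{v₁} D] [Preadditive D] [IsFiniteLength D] :
    Abelian D := IsFiniteLength.abelian D

section

variable {D : Type u₁} [Category.{v₁} D] {A : Type v₂} [Ring A] (e : D ⥤ FGModuleCat.{v₁} A)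

/-- The submodule underlying the image of a subobject. -/
noncomputable def submoduleOfSubobject {X : D} (S : Subobject X) : Submodule A (e.obj X) :=
  LinearMap.range (e.map S.arrow).hom.hom

/-- If S ≤ T had the same image, inverting the injection given by S would produce a module map from
T to S over X; lifting it along the equivalence gives T ≤ S. Chain conditions thus pass from
submodules to subobjects. -/
theorem submoduleOfSubobject_strictMono [IsNoetherianRing A] [e.IsEquivalence] (X : D) :
    StrictMono (submoduleOfSubobject e (X := X)) := by
  intro S T hST
  have hfac : e.map (S.ofLE T hST.le) ≫ e.map T.arrow = e.map S.arrow := by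
    rw [← e.map_comp, Subobject.ofLE_arrow]
  refine lt_of_le_of_ne ?_ fun heq => ?_
  · rintro _ ⟨x, rfl⟩
    exact ⟨(e.map (S.ofLE T hST.le)).hom.hom x, congrArg (fun z => z.hom.hom x) hfac⟩
  · have hmono : Mono (e.map S.arrow) := inferInstance
    have hinj : Function.Injective (e.map S.arrow).hom.hom :=
      (ModuleCat.mono_iff_injective _).mp
        (inferInstanceAs (Mono ((forget₂ (FGModuleCat A) (ModuleCat A)).map (e.map S.arrow))))
    let g := LinearEquiv.ofInjective _ hinj
    let t : (e.obj (T : D)) →ₗ[A] (e.obj (S : D)) :=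
      g.symm.toLinearMap ∘ₗ (e.map T.arrow).hom.hom.codRestrict _ (fun x => by
        change _ ∈ submoduleOfSubobject e S
        rw [heq]
        exact ⟨x, rfl⟩)
    have ht : ∀ x, (e.map S.arrow).hom.hom (t x) = (e.map T.arrow).hom.hom x := fun x =>
      congrArg Subtype.val (g.apply_symm_apply _)
    obtain ⟨s, hs⟩ := e.map_surjective
      (show e.obj (T : D) ⟶ e.obj (S : D) from ⟨ModuleCat.ofHom t⟩)
    have : s ≫ S.arrow = T.arrow := by
      apply e.map_injective
      rw [e.map_comp, hs]
      apply FGModuleCat.hom_ext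
      ext x
      exact ht x
    exact hST.not_ge (Subobject.le_of_comm s this)

theorem isFiniteLength_of_isEquivalence [Preadditive D] [IsNoetherianRing A] [IsArtinianRing A]
    [e.IsEquivalence] : IsFiniteLength D := by
  have hp : HasFiniteProducts D :=
    ⟨fun n => Adjunction.hasLimitsOfShape_of_equivalence e⟩
  let hA := abelianOfEquivalence e
  exact
    { hasFiniteProducts := hp
      hasKernels := hA.has_kernels
      hasCokernels := hA.has_cokernels
      isNormalMono := hA.toIsNormalMonoCategory
      isNormalEpi := hA.toIsNormalEpiCategory
      isNoetherian := fun X => ⟨(submoduleOfSubobject_strictMono e X).wellFoundedGT⟩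
      isArtinian := fun X => by
        have : IsArtinian A (e.obj X) := isArtinian_of_fg_of_artinian'
        exact ⟨(submoduleOfSubobject_strictMono e X).wellFoundedLT⟩ }

end

variable {D : Type u₁} [Category.{v₁} D]

/-- The quotient by a maximal proper subobject S. For a nonzero quotient f of X/S, the kernel of X →
X/S → Z contains S and is proper, hence equals S, so f is mono. -/
theorem exists_epi_simple [Abelian D] (X : D) [IsNoetherianObject X] (hX : ¬ IsZero X) :
    ∃ (L : D) (p : X ⟶ L), Epi p ∧ Simple L := by
  have := Subobject.nontrivial_of_not_isZero hX
  obtain ⟨S, hS, hmax⟩ := (inferInstance : WellFoundedGT (Subobject X)).wf.has_min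
    {S | S ≠ ⊤} ⟨⊥, bot_ne_top⟩
  refine ⟨cokernel S.arrow, cokernel.π S.arrow, inferInstance, simple_of_cosimple _ ?_⟩
  intro Z f hf
  constructor
  · rintro h rfl
    apply hS
    have h0 : cokernel.π S.arrow = 0 := by
      have h1 : IsZero (cokernel S.arrow) := by
        rw [IsZero.iff_id_eq_zero, ← cancel_mono (0 : cokernel S.arrow ⟶ Z), comp_zero, comp_zero]
      exact h1.eq_of_tgt _ _
    have := Abelian.epi_of_cokernel_π_eq_zero _ h0
    have := isIso_of_mono_of_epi S.arrow
    exact Subobject.eq_top_of_isIso_arrow S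
  · intro hf0
    have hker : S = kernelSubobject (cokernel.π S.arrow ≫ f) := by
      have hle : S ≤ kernelSubobject (cokernel.π S.arrow ≫ f) :=
        le_kernelSubobject _ _ (by simp)
      by_contra hne
      refine hmax (kernelSubobject (cokernel.π S.arrow ≫ f)) (fun htop => hf0 ?_)
        (lt_of_le_of_ne hle hne)
      rw [← cancel_epi (cokernel.π S.arrow), comp_zero]
      have h2 : IsIso (kernelSubobject (cokernel.π S.arrow ≫ f)).arrow := by
        rw [Subobject.isIso_arrow_iff_eq_top, htop]
      rw [← cancel_epi (kernelSubobject (cokernel.π S.arrow ≫ f)).arrow, comp_zero,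
        kernelSubobject_arrow_comp]
    have : Mono f := by
      refine mono_of_cancel_zero _ fun {W} x hx => ?_
      obtain ⟨W', w, hw, y, hy⟩ := surjective_up_to_refinements_of_epi (cokernel.π S.arrow) x
      have hy0 : y ≫ cokernel.π S.arrow ≫ f = 0 := by
        rw [← Category.assoc, ← hy, Category.assoc, hx, comp_zero]
      have hfac : S.Factors y := by
        rw [hker, kernelSubobject_factors_iff]
        exact hy0
      rw [← cancel_epi w, comp_zero, hy, ← Subobject.factorThru_arrow S y hfac, Category.assoc,
        cokernel.condition, comp_zero]
    exact isIso_of_mono_of_epi f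

end FiniteLength

/-! ### Additively closed classes and their additive generators -/

section AdditiveClosure

variable {V : Type u₁} [Category.{v₁} V] [Preadditive V]

theorem SumRetract.of_fintype {Q P : V} {ι : Type*} [Fintype ι] (s : ι → (P ⟶ Q)) (r : ι → (Q ⟶ P))
    (h : ∑ a, s a ≫ r a = 𝟙 P) : SumRetract Q P := by
  classical
  refine ⟨Fintype.card ι, fun a => s ((Fintype.equivFin ι).symm a),
    fun a => r ((Fintype.equivFin ι).symm a), ?_⟩
  rw [← h]
  exact Equiv.sum_comp (Fintype.equivFin ι).symm fun a => s a ≫ r a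

theorem SumRetract.map {D : Type u₂} [Category.{v₂} D] [Preadditive D] (Φ : V ⥤ D) [Φ.Additive]
    {Q P : V} (h : SumRetract Q P) : SumRetract (Φ.obj Q) (Φ.obj P) := by
  obtain ⟨n, s, r, h⟩ := h
  refine ⟨n, fun a => Φ.map (s a), fun a => Φ.map (r a), ?_⟩
  rw [← Φ.map_id, ← h, Φ.map_sum]
  simp

/-- The class `T` is closed under finite direct sums and direct summands. -/
def IsAdditivelyClosed (T : ObjectProperty V) : Prop :=
  ∀ (H : V) (n : ℕ) (f : Fin n → V) (s : ∀ a, H ⟶ f a) (r : ∀ a, f a ⟶ H),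
    (∀ a, T (f a)) → ∑ a, s a ≫ r a = 𝟙 H → T H

namespace IsAdditivelyClosed

variable {T : ObjectProperty V} (hT : IsAdditivelyClosed T)

include hT

theorem of_retract {H G : V} (r : Retract G H) (h : T H) : T G :=
  hT G 1 (fun _ => H) (fun _ => r.i) (fun _ => r.r) (fun _ => h) (by simp)

theorem of_iso {H G : V} (e : H ≅ G) (h : T H) : T G :=
  hT.of_retract ⟨e.inv, e.hom, e.inv_hom_id⟩ h

theorem of_isZero {H : V} (h : IsZero H) : T H :=
  hT H 0 (fun a => a.elim0) (fun a => a.elim0) (fun a => a.elim0) (fun a => a.elim0)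
    (h.eq_of_src _ _)

theorem of_fintype {H : V} {ι : Type*} [Fintype ι] (f : ι → V) (s : ∀ a, H ⟶ f a)
    (r : ∀ a, f a ⟶ H) (hf : ∀ a, T (f a)) (h : ∑ a, s a ≫ r a = 𝟙 H) : T H := by
  classical
  refine hT H (Fintype.card ι) (fun a => f ((Fintype.equivFin ι).symm a))
    (fun a => s ((Fintype.equivFin ι).symm a)) (fun a => r ((Fintype.equivFin ι).symm a))
    (fun a => hf _) ?_
  rw [← h]
  exact Equiv.sum_comp (Fintype.equivFin ι).symm fun a => s a ≫ r a

theorem of_biproduct [HasFiniteBiproducts V] {ι : Type} [Fintype ι] (f : ι → V)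
    (hf : ∀ a, T (f a)) : T (⨁ f) := by
  classical
  exact hT.of_fintype f (fun a => biproduct.π f a) (fun a => biproduct.ι f a) hf
    biproduct.total

theorem of_biprod [HasBinaryBiproducts V] {X Y : V} (hX : T X) (hY : T Y) : T (X ⊞ Y) :=
  hT _ 2 (Fin.cons X (Fin.cons Y (fun a => a.elim0)))
    (Fin.cons biprod.fst (Fin.cons biprod.snd (fun a => a.elim0)))
    (Fin.cons biprod.inl (Fin.cons biprod.inr (fun a => a.elim0)))
    (Fin.forall_fin_two.mpr ⟨hX, hY⟩) (by
      rw [Fin.sum_univ_two]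
      exact biprod.total)

end IsAdditivelyClosed

theorem sumRetract_isAdditivelyClosed (Q : V) : IsAdditivelyClosed (SumRetract Q) := by
  intro H n f s r hf h
  choose m s' r' h' using hf
  refine SumRetract.of_fintype (ι := Σ a, Fin (m a)) (fun x => s x.1 ≫ s' x.1 x.2)
    (fun x => r' x.1 x.2 ≫ r x.1) ?_
  rw [Fintype.sum_sigma, ← h]
  refine Finset.sum_congr rfl fun a _ => ?_
  rw [← Category.id_comp (r a), ← h' a, sum_comp, comp_sum]
  simp

theorem hasFiniteBiproducts_of_binary [HasZeroObject V] [HasBinaryBiproducts V] :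
    HasFiniteBiproducts V := by
  have : HasTerminal V := HasZeroObject.hasTerminal
  have : HasFiniteProducts V := hasFiniteProducts_of_has_binary_and_terminal
  exact HasFiniteBiproducts.of_hasFiniteProducts

/-- A preadditive category over a field which is additive and idempotent complete, with finite
dimensional morphism spaces and finitely many indecomposable objects. -/
class IsFinitaryCategory (k : Type*) [Field k] (V : Type u₁) [Category.{v₁} V] [Preadditive V]
    [Linear k V] [HasBinaryBiproducts V] : Prop where
  idem : IsIdempotentComplete V
  fin (X Y : V) : Module.Finite k (X ⟶ Y)
  indec : ∃ s : Set V, s.Finite ∧ ∀ F : V, Indecomposable F → ∃ G ∈ s, Nonempty (F ≅ G)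

variable (k : Type*) [Field k] [Linear k V] [HasZeroObject V] [HasBinaryBiproducts V]
  [hV : IsFinitaryCategory k V]

include k hV

/-- The objects of an additively closed class are the summands of sums of copies of one of them. -/
theorem exists_sumRetract {T : ObjectProperty V} (hT : IsAdditivelyClosed T) :
    ∃ E : V, T E ∧ ∀ H, T H → SumRetract E H := by
  classical
  have := hasFiniteBiproducts_of_binary (V := V)
  obtain ⟨s, hs, hind⟩ := hV.indec
  -- The generator is the direct sum of the chosen representatives that belong to T.
  let t : Set V := {G ∈ s | T G}
  have ht : t.Finite := hs.subset fun _ h => h.1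
  obtain ⟨n, f, hf⟩ : ∃ (n : ℕ) (f : Fin n → V), Set.range f = t := by
    have := ht.fintype
    exact ⟨Fintype.card t, fun a => ((Fintype.equivFin t).symm a : V), by
      ext x
      constructor
      · rintro ⟨a, rfl⟩
        exact ((Fintype.equivFin t).symm a).2
      · intro hx
        exact ⟨Fintype.equivFin t ⟨x, hx⟩, by simp⟩⟩
  refine ⟨⨁ f, hT.of_biproduct f fun a => ?_, ?_⟩
  · have : f a ∈ t := hf ▸ Set.mem_range_self a
    exact this.2
  · have hcl := sumRetract_isAdditivelyClosed (⨁ f)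
    refine indecomposable_induction k hV.fin (fun H => T H → SumRetract (⨁ f) H) ?_ ?_ ?_ ?_
    · rintro X Y ⟨e⟩ hX hY
      exact hcl.of_iso e (hX (hT.of_iso e.symm hY))
    · exact fun X hX _ => hcl.of_isZero hX
    · intro X Y hX hY hXY
      refine hcl.of_biprod (hX (hT.of_retract ⟨biprod.inl, biprod.fst, by simp⟩ hXY))
        (hY (hT.of_retract ⟨biprod.inr, biprod.snd, by simp⟩ hXY))
    · intro X hX hTX
      obtain ⟨G, hG, ⟨e⟩⟩ := hind X hX
      have hGt : G ∈ t := ⟨hG, hT.of_iso e hTX⟩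
      rw [← hf] at hGt
      obtain ⟨a, rfl⟩ := hGt
      refine ⟨1, fun _ => e.hom ≫ biproduct.ι f a, fun _ => biproduct.π f a ≫ e.inv, ?_⟩
      simp

end AdditiveClosure

/-! ### The presenting criterion and its two consequences -/

section Presenting

variable {V : Type u₁} [Category.{v₁} V] [Preadditive V] {D : Type u₂} [Category.{v₂} D]
  [Preadditive D]

/-- The category `D` consists of the cokernels of the images under `Φ` of morphisms between
objects in the class `T`, and these images behave like projective objects of `D`. -/
structure IsPresenting (Φ : V ⥤ D) (T : ObjectProperty V) : Prop where
  full {H H' : V} : T H → T H' → ∀ φ : Φ.obj H ⟶ Φ.obj H', ∃ α : H ⟶ H', Φ.map α = φ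
  presentation (Z : D) : ∃ (H₁ H₀ : V) (α : H₁ ⟶ H₀) (π : Φ.obj H₀ ⟶ Z) (w : Φ.map α ≫ π = 0),
    T H₁ ∧ T H₀ ∧ Nonempty (IsColimit (CokernelCofork.ofπ π w))
  lift {H H₁ H₀ : V} {Z : D} (α : H₁ ⟶ H₀) (π : Φ.obj H₀ ⟶ Z) (w : Φ.map α ≫ π = 0) :
    T H → T H₁ → T H₀ → Nonempty (IsColimit (CokernelCofork.ofπ π w)) →
    ∀ f : Φ.obj H ⟶ Z, ∃ g : Φ.obj H ⟶ Φ.obj H₀, g ≫ π = f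
  exact {H H₁ H₀ : V} {Z : D} (α : H₁ ⟶ H₀) (π : Φ.obj H₀ ⟶ Z) (w : Φ.map α ≫ π = 0) :
    T H → T H₁ → T H₀ → Nonempty (IsColimit (CokernelCofork.ofπ π w)) →
    ∀ g : Φ.obj H ⟶ Φ.obj H₀, g ≫ π = 0 → ∃ h : Φ.obj H ⟶ Φ.obj H₁, h ≫ Φ.map α = g
  hasCokernel {H₁ H₀ : V} (α : H₁ ⟶ H₀) : T H₁ → T H₀ → HasCokernel (Φ.map α)

namespace IsPresenting

variable {Φ : V ⥤ D} {T : ObjectProperty V} (h : IsPresenting Φ T)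
  (k : Type*) [Field k] [Linear k V] [HasZeroObject V] [HasBinaryBiproducts V]
  [hV : IsFinitaryCategory k V] [Φ.Additive]

include h k hV

/-- If E is an additive generator of T, then ΦE is a progenerator of D; fullness makes End E → End
ΦE surjective, which supplies the finite-dimensional algebra. -/
theorem exists_equivalence (hT : IsAdditivelyClosed T) :
    ∃ (A : Type v₂) (_ : Ring A) (_ : Algebra k A), Module.Finite k A ∧
      Nonempty (D ≌ FGModuleCat.{v₂} A) := by
  classical
  have := hasFiniteBiproducts_of_binary (V := V)
  obtain ⟨E, hE, hsum⟩ := exists_sumRetract k hT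
  have hQ : IsProgenerator (Φ.obj E) (fun P => ∃ H, T H ∧ Φ.obj H = P) :=
    { sumRetract := by
        rintro _ ⟨H, hH, rfl⟩
        exact (hsum H hH).map Φ
      power := fun n => by
        refine ⟨Φ.obj (⨁ fun _ : Fin n => E), fun a => Φ.map (biproduct.ι (fun _ : Fin n => E) a),
          fun a => Φ.map (biproduct.π (fun _ : Fin n => E) a),
          ⟨_, hT.of_biproduct _ fun _ => hE, rfl⟩, ?_, ?_⟩
        · intro a b
          rw [← Φ.map_comp, biproduct.ι_π]
          split_ifs with hab
          · subst hab; simp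
          · simp
        · rw [← Φ.map_id, ← biproduct.total, Φ.map_sum]
          simp
      presentation := fun X => by
        obtain ⟨H₁, H₀, α, π, w, h₁, h₀, hc⟩ := h.presentation X
        exact ⟨_, _, Φ.map α, π, w, ⟨_, h₁, rfl⟩, ⟨_, h₀, rfl⟩, hc⟩
      lift := by
        rintro _ _ X α π w ⟨H₁, h₁, rfl⟩ ⟨H₀, h₀, rfl⟩ hc f
        obtain ⟨α, rfl⟩ := h.full h₁ h₀ α
        exact h.lift α π w hE h₁ h₀ hc f
      exact := by
        rintro _ _ X α π w ⟨H₁, h₁, rfl⟩ ⟨H₀, h₀, rfl⟩ hc f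
        obtain ⟨α, rfl⟩ := h.full h₁ h₀ α
        exact h.exact α π w hE h₁ h₀ hc f
      hasCokernel := by
        rintro _ _ α ⟨H₁, h₁, rfl⟩ ⟨H₀, h₀, rfl⟩
        obtain ⟨α, rfl⟩ := h.full h₁ h₀ α
        exact h.hasCokernel α h₁ h₀ }
  have hfin : Module.Finite k (End E) := hV.fin E E
  exact hQ.exists_equivalence (k := k) (B := End E)
    { toFun := fun x => Φ.map x
      map_one' := Φ.map_id E
      map_mul' := fun x y => Φ.map_comp y x
      map_zero' := Φ.map_zero E E
      map_add' := fun _ _ => Φ.map_add } (fun φ => h.full hE hE φ)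

omit h in
-- The morphisms H → J killed by Φ form a finite-dimensional space. A finite spanning family,
-- assembled into one morphism from a sum of copies of H, is universal among them.
theorem exists_map_vanishing (Φ : V ⥤ D) [Φ.Additive] (H J : V) :
    ∃ (X : V) (w : X ⟶ J), Φ.map w = 0 ∧
      ∀ γ : H ⟶ J, Φ.map γ = 0 → ∃ δ : H ⟶ X, δ ≫ w = γ := by
  classical
  have := hasFiniteBiproducts_of_binary (V := V)
  have := hV.fin H J
  let N : Submodule k (H ⟶ J) :=
    { carrier := {γ | Φ.map γ = 0}
      add_mem' := fun {a b} ha hb => by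
        have ha' : Φ.map a = 0 := ha
        have hb' : Φ.map b = 0 := hb
        change Φ.map (a + b) = 0
        rw [Φ.map_add, ha', hb', add_zero]
      zero_mem' := Φ.map_zero _ _
      smul_mem' := fun c a ha => by
        have ha' : Φ.map a = 0 := ha
        change Φ.map (c • a) = 0
        rw [← Category.id_comp a, ← Linear.smul_comp, Φ.map_comp, ha', comp_zero] }
  obtain ⟨n, p, hp⟩ := Module.Finite.exists_fin' k N
  let g : Fin n → (H ⟶ J) := fun a => (p (Pi.single a 1) : N)
  refine ⟨⨁ fun _ : Fin n => H, biproduct.desc g, ?_, ?_⟩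
  · rw [← Category.id_comp (biproduct.desc g), ← biproduct.total, Preadditive.sum_comp, Φ.map_sum]
    refine Finset.sum_eq_zero fun a _ => ?_
    rw [Category.assoc, biproduct.ι_desc, Φ.map_comp]
    have : Φ.map (g a) = 0 := (p (Pi.single a 1)).2
    rw [this, comp_zero]
  · intro γ hγ
    obtain ⟨c, hc⟩ := hp ⟨γ, hγ⟩
    refine ⟨biproduct.lift fun a => c a • 𝟙 H, ?_⟩
    rw [biproduct.lift_desc]
    have h1 : γ = ((p c : N) : H ⟶ J) := by rw [hc]
    have h2 : c = ∑ a, c a • Pi.single a (1 : k) := by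
      funext b
      rw [Finset.sum_apply, Finset.sum_eq_single b]
      · simp
      · intro a _ ha; simp [ha.symm]
      · simp
    rw [h1]
    conv_rhs => rw [h2, map_sum, Submodule.coe_sum]
    refine Finset.sum_congr rfl fun a _ => ?_
    rw [map_smul, Linear.smul_comp, Category.id_comp]
    rfl

/-- Φ is not assumed faithful, so a lift of f to presentations commutes only after applying Φ. To
absorb the defect, the presentation of W receives extra relations x : X → J₀ that Φ kills: they
leave the cokernel unchanged, and every defect H₁ → J₀ factors through them. -/
theorem exists_generating (Z W : D) :
    ∃ (u v : Arrow V) (π : Φ.obj u.right ⟶ Z) (ρ : Φ.obj v.right ⟶ W)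
      (wπ : Φ.map u.hom ≫ π = 0) (wρ : Φ.map v.hom ≫ ρ = 0),
      Nonempty (IsColimit (CokernelCofork.ofπ π wπ)) ∧
      Nonempty (IsColimit (CokernelCofork.ofπ ρ wρ)) ∧
      ∀ f : Z ⟶ W, ∃ φ : u ⟶ v, π ≫ f = Φ.map φ.right ≫ ρ := by
  obtain ⟨H₁, H₀, α, π, w, h₁, h₀, hc⟩ := h.presentation Z
  obtain ⟨J₁, J₀, β, ρ, w', h₁', h₀', ⟨hc'⟩⟩ := h.presentation W
  obtain ⟨X, x, hx, hfac⟩ := exists_map_vanishing k Φ H₁ J₀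
  have hv : Φ.map (biprod.desc β x) ≫ ρ = 0 := by
    have : biprod.desc β x = biprod.fst ≫ β + biprod.snd ≫ x := by
      apply biprod.hom_ext' <;> simp
    rw [this, Φ.map_add, Φ.map_comp, Φ.map_comp, hx, comp_zero, add_zero, Category.assoc, w',
      comp_zero]
  refine ⟨Arrow.mk α, Arrow.mk (biprod.desc β x), π, ρ, w, hv, hc, ⟨?_⟩, ?_⟩
  · have : Epi ρ := Cofork.IsColimit.epi hc'
    refine CokernelCofork.IsColimit.ofπ' _ _ (fun {Y} t ht => ?_)
    have ht' : Φ.map β ≫ t = 0 := by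
      have h1 : β = biprod.inl ≫ biprod.desc β x := by simp
      have h2 : Φ.map (biprod.desc β x) ≫ t = 0 := ht
      rw [h1, Φ.map_comp, Category.assoc, h2, comp_zero]
    exact ⟨hc'.desc (CokernelCofork.ofπ t ht'), hc'.fac _ WalkingParallelPair.one⟩
  · intro f
    obtain ⟨φ₀, hφ₀⟩ := h.lift β ρ w' h₀ h₁' h₀' ⟨hc'⟩ (π ≫ f)
    obtain ⟨φ₁, hφ₁⟩ := h.exact β ρ w' h₁ h₁' h₀' ⟨hc'⟩ (Φ.map α ≫ φ₀) (by
      rw [Category.assoc, hφ₀, ← Category.assoc, w, zero_comp])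
    obtain ⟨a₀, rfl⟩ := h.full h₀ h₀' φ₀
    obtain ⟨a₁, rfl⟩ := h.full h₁ h₁' φ₁
    -- The defect of the square is killed by Φ; its factorisation δ becomes the second component of
    -- the left edge.
    obtain ⟨δ, hδ⟩ := hfac (α ≫ a₀ - a₁ ≫ β) (by
      rw [Φ.map_sub, Φ.map_comp, Φ.map_comp, hφ₁, sub_self])
    refine ⟨Arrow.homMk' (biprod.lift a₁ δ) a₀ ?_, hφ₀.symm⟩
    rw [biprod.lift_desc, hδ]
    abel

end IsPresenting

end Presenting

/-! ### The right Freyd category: representables are projective and present everything -/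

section Freyd

variable {V : Type u₁} [Category.{v₁} V] [Preadditive V]

theorem frHom_eq_zero_iff {A B A' B' : V} (a : A ⟶ B) (a' : A' ⟶ B') (l : A ⟶ A') (r : B ⟶ B')
    (w : l ≫ a' = a ≫ r) : frHom a a' l r w = 0 ↔ ∃ s : B ⟶ A', r = s ≫ a' := by
  refine (RightFreyd.quotient_map_eq_zero_iff (Arrow.homMk' l r w)).trans ?_
  constructor
  · rintro ⟨⟨s, hs⟩⟩
    exact ⟨s, (sub_zero r).symm.trans hs⟩
  · rintro ⟨s, hs⟩
    exact ⟨⟨s, (sub_zero r).trans hs⟩⟩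

theorem frHom_sub {A B A' B' : V} (a : A ⟶ B) (a' : A' ⟶ B') (l l' : A ⟶ A') (r r' : B ⟶ B')
    (w : l ≫ a' = a ≫ r) (w' : l' ≫ a' = a ≫ r') : frHom a a' l r w - frHom a a' l' r' w' =
      frHom a a' (l - l') (r - r') (by rw [sub_comp, comp_sub, w, w']) :=
  ((RightFreyd.quotient V).map_sub (f := Arrow.homMk' l r w) (g := Arrow.homMk' l' r' w')).symm

theorem exists_frHom {A B A' B' : V} (a : A ⟶ B) (a' : A' ⟶ B') (f : frObj a ⟶ frObj a') :
    ∃ (l : A ⟶ A') (r : B ⟶ B') (w : l ≫ a' = a ≫ r), f = frHom a a' l r w := by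
  obtain ⟨g, rfl⟩ := (RightFreyd.quotient V).map_surjective f
  exact ⟨g.left, g.right, g.w, rfl⟩

theorem exists_frObj (X : RightFreyd V) : ∃ (A B : V) (a : A ⟶ B), X = frObj a := by
  rcases X with ⟨⟨A, B, a⟩⟩
  exact ⟨A, B, a, rfl⟩

variable [HasZeroObject V]

open ZeroObject

/-- The projection from `P_B` to the object `A ⟶ B` of the right Freyd category. -/
noncomputable def freydπ {A B : V} (a : A ⟶ B) : (RightFreyd.functor V).obj B ⟶ frObj a :=
  frHom (0 : (0 : V) ⟶ B) a 0 (𝟙 B) (by simp)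

theorem freydπ_condition {A B : V} (a : A ⟶ B) :
    (RightFreyd.functor V).map a ≫ freydπ a = 0 := by
  exact (frHom_comp _ _ _ _ _ _ _ _ _).trans
    ((frHom_eq_zero_iff _ _ _ _ _).mpr ⟨𝟙 A, by simp⟩)

theorem exists_of_comp_freydπ_eq_zero {A B H : V} (a : A ⟶ B)
    (g : (RightFreyd.functor V).obj H ⟶ (RightFreyd.functor V).obj B) (hg : g ≫ freydπ a = 0) :
    ∃ h, h ≫ (RightFreyd.functor V).map a = g := by
  obtain ⟨g, rfl⟩ := (RightFreyd.functor V).map_surjective g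
  have h1 := (frHom_comp (0 : (0 : V) ⟶ H) (0 : (0 : V) ⟶ B) a 0 g (by simp) 0 (𝟙 B)
    (by simp)).symm.trans hg
  obtain ⟨s, hs⟩ := (frHom_eq_zero_iff _ _ _ _ _).mp h1
  rw [Category.comp_id] at hs
  subst hs
  exact ⟨(RightFreyd.functor V).map s, ((RightFreyd.functor V).map_comp s a).symm⟩

instance {A B : V} (a : A ⟶ B) : Epi (freydπ a) := by
  have : IsIso (Arrow.homMk' (f := (0 : (0 : V) ⟶ B)) (g := a) (u := 0) (v := 𝟙 B)
    (by simp)).right := inferInstanceAs (IsIso (𝟙 B))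
  exact RightFreyd.epi_of_isIso_right _

theorem isColimit_freydπ {A B : V} (a : A ⟶ B) :
    Nonempty (IsColimit (CokernelCofork.ofπ (freydπ a) (freydπ_condition a))) := by
  refine ⟨CokernelCofork.IsColimit.ofπ' _ _ fun {Z} g hg => Nonempty.some ?_⟩
  obtain ⟨A', B', z, rfl⟩ := exists_frObj Z
  obtain ⟨l, r, w, rfl⟩ := exists_frHom (0 : (0 : V) ⟶ B) z g
  have h1 := (frHom_comp (0 : (0 : V) ⟶ A) (0 : (0 : V) ⟶ B) z 0 a (by simp) l r w).symm.trans hg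
  obtain ⟨s, hs⟩ := (frHom_eq_zero_iff _ _ _ _ _).mp h1
  refine ⟨⟨frHom a z s r hs.symm, ?_⟩⟩
  refine (frHom_comp _ _ _ _ _ _ _ _ _).trans (frHom_congr _ _ ?_ (by simp))
  exact (isZero_zero V).eq_of_src _ _

variable [HasBinaryBiproducts V]

/-- An epimorphism (l, r) onto y : A' → B' forces the identity of B' to factor through y and r
jointly. The r-component of this factorisation, composed with r', is the lift; the y-component is a
null-homotopy. -/
theorem exists_lift_of_epi {H : V} {X Y : RightFreyd V} (g : X ⟶ Y) [Epi g]
    (f : (RightFreyd.functor V).obj H ⟶ Y) : ∃ f', f' ≫ g = f := by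
  obtain ⟨A, B, x, rfl⟩ := exists_frObj X
  obtain ⟨A', B', y, rfl⟩ := exists_frObj Y
  obtain ⟨l, r, w, rfl⟩ := exists_frHom x y g
  obtain ⟨l', r', w', rfl⟩ := exists_frHom (0 : (0 : V) ⟶ H) y f
  -- This is the projection of y to its quotient by the image of r. It vanishes after the
  -- epimorphism g, hence vanishes.
  have h0 : frHom y (biprod.desc y r) biprod.inl (𝟙 B') (by simp) = 0 := by
    rw [← cancel_epi (frHom x y l r w), comp_zero, frHom_comp, frHom_eq_zero_iff]
    exact ⟨biprod.inr, by simp⟩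
  rw [frHom_eq_zero_iff] at h0
  obtain ⟨s, hs⟩ := h0
  refine ⟨frHom (0 : (0 : V) ⟶ H) x 0 (r' ≫ s ≫ biprod.snd) (by simp), ?_⟩
  refine (frHom_comp _ _ _ _ _ _ _ _ _).trans (sub_eq_zero.mp ?_)
  refine (frHom_sub _ _ _ _ _ _ _ _).trans ((frHom_eq_zero_iff _ _ _ _ _).mpr ⟨- (r' ≫ s ≫ biprod.fst), ?_⟩)
  have h1 : r' = r' ≫ s ≫ biprod.desc y r := by rw [← hs, Category.comp_id]
  have h2 : biprod.desc y r = biprod.fst ≫ y + biprod.snd ≫ r := by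
    apply biprod.hom_ext' <;> simp
  rw [h2, comp_add, comp_add] at h1
  simp only [neg_comp, Category.assoc]
  rw [sub_eq_iff_eq_add]
  exact eq_neg_add_of_add_eq h1.symm

theorem isPresenting_freyd : IsPresenting (RightFreyd.functor V) ⊤ where
  full _ _ φ := (RightFreyd.functor V).map_surjective φ
  presentation Z := by
    obtain ⟨A, B, a, rfl⟩ := exists_frObj Z
    exact ⟨A, B, a, freydπ a, freydπ_condition a, trivial, trivial, isColimit_freydπ a⟩
  lift {H H₁ H₀ Z} α π w _ _ _ hc f := by
    have : Epi π := Cofork.IsColimit.epi hc.some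
    exact exists_lift_of_epi π f
  exact {H H₁ H₀ Z} α π w _ _ _ hc g hg := by
    refine exists_of_comp_freydπ_eq_zero α g ?_
    have : π ≫ hc.some.desc (CokernelCofork.ofπ (freydπ α) (freydπ_condition α)) = freydπ α :=
      hc.some.fac _ WalkingParallelPair.one
    rw [← this, ← Category.assoc, hg, zero_comp]
  hasCokernel _ _ _ := inferInstance

end Freyd

/-! ### Actions with adjoints, free generators, and the cell datum -/

namespace PreTwoRep

section

variable {C : Type u} [Bicategory.{w, v} C] (M : PreTwoRep.{w, v, u, v₁, u₁} C)

/-- The functor by which a 1-morphism acts. -/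
abbrev actF {i j : C} (F : i ⟶ j) : M.obj i ⥤ M.obj j := (M.map F).toFunctor

theorem act₂_naturality {i j : C} {F G : i ⟶ j} (α : F ⟶ G) {X Y : M.obj i} (f : X ⟶ Y) :
    (M.actF F).map f ≫ M.act₂ α Y = M.act₂ α X ≫ (M.actF G).map f :=
  (M.map₂ α).toNatTrans.naturality f

theorem act₂_id {i j : C} (F : i ⟶ j) (X : M.obj i) : M.act₂ (𝟙 F) X = 𝟙 _ := by
  simp [act₂]

/-- The functor sending a 1-morphism to its value at `X`. -/
def evalFunctor {i : C} (X : M.obj i) (j : C) : (i ⟶ j) ⥤ M.obj j where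
  obj F := M.act F X
  map α := M.act₂ α X
  map_id F := M.act₂_id F X
  map_comp α β := M.act₂_comp α β X

/-- The action of a composite. -/
def compIso {i j l : C} (F : i ⟶ j) (H : j ⟶ l) : M.actF (F ≫ H) ≅ M.actF F ⋙ M.actF H :=
  Cat.Hom.toNatIso (M.mapComp F H)

theorem act₂_whiskerRight {i j l : C} {F G : i ⟶ j} (α : F ⟶ G) (H : j ⟶ l) (X : M.obj i) :
    M.act₂ (α ▷ H) X ≫ (M.compIso G H).hom.app X =
      (M.compIso F H).hom.app X ≫ (M.actF H).map (M.act₂ α X) := by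
  have h := M.map₂_whisker_right α H
  have h2 := congrArg (fun z => z.toNatTrans.app X) (show
    M.map₂ (α ▷ H) ≫ (M.mapComp G H).hom = (M.mapComp F H).hom ≫ M.map₂ α ▷ M.map H by
      rw [h]; simp)
  exact h2

variable [∀ i j : C, Preadditive (i ⟶ j)]

/-- The action of `C` is additive. -/
class IsAdditive : Prop where
  map_add {i j : C} (F : i ⟶ j) : (M.actF F).Additive
  act₂_add {i j : C} {F G : i ⟶ j} (α β : F ⟶ G) (X : M.obj i) :
    M.act₂ (α + β) X = M.act₂ α X + M.act₂ β X

attribute [instance] IsAdditive.map_add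

instance [M.IsAdditive] {i : C} (X : M.obj i) (j : C) : (M.evalFunctor X j).Additive :=
  ⟨fun {_ _ α β} => IsAdditive.act₂_add α β X⟩

/-- Every 1-morphism acts by a functor with two-sided adjoint given by a 1-morphism. -/
class HasAdjoints : Prop where
  exists_adjoint {i j : C} (F : i ⟶ j) :
    ∃ F' : j ⟶ i, Nonempty (M.actF F ⊣ M.actF F') ∧ Nonempty (M.actF F' ⊣ M.actF F)

section

variable [M.HasAdjoints] {i j : C} (F : i ⟶ j)

instance : PreservesColimitsOfSize.{0, 0} (M.actF F) := by
  obtain ⟨F', ⟨h⟩, -⟩ := HasAdjoints.exists_adjoint (M := M) F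
  exact h.leftAdjoint_preservesColimits

instance : PreservesLimitsOfSize.{0, 0} (M.actF F) := by
  obtain ⟨F', -, ⟨h⟩⟩ := HasAdjoints.exists_adjoint (M := M) F
  exact h.rightAdjoint_preservesLimits

instance : PreservesFiniteColimits (M.actF F) :=
  PreservesColimitsOfSize.preservesFiniteColimits _

instance : PreservesFiniteLimits (M.actF F) :=
  PreservesLimitsOfSize.preservesFiniteLimits _

end

/-- The object `P` freely generates `M`, in the sense that `P` is projective, the morphisms between
objects `F P` come from unique 2-morphisms and every object is a quotient of some `F P`. -/
structure IsFreeOn {i : C} (P : M.obj i) : Prop where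
  projective : Projective P
  full (j : C) : (M.evalFunctor P j).Full
  faithful (j : C) : (M.evalFunctor P j).Faithful
  cover {j : C} (X : M.obj j) : ∃ (F : i ⟶ j) (f : M.act F P ⟶ X), Epi f

end

end PreTwoRep

/-- If a sum of two endomorphisms is invertible, one of them is. -/
def HasLocalEnd {V : Type u₁} [Category.{v₁} V] [Preadditive V] (X : V) : Prop :=
  ∀ a b : X ⟶ X, IsIso (a + b) → IsIso a ∨ IsIso b

theorem isAdditivelyClosed_isZero {V : Type u₁} [Category.{v₁} V] [Preadditive V]
    {D : Type u₂} [Category.{v₂} D] [Preadditive D] (Φ : V ⥤ D) [Φ.Additive] :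
    IsAdditivelyClosed (fun H => IsZero (Φ.obj H)) := by
  intro H n f s r hf h
  rw [IsZero.iff_id_eq_zero, ← Φ.map_id, ← h, Φ.map_sum]
  refine Finset.sum_eq_zero fun a _ => ?_
  rw [Φ.map_comp, (hf a).eq_of_tgt (Φ.map (s a)) 0, zero_comp]

namespace PreTwoRep

section

variable {C : Type u} [Bicategory.{w, v} C] [∀ i j : C, Preadditive (i ⟶ j)]
  {M : PreTwoRep.{w, v, u, v₁, u₁} C} [M.IsAdditive] [M.HasAdjoints]
  [∀ j, IsFiniteLength (M.obj j)] {i : C}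

theorem isZero_act {j : C} (F : i ⟶ j) {X : M.obj i} (h : IsZero X) : IsZero (M.act F X) :=
  (M.actF F).map_isZero h

theorem isZero_act_comp {j l : C} {F : i ⟶ j} {X : M.obj i} (h : IsZero (M.act F X)) (H : j ⟶ l) :
    IsZero (M.act (F ≫ H) X) :=
  (isZero_act H h).of_iso ((M.compIso F H).app X)

theorem isZero_act_retract {j : C} {F G : i ⟶ j} {X : M.obj i} (h : IsZero (M.act F X))
    (r : Retract G F) : IsZero (M.act G X) :=
  (isAdditivelyClosed_isZero (M.evalFunctor X j)).of_retract r h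

theorem IsFreeOn.projective_act {P : M.obj i} (hP : M.IsFreeOn P) {j : C} (F : i ⟶ j) :
    Projective (M.act F P) := by
  obtain ⟨F', ⟨h⟩, -⟩ := HasAdjoints.exists_adjoint (M := M) F
  exact h.map_projective P hP.projective

theorem IsFreeOn.isIso_of_isIso_act₂ {P : M.obj i} (hP : M.IsFreeOn P) {j : C} {F G : i ⟶ j}
    (α : F ⟶ G) (h : IsIso (M.act₂ α P)) : IsIso α := by
  have := hP.full j
  have := hP.faithful j
  have : IsIso ((M.evalFunctor P j).map α) := h
  exact isIso_of_fully_faithful (M.evalFunctor P j) α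

theorem IsFreeOn.exists_act₂ {P : M.obj i} (hP : M.IsFreeOn P) {j : C} {F G : i ⟶ j}
    (φ : M.act F P ⟶ M.act G P) : ∃ α, M.act₂ α P = φ :=
  (hP.full j).map_surjective φ

theorem IsFreeOn.hasLocalEnd {P : M.obj i} (hP : M.IsFreeOn P) {j : C} {G : i ⟶ j}
    (hG : HasLocalEnd G) : HasLocalEnd (M.act G P) := by
  intro a b hab
  obtain ⟨α, rfl⟩ := hP.exists_act₂ a
  obtain ⟨β, rfl⟩ := hP.exists_act₂ b
  rw [← IsAdditive.act₂_add] at hab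
  rcases hG α β (hP.isIso_of_isIso_act₂ _ hab) with h | h
  · exact Or.inl (inferInstanceAs (IsIso ((M.evalFunctor P j).map α)))
  · exact Or.inr (inferInstanceAs (IsIso ((M.evalFunctor P j).map β)))

theorem IsFreeOn.nonempty_retract {P : M.obj i} (hP : M.IsFreeOn P) {j : C} {F G : i ⟶ j}
    (s : M.act G P ⟶ M.act F P) (r : M.act F P ⟶ M.act G P) (h : IsIso (s ≫ r)) :
    Nonempty (Retract G F) := by
  obtain ⟨σ, rfl⟩ := hP.exists_act₂ s
  obtain ⟨ρ, rfl⟩ := hP.exists_act₂ r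
  rw [← act₂_comp] at h
  have := hP.isIso_of_isIso_act₂ _ h
  exact ⟨⟨σ, ρ ≫ inv (σ ≫ ρ), by rw [← Category.assoc, IsIso.hom_inv_id]⟩⟩

/-- The hypotheses on a subobject `ι : K ⟶ P` with simple top `p : K ⟶ L`, covered by `G P`. -/
structure IsCellDatum {P K L : M.obj i} (ι : K ⟶ P) (p : K ⟶ L) (G : i ⟶ i) : Prop where
  free : M.IsFreeOn P
  mono : Mono ι
  top : IsSimpleTop p
  hasLocalEnd : HasLocalEnd G
  exists_epi : ∃ e : M.act G P ⟶ L, Epi e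
  not_isZero : ¬ IsZero (M.act G L)

namespace IsCellDatum

variable {P K L : M.obj i} {ι : K ⟶ P} {p : K ⟶ L} {G : i ⟶ i} (h : M.IsCellDatum ι p G)

/-- The 1-morphisms annihilating `P / K`. -/
def ann (M : PreTwoRep.{w, v, u, v₁, u₁} C) [∀ j, IsFiniteLength (M.obj j)] {P K : M.obj i}
    (ι : K ⟶ P) (j : C) : ObjectProperty (i ⟶ j) := fun F => IsZero (M.act F (cokernel ι))

theorem ann_isAdditivelyClosed (ι : K ⟶ P) (j : C) : IsAdditivelyClosed (ann M ι j) :=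
  isAdditivelyClosed_isZero (M.evalFunctor (cokernel ι) j)

theorem ann_comp {j l : C} {F : i ⟶ j} (hF : ann M ι j F) (H : j ⟶ l) : ann M ι l (F ≫ H) :=
  isZero_act_comp hF H

theorem isIso_of_ann [Mono ι] {j : C} {F : i ⟶ j} (hF : ann M ι j F) :
    IsIso ((M.actF F).map ι) := by
  have : Epi ((M.actF F).map ι) := by
    have hc := CokernelCofork.mapIsColimit _ (cokernelIsCokernel ι) (M.actF F)
    refine epi_of_isZero_cokernel' _ hc hF
  exact isIso_of_mono_of_epi _

include h

theorem simple : Simple L := h.top.1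

theorem epi : Epi p := h.top.2.1

theorem simple_ne_zero (X : M.obj i) (f : X ⟶ L) [Epi f] : f ≠ 0 := by
  have := h.simple
  intro h0
  apply id_nonzero L
  rw [← cancel_epi f, h0, zero_comp, zero_comp]

/-- This makes GP behave as a projective cover of L: one of f and 1 - f is invertible, and 1 - f
kills the epimorphism e onto L ≠ 0. -/
theorem isIso_of_comp_eq {e : M.act G P ⟶ L} [Epi e] {f : M.act G P ⟶ M.act G P}
    (hf : f ≫ e = e) : IsIso f := by
  rcases h.free.hasLocalEnd h.hasLocalEnd f (𝟙 _ - f) (by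
    rw [add_sub_cancel]; infer_instance) with h1 | h1
  · exact h1
  · exfalso
    have h2 : (𝟙 _ - f) ≫ e = 0 := by rw [sub_comp, hf, Category.id_comp, sub_self]
    rw [← comp_zero (X := M.act G P) (f := 𝟙 _ - f), cancel_epi] at h2
    exact h.simple_ne_zero _ e h2

/-- The nonzero map t ≫ g into the simple L is epi, so projectivity lifts e through it; likewise g
lifts through e. The round trip is an endomorphism of GP over L, hence invertible. -/
theorem exists_sections {H : i ⟶ i} {e : M.act G P ⟶ L} [Epi e] {Y : M.obj i}
    (t : Y ⟶ M.act H P) (g : M.act H P ⟶ L) (hg : t ≫ g ≠ 0) :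
    ∃ (s : M.act G P ⟶ Y) (r : M.act H P ⟶ M.act G P),
      (s ≫ t) ≫ g = e ∧ r ≫ e = g ∧ IsIso (s ≫ t ≫ r) := by
  have := h.simple
  have := h.free.projective_act G
  have := h.free.projective_act H
  have : Epi (t ≫ g) := epi_of_nonzero_to_simple hg
  refine ⟨Projective.factorThru e (t ≫ g), Projective.factorThru g e, ?_, by simp, ?_⟩
  · rw [Category.assoc]; simp
  · apply h.isIso_of_comp_eq (e := e)
    simp

theorem nonempty_retract_of_ne_zero {H : i ⟶ i} (g : M.act H P ⟶ L) (hg : g ≠ 0) :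
    Nonempty (Retract G H) := by
  obtain ⟨e, he⟩ := h.exists_epi
  obtain ⟨s, r, -, -, hsr⟩ := h.exists_sections (e := e) (𝟙 _) g (by rwa [Category.id_comp])
  rw [Category.id_comp] at hsr
  exact h.free.nonempty_retract s r hsr

/-- Morphisms from `H P` to the simple top kill `H` applied to the radical of `K`. -/
theorem map_kernel_comp_eq_zero {H : i ⟶ i} (g : M.act H P ⟶ L) :
    (M.actF H).map (kernel.ι p ≫ ι) ≫ g = 0 := by
  by_contra hne
  have := h.mono
  obtain ⟨e, he⟩ := h.exists_epi
  obtain ⟨s, r, -, -, hsr⟩ := h.exists_sections (e := e) _ g hne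
  obtain ⟨ρ, rfl⟩ := h.free.exists_act₂ r
  -- By fullness r comes from a 2-morphism ρ : H → G, so naturality moves ρ past the inclusion: an
  -- automorphism of GP now factors as GP → G(rad K) → GK → GP.
  rw [act₂_naturality, Functor.map_comp] at hsr
  have h1 : Epi ((M.actF G).map ι) := by
    have : Epi (s ≫ M.act₂ ρ (kernel p) ≫ (M.actF G).map (kernel.ι p) ≫ (M.actF G).map ι) :=
      inferInstance
    simp only [← Category.assoc] at this
    exact @epi_of_epi _ _ _ _ _ _ _ this
  have h2 : IsIso ((M.actF G).map ι) := isIso_of_mono_of_epi _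
  have h3 : Epi ((M.actF G).map (kernel.ι p)) := by
    have h4 : Epi ((s ≫ M.act₂ ρ (kernel p) ≫ (M.actF G).map (kernel.ι p) ≫ (M.actF G).map ι) ≫
      inv ((M.actF G).map ι)) := inferInstance
    simp only [Category.assoc, IsIso.hom_inv_id, Category.comp_id] at h4
    simp only [← Category.assoc] at h4
    exact @epi_of_epi _ _ _ _ _ _ _ h4
  have := h.epi
  -- G(rad K) → GK and GK → GL are both epi with zero composite, so GL = 0.
  apply h.not_isZero
  rw [IsZero.iff_id_eq_zero, ← cancel_epi ((M.actF G).map p),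
    ← cancel_epi ((M.actF G).map (kernel.ι p)), ← Category.assoc, ← Functor.map_comp,
    kernel.condition]
  simp

end IsCellDatum

end

/-! ### Relative projectivity of the values at L -/

section

variable {C : Type u} [Bicategory.{w, v} C] [∀ i j : C, Preadditive (i ⟶ j)]
  {M : PreTwoRep.{w, v, u, v₁, u₁} C} [M.IsAdditive] [M.HasAdjoints]
  [∀ j, IsFiniteLength (M.obj j)] {i : C}

/-- The objects presented by values at `L` of 1-morphisms annihilating `P / K`. -/
def presented {P K : M.obj i} (ι : K ⟶ P) (L : M.obj i) (j : C) : ObjectProperty (M.obj j) :=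
  fun X => ∃ (H₁ H₀ : i ⟶ j) (α : H₁ ⟶ H₀) (π : M.act H₀ L ⟶ X) (w : M.act₂ α L ≫ π = 0),
    IsCellDatum.ann M ι j H₁ ∧ IsCellDatum.ann M ι j H₀ ∧
      Nonempty (IsColimit (CokernelCofork.ofπ π w))

theorem exists_desc_act {j l : C} {X Y Z : M.obj j} {f : X ⟶ Y} {g : Y ⟶ Z} {w : f ≫ g = 0}
    (hc : Nonempty (IsColimit (CokernelCofork.ofπ g w))) (F : j ⟶ l) {W : M.obj l}
    (t : M.act F Y ⟶ W) (ht : (M.actF F).map f ≫ t = 0) : ∃ t', (M.actF F).map g ≫ t' = t :=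
  have hF := CokernelCofork.mapIsColimit _ hc.some (M.actF F)
  ⟨hF.desc (CokernelCofork.ofπ _ ht), hF.fac _ WalkingParallelPair.one⟩

/-- The action on cokernels of 2-morphisms. -/
theorem exists_isColimit_act {j l : C} {L : M.obj i} {H₁ H₀ : i ⟶ j} (α : H₁ ⟶ H₀) {X : M.obj j}
    (π : M.act H₀ L ⟶ X) (w : M.act₂ α L ≫ π = 0)
    (hc : Nonempty (IsColimit (CokernelCofork.ofπ π w))) (F : j ⟶ l) :
    ∃ w' : M.act₂ (α ▷ F) L ≫ (M.compIso H₀ F).hom.app L ≫ (M.actF F).map π = 0,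
      Nonempty (IsColimit (CokernelCofork.ofπ _ w')) := by
  have h0 : (M.actF F).map (M.act₂ α L) ≫ (M.actF F).map π = 0 := by
    rw [← Functor.map_comp, w, Functor.map_zero]
  have w' : M.act₂ (α ▷ F) L ≫ (M.compIso H₀ F).hom.app L ≫ (M.actF F).map π = 0 := by
    rw [← Category.assoc, act₂_whiskerRight, Category.assoc, h0, comp_zero]
  have : Epi π := Cofork.IsColimit.epi hc.some
  refine ⟨w', ⟨CokernelCofork.IsColimit.ofπ' _ _ fun {Y} t ht => Nonempty.some ?_⟩⟩
  have h1 : (M.actF F).map (M.act₂ α L) ≫ (M.compIso H₀ F).inv.app L ≫ t = 0 := by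
    rw [← cancel_epi ((M.compIso H₁ F).hom.app L), comp_zero, ← Category.assoc,
      ← act₂_whiskerRight]
    simp [ht]
  obtain ⟨t', ht'⟩ := exists_desc_act hc F _ h1
  refine ⟨⟨t', ?_⟩⟩
  rw [Category.assoc, ht']
  simp

theorem presented_act {P K L : M.obj i} {ι : K ⟶ P} {j l : C} {X : M.obj j}
    (hX : presented ι L j X) (F : j ⟶ l) : presented ι L l (M.act F X) := by
  obtain ⟨H₁, H₀, α, π, w, h₁, h₀, hc⟩ := hX
  obtain ⟨w', hc'⟩ := exists_isColimit_act α π w hc F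
  exact ⟨_, _, α ▷ F, _, w', IsCellDatum.ann_comp h₁ F, IsCellDatum.ann_comp h₀ F, hc'⟩

theorem presented_of_ann {P K L : M.obj i} {ι : K ⟶ P} {j : C} {H : i ⟶ j}
    (hH : IsCellDatum.ann M ι j H) : presented ι L j (M.act H L) := by
  have h0 : M.act₂ (0 : H ⟶ H) L = 0 := (M.evalFunctor L j).map_zero H H
  refine ⟨H, H, 0, 𝟙 _, by rw [h0, zero_comp], hH, hH,
    ⟨CokernelCofork.IsColimit.ofπ' _ _ fun {Y} t ht => ⟨t, Category.id_comp _⟩⟩⟩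

namespace IsCellDatum

variable {P K L : M.obj i} {ι : K ⟶ P} {p : K ⟶ L} {G : i ⟶ i} (h : M.IsCellDatum ι p G)

include h

/-- P is projective, so g lifts to P → H₀ L. Its transpose under an adjunction H' ⊣ H₀ is a morphism
H'P → L, to which `map_kernel_comp_eq_zero` applies. -/
theorem comp_eq_zero_of_presented {Y : M.obj i} (hY : presented ι L i Y) (g : P ⟶ Y) :
    (kernel.ι p ≫ ι) ≫ g = 0 := by
  obtain ⟨H₁, H₀, α, π, w, -, -, ⟨hc⟩⟩ := hY
  have : Epi π := Cofork.IsColimit.epi hc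
  have := h.free.projective
  rw [← Projective.factorThru_comp g π, ← Category.assoc]
  obtain ⟨H', -, ⟨adj⟩⟩ := HasAdjoints.exists_adjoint (M := M) H₀
  have h1 : (kernel.ι p ≫ ι) ≫ Projective.factorThru g π = 0 := by
    apply (adj.homEquiv _ _).symm.injective
    rw [Adjunction.homEquiv_naturality_left_symm, h.map_kernel_comp_eq_zero]
    simp [Adjunction.homEquiv_counit]
  rw [h1, zero_comp]

/-- Transposing along F ⊣ F' turns g into a morphism P → F'X, and F'X is again presented. -/
theorem map_comp_eq_zero_of_presented {j : C} (F : i ⟶ j) {X : M.obj j} (hX : presented ι L j X)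
    (g : M.act F P ⟶ X) : (M.actF F).map (kernel.ι p ≫ ι) ≫ g = 0 := by
  obtain ⟨F', ⟨adj⟩, -⟩ := HasAdjoints.exists_adjoint (M := M) F
  apply (adj.homEquiv _ _).injective
  rw [Adjunction.homEquiv_naturality_left,
    h.comp_eq_zero_of_presented (presented_act hX F')]
  simp [Adjunction.homEquiv_unit]

/-- The projection `F P ⟶ F L`, for `F` annihilating `P / K`. -/
noncomputable def proj (_ : M.IsCellDatum ι p G) {j : C} (F : i ⟶ j) : M.act F P ⟶ M.act F L :=
  open Classical in
  if _ : IsIso ((M.actF F).map ι) then inv ((M.actF F).map ι) ≫ (M.actF F).map p else 0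

theorem map_proj {j : C} {F : i ⟶ j} (hF : ann M ι j F) :
    (M.actF F).map ι ≫ h.proj F = (M.actF F).map p := by
  have := h.mono
  have := isIso_of_ann hF
  simp [proj, this]

theorem epi_proj {j : C} {F : i ⟶ j} (hF : ann M ι j F) : Epi (h.proj F) := by
  have := h.epi
  have : Epi ((M.actF F).map ι ≫ h.proj F) := by
    rw [h.map_proj hF]
    infer_instance
  exact epi_of_epi ((M.actF F).map ι) _

theorem proj_naturality {j : C} {F H : i ⟶ j} (hF : ann M ι j F) (hH : ann M ι j H) (α : F ⟶ H) :
    h.proj F ≫ M.act₂ α L = M.act₂ α P ≫ h.proj H := by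
  have := h.mono
  have := isIso_of_ann hF
  rw [← cancel_epi ((M.actF F).map ι), ← Category.assoc, h.map_proj hF, act₂_naturality,
    ← Category.assoc, act₂_naturality, Category.assoc, h.map_proj hH]

theorem exists_desc_of_kernel {j : C} {F : i ⟶ j} (hF : ann M ι j F) {X : M.obj j}
    (g : M.act F P ⟶ X) (hg : (M.actF F).map (kernel.ι p ≫ ι) ≫ g = 0) :
    ∃ g' : M.act F L ⟶ X, h.proj F ≫ g' = g := by
  have := h.mono
  have := isIso_of_ann hF
  have := h.epi
  have h0 : (M.actF F).map (kernel.ι p) ≫ (M.actF F).map ι ≫ g = 0 := by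
    rw [← Category.assoc, ← Functor.map_comp, hg]
  obtain ⟨t, ht⟩ := exists_desc_act (f := kernel.ι p) (g := p) (w := kernel.condition p)
    ⟨Abelian.epiIsCokernelOfKernel (KernelFork.ofι (kernel.ι p) (kernel.condition p)) (kernelIsKernel p)⟩ F _ h0
  refine ⟨t, ?_⟩
  rw [← cancel_epi ((M.actF F).map ι), ← Category.assoc, h.map_proj hF, ht]

theorem exists_desc {j : C} {F : i ⟶ j} (hF : ann M ι j F) {X : M.obj j}
    (hX : presented ι L j X) (g : M.act F P ⟶ X) : ∃ g' : M.act F L ⟶ X, h.proj F ≫ g' = g :=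
  h.exists_desc_of_kernel hF g (h.map_comp_eq_zero_of_presented F hX g)

/-- The lift exists on FP by projectivity and descends to FL because Y is presented; Z and X may be
arbitrary. The intermediate Z allows q to fail to be epi as long as f lands in its image. -/
theorem exists_lift {j : C} {F : i ⟶ j} (hF : ann M ι j F) {X Y : M.obj j}
    (hY : presented ι L j Y) (q : Y ⟶ X) (f : M.act F L ⟶ X)
    (hq : ∃ (Z : M.obj j) (a : Y ⟶ Z) (b : Z ⟶ X), Epi a ∧ a ≫ b = q ∧ ∃ f', f' ≫ b = f) :
    ∃ f', f' ≫ q = f := by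
  obtain ⟨Z, a, b, ha, rfl, f', rfl⟩ := hq
  have := h.free.projective_act F
  have := h.epi_proj hF
  obtain ⟨g, hg⟩ := h.exists_desc hF hY (Projective.factorThru (h.proj F ≫ f') a)
  refine ⟨g, ?_⟩
  rw [← cancel_epi (h.proj F), ← Category.assoc, ← Category.assoc, hg, Projective.factorThru_comp,
    Category.assoc]

theorem exists_lift_of_epi {j : C} {F : i ⟶ j} (hF : ann M ι j F) {X Y : M.obj j}
    (hY : presented ι L j Y) (q : Y ⟶ X) [Epi q] (f : M.act F L ⟶ X) : ∃ f', f' ≫ q = f :=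
  h.exists_lift hF hY q f ⟨X, q, 𝟙 X, inferInstance, Category.comp_id _, f, Category.comp_id _⟩

theorem exists_lift_of_exact {j : C} {H H₁ H₀ : i ⟶ j} {X : M.obj j} (hH : ann M ι j H)
    (h₁ : ann M ι j H₁) (α : H₁ ⟶ H₀) (π : M.act H₀ L ⟶ X) (w : M.act₂ α L ≫ π = 0)
    (hc : Nonempty (IsColimit (CokernelCofork.ofπ π w))) (g : M.act H L ⟶ M.act H₀ L)
    (hg : g ≫ π = 0) : ∃ g' : M.act H L ⟶ M.act H₁ L, g' ≫ M.act₂ α L = g := by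
  have hex : (ShortComplex.mk _ _ w).Exact := ShortComplex.exact_of_g_is_cokernel _ hc.some
  refine h.exists_lift hH (presented_of_ann h₁) _ g
    ⟨Abelian.image (M.act₂ α L), Abelian.factorThruImage _, Abelian.image.ι _, inferInstance,
      Abelian.image.fac _, ?_⟩
  refine ⟨kernel.lift _ g ?_, kernel.lift_ι _ _ _⟩
  have hπ : π ≫ hc.some.desc (CokernelCofork.ofπ _ (cokernel.condition (M.act₂ α L))) =
    cokernel.π _ := hc.some.fac _ WalkingParallelPair.one
  rw [← hπ, ← Category.assoc, hg, zero_comp]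

/-- Lift φ to a morphism HP → H'P between projectives, where it comes from a 2-morphism, and return
to L by naturality of `proj`. -/
theorem exists_act₂ {j : C} {H H' : i ⟶ j} (hH : ann M ι j H) (hH' : ann M ι j H')
    (φ : M.act H L ⟶ M.act H' L) : ∃ α : H ⟶ H', M.act₂ α L = φ := by
  have := h.free.projective_act H
  have := h.epi_proj hH
  have := h.epi_proj hH'
  obtain ⟨α, hα⟩ := h.free.exists_act₂ (Projective.factorThru (h.proj H ≫ φ) (h.proj H'))
  refine ⟨α, ?_⟩
  rw [← cancel_epi (h.proj H), h.proj_naturality hH hH', hα, Projective.factorThru_comp]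

/-- Right approximations by values at `L`. -/
theorem exists_approximation [∀ i j : C, HasZeroObject (i ⟶ j)]
    [∀ i j : C, HasBinaryBiproducts (i ⟶ j)] {j : C} (X : M.obj j) :
    ∃ (H : i ⟶ j) (a : M.act H L ⟶ X), ann M ι j H ∧ ∀ (H' : i ⟶ j) (b : M.act H' L ⟶ X),
      ann M ι j H' → ∃ c, c ≫ a = b := by
  have hT := ann_isAdditivelyClosed (M := M) ι j
  -- X is noetherian, so some a has maximal image. Adding a further b on H ⊞ H' cannot enlarge it,
  -- so b lands in the image of a and lifts.
  obtain ⟨S, ⟨H, a, hH, rfl⟩, hmax⟩ := (inferInstance : WellFoundedGT (Subobject X)).wf.has_min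
    {S | ∃ (H : i ⟶ j) (a : M.act H L ⟶ X), ann M ι j H ∧ imageSubobject a = S}
    ⟨_, _, 0, hT.of_isZero (isZero_zero (i ⟶ j)), rfl⟩
  refine ⟨H, a, hH, fun H' b hH' => ?_⟩
  let Φ := M.evalFunctor L j
  let a' : M.act (H ⊞ H') L ⟶ X :=
    M.act₂ (biprod.fst : H ⊞ H' ⟶ H) L ≫ a + M.act₂ (biprod.snd : H ⊞ H' ⟶ H') L ≫ b
  have hz : ∀ (F F' : i ⟶ j), M.act₂ (0 : F ⟶ F') L = 0 := fun F F' => Φ.map_zero F F'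
  have ha : M.act₂ biprod.inl L ≫ a' = a := by
    simp only [a', comp_add, ← Category.assoc, ← act₂_comp, biprod.inl_fst, biprod.inl_snd,
      act₂_id, hz, Category.id_comp, zero_comp, add_zero]
  have hb : M.act₂ biprod.inr L ≫ a' = b := by
    simp only [a', comp_add, ← Category.assoc, ← act₂_comp, biprod.inr_fst, biprod.inr_snd,
      act₂_id, hz, Category.id_comp, zero_comp, zero_add]
  have hle : imageSubobject a ≤ imageSubobject a' := by
    conv_lhs => rw [← ha]
    exact imageSubobject_comp_le _ _
  have heq : imageSubobject a = imageSubobject a' := by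
    by_contra hne
    exact hmax _ ⟨_, a', hT.of_biprod hH hH', rfl⟩ (lt_of_le_of_ne hle hne)
  refine h.exists_lift hH' (presented_of_ann hH) a b
    ⟨_, factorThruImageSubobject a, (imageSubobject a).arrow, inferInstance, by simp,
      M.act₂ biprod.inr L ≫ factorThruImageSubobject a' ≫ Subobject.ofLE _ _ heq.ge, ?_⟩
  simp [hb]

end IsCellDatum

end

end PreTwoRep

/-- Pull f back along π. If the pullback covers X then f is epi; otherwise its composite with π ≫ p
vanishes, and so does f ≫ p. -/
theorem IsSimpleTop.of_epi_comp {D : Type u₁} [Category.{v₁} D] [Abelian D] {X S L : D}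
    (π : X ⟶ S) [Epi π] (p : S ⟶ L) (h : IsSimpleTop (π ≫ p)) : IsSimpleTop p := by
  obtain ⟨h1, h2, h3⟩ := h
  refine ⟨h1, epi_of_epi π p, fun Y f hf => ?_⟩
  by_contra hne
  apply hf
  have hepi : Epi (pullback.snd f π) := by
    by_contra hcon
    have h4 := h3 _ _ hcon
    rw [← Category.assoc, ← pullback.condition, Category.assoc] at h4
    have : Epi (pullback.fst f π) := inferInstance
    exact hne (by rw [← cancel_epi (pullback.fst f π), h4, comp_zero])
  have : Epi (pullback.fst f π ≫ f) := by
    rw [pullback.condition]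
    infer_instance
  exact epi_of_epi (pullback.fst f π) f

/-! ### The cell simple S and the isomorphisms FS ≅ FL -/

namespace PreTwoRep

section

variable {C : Type u} [Bicategory.{w, v} C] [∀ i j : C, Preadditive (i ⟶ j)]
  [∀ i j : C, HasZeroObject (i ⟶ j)] [∀ i j : C, HasBinaryBiproducts (i ⟶ j)]
  {M : PreTwoRep.{w, v, u, v₁, u₁} C} [M.IsAdditive] [M.HasAdjoints]
  [∀ j, IsFiniteLength (M.obj j)] {i : C}

namespace IsCellDatum

variable {P K L : M.obj i} {ι : K ⟶ P} {p : K ⟶ L} {G : i ⟶ i} (h : M.IsCellDatum ι p G)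
  {D : ∀ j : C, ObjectProperty (M.obj j)} (hD : ∀ j X, D j X ↔ presented ι L j X)

include h

/-- The cover GP → L kills G(rad K), so it factors through GL. A subobject of GL mapping onto L
lifts to an endomorphism of GP over L, which is invertible; hence the subobject is everything. -/
theorem exists_isSimpleTop_act (hG : ann M ι i G) : ∃ e : M.act G L ⟶ L, IsSimpleTop e := by
  obtain ⟨e, he⟩ := h.exists_epi
  obtain ⟨e', rfl⟩ := h.exists_desc_of_kernel hG e (h.map_kernel_comp_eq_zero e)
  have := h.simple
  have hp := h.epi_proj hG
  have hproj := h.free.projective_act G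
  refine ⟨e', h.simple, epi_of_epi (h.proj G) e', fun Y f hf => ?_⟩
  by_contra hne
  apply hf
  have : Epi (f ≫ e') := epi_of_nonzero_to_simple hne
  let t := Projective.factorThru (h.proj G ≫ e') (f ≫ e')
  have ht : t ≫ f ≫ e' = h.proj G ≫ e' := Projective.factorThru_comp _ _
  let s := Projective.factorThru (t ≫ f) (h.proj G)
  have hs : s ≫ h.proj G = t ≫ f := Projective.factorThru_comp _ _
  have : IsIso s := h.isIso_of_comp_eq (e := h.proj G ≫ e') (by
    rw [← Category.assoc, hs, Category.assoc, ht])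
  have : Epi (t ≫ f) := by
    rw [← hs]
    infer_instance
  exact epi_of_epi t f

include hD

/-- The quotient of `F L` by the images of all morphisms factoring through the kernel of a morphism
to some object. -/
theorem exists_image {j : C} {F : i ⟶ j} (hF : ann M ι j F) {X : M.obj j} (f : M.act F L ⟶ X) :
    ∃ (Y : (D j).FullSubcategory) (π : M.act F L ⟶ Y.obj) (m : Y.obj ⟶ X), Epi π ∧ π ≫ m = f ∧
      ∀ (H : i ⟶ j) (b : M.act H L ⟶ Y.obj), ann M ι j H → b ≫ m = 0 → b = 0 := by
  -- The kernel of f need not be presented; dividing only by the image of its approximation HL keeps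
  -- the quotient inside D.
  obtain ⟨H, a, hH, ha⟩ := h.exists_approximation (kernel f)
  obtain ⟨α, hα⟩ := h.exists_act₂ hH hF (a ≫ kernel.ι f)
  have hY : presented ι L j (cokernel (a ≫ kernel.ι f)) := by
    refine ⟨H, F, α, cokernel.π _, by rw [hα, cokernel.condition], hH, hF, ⟨?_⟩⟩
    exact CokernelCofork.IsColimit.ofπ' _ _ fun {Y} t ht =>
      ⟨cokernel.desc _ t (by rw [← hα, ht]), cokernel.π_desc _ _ _⟩
  refine ⟨⟨_, (hD j _).mpr hY⟩, cokernel.π _, cokernel.desc _ f (by simp), inferInstance,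
    cokernel.π_desc _ _ _, fun H' b hH' hb => ?_⟩
  obtain ⟨b', rfl⟩ := h.exists_lift_of_epi hH' (presented_of_ann hF)
    (cokernel.π (a ≫ kernel.ι f)) b
  rw [Category.assoc, cokernel.π_desc] at hb
  obtain ⟨c, hc⟩ := ha H' (kernel.lift f b' hb) hH'
  have : b' = c ≫ a ≫ kernel.ι f := by rw [← Category.assoc, hc, kernel.lift_ι]
  rw [this, Category.assoc, cokernel.condition, comp_zero]

theorem exists_cover {j : C} (Y : (D j).FullSubcategory) :
    ∃ (H : i ⟶ j) (π : M.act H L ⟶ Y.obj), ann M ι j H ∧ Epi π := by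
  obtain ⟨H₁, H₀, α, π, w, h₁, h₀, ⟨hc⟩⟩ := (hD j _).mp Y.property
  exact ⟨H₀, π, h₀, Cofork.IsColimit.epi hc⟩

/-- Monomorphisms of D are tested on the objects HL, because these cover D. -/
theorem mono_of_forall {j : C} {X Y : (D j).FullSubcategory} (m : Y ⟶ X)
    (hm : ∀ (H : i ⟶ j) (b : M.act H L ⟶ Y.obj), ann M ι j H → b ≫ m.hom = 0 → b = 0) :
    Mono m := by
  refine mono_of_cancel_zero _ fun {Z} x hx => ?_
  obtain ⟨H, π, hH, hπ⟩ := h.exists_cover hD Z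
  have hx' : x.hom ≫ m.hom = 0 := congrArg (fun z => z.hom) hx
  apply ObjectProperty.hom_ext
  have h0 : π ≫ x.hom = 0 := hm H _ hH (by rw [Category.assoc, hx', comp_zero])
  change x.hom = 0
  rw [← cancel_epi π, h0, comp_zero]

/-- The image of f formed inside D is a nonzero subobject of the simple object S, hence all of S.
The resulting epimorphism is one of the ambient category. -/
theorem epi_of_ne_zero {S : (D i).FullSubcategory} [Simple S] {F : i ⟶ i} (hF : ann M ι i F)
    (f : M.act F L ⟶ S.obj) (hf : f ≠ 0) : Epi f := by
  obtain ⟨Y, π, m, hπ, rfl, hm⟩ := h.exists_image hD hF f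
  let m' : Y ⟶ S := ObjectProperty.homMk m
  have hmono : Mono m' := h.mono_of_forall hD m' hm
  have hne : m' ≠ 0 := by
    intro h0
    have : m = 0 := congrArg (fun z => z.hom) h0
    exact hf (by rw [this, comp_zero])
  have : IsIso m' := isIso_of_mono_of_nonzero hne
  have : IsIso m := inferInstanceAs (IsIso m'.hom)
  infer_instance

/-- S is the image of GL → L formed inside D. It is a quotient of GL, so it inherits the simple top
L. -/
theorem exists_simple (hG : ann M ι i G) : ∃ S : (D i).FullSubcategory, Simple S ∧
    ∃ q : S.obj ⟶ L, IsSimpleTop q := by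
  obtain ⟨e, he⟩ := h.exists_isSimpleTop_act hG
  obtain ⟨S, π, q, hπ, rfl, hq⟩ := h.exists_image hD hG e
  have hq' := IsSimpleTop.of_epi_comp π q he
  have := hq'.2.1
  refine ⟨S, ⟨fun {Y} m hm => ?_⟩, q, hq'⟩
  constructor
  · intro hiso h0
    have hm0 : m.hom = 0 := congrArg (fun z => z.hom) h0
    have : IsIso m.hom := inferInstance
    apply h.simple_ne_zero _ q
    rw [← cancel_epi m.hom, hm0, zero_comp, zero_comp]
  · intro hm0
    obtain ⟨H, c, hH, hc⟩ := h.exists_cover hD Y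
    have h1 : c ≫ m.hom ≠ 0 := by
      intro h0
      apply hm0
      apply ObjectProperty.hom_ext
      change m.hom = 0
      rw [← cancel_epi c, h0, comp_zero]
    -- A non-epi into S dies in the top L, and a morphism HL → S killed by q is zero by construction
    -- of S.
    have hepi : Epi (c ≫ m.hom) := by
      by_contra hcon
      exact h1 (hq H _ hH (hq'.2.2 _ _ hcon))
    have hepi' : Epi m.hom := epi_of_epi c m.hom
    -- A monomorphism of D that is epi in the ambient category is not yet known to be invertible. A
    -- section is built from a presentation of S: lift its generators along m; the relations vanish
    -- because m is mono in D.
    obtain ⟨X₁, X₀, α, ρ, w, h₁, h₀, ⟨hcol⟩⟩ := (hD i _).mp S.property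
    obtain ⟨t, ht⟩ := h.exists_lift_of_epi h₀ ((hD i _).mp Y.property) m.hom ρ
    have hz : M.act₂ α L ≫ t = 0 := by
      have hX : (D i) (M.act X₁ L) := (hD i _).mpr (presented_of_ann h₁)
      let x : (⟨_, hX⟩ : (D i).FullSubcategory) ⟶ Y := ObjectProperty.homMk (M.act₂ α L ≫ t)
      have hx : x ≫ m = 0 := by
        apply ObjectProperty.hom_ext
        change (M.act₂ α L ≫ t) ≫ m.hom = 0
        rw [Category.assoc, ht, w]
      have : x = 0 := by rw [← cancel_mono m, hx, zero_comp]
      exact congrArg (fun z => z.hom) this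
    have : Epi ρ := Cofork.IsColimit.epi hcol
    let r : S ⟶ Y := ObjectProperty.homMk (hcol.desc (CokernelCofork.ofπ t hz))
    have hr : r ≫ m = 𝟙 S := by
      apply ObjectProperty.hom_ext
      change hcol.desc (CokernelCofork.ofπ t hz) ≫ m.hom = 𝟙 S.obj
      have h2 : ρ ≫ hcol.desc (CokernelCofork.ofπ t hz) = t :=
        hcol.fac _ WalkingParallelPair.one
      rw [← cancel_epi ρ, ← Category.assoc, h2, ht, Category.comp_id]
    exact ⟨r, by rw [← cancel_mono m, Category.assoc, hr, Category.comp_id, Category.id_comp], hr⟩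

section Simple

variable {S : (D i).FullSubcategory} [Simple S] {q : S.obj ⟶ L} (hq : IsSimpleTop q)

include hq

/-- Injectivity of Hom(FL, S) → Hom(FL, L): a nonzero morphism to S is epi, and an epimorphism
followed by q is nonzero. -/
theorem eq_zero_of_comp {F : i ⟶ i} (hF : ann M ι i F) (f : M.act F L ⟶ S.obj)
    (hf : f ≫ q = 0) : f = 0 := by
  by_contra hne
  have := h.epi_of_ne_zero hD hF f hne
  have := hq.2.1
  exact h.simple_ne_zero _ (f ≫ q) hf

theorem exists_lift_simple {F : i ⟶ i} (hF : ann M ι i F) (f : M.act F L ⟶ L) :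
    ∃ f', f' ≫ q = f :=
  have := hq.2.1
  h.exists_lift_of_epi hF ((hD i _).mp S.property) q f

theorem map_eq_zero_of_comp {j : C} {F H : i ⟶ j} (hH : ann M ι j H) (f : M.act H L ⟶ M.act F S.obj)
    (hf : f ≫ (M.actF F).map q = 0) : f = 0 := by
  obtain ⟨F', -, ⟨adj⟩⟩ := HasAdjoints.exists_adjoint (M := M) F
  have h1 : (M.compIso H F').hom.app L ≫ (adj.homEquiv _ _).symm f = 0 := by
    refine h.eq_zero_of_comp hD hq (ann_comp hH F') _ ?_
    rw [Category.assoc, ← Adjunction.homEquiv_naturality_right_symm, hf]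
    simp [Adjunction.homEquiv_counit]
  apply (adj.homEquiv _ _).symm.injective
  rw [← cancel_epi ((M.compIso H F').hom.app L), h1]
  simp [Adjunction.homEquiv_counit]

theorem exists_lift_act {j : C} {F H : i ⟶ j} (hH : ann M ι j H) (f : M.act H L ⟶ M.act F L) :
    ∃ f', f' ≫ (M.actF F).map q = f := by
  obtain ⟨F', -, ⟨adj⟩⟩ := HasAdjoints.exists_adjoint (M := M) F
  obtain ⟨g, hg⟩ := h.exists_lift_simple hD hq (ann_comp hH F')
    ((M.compIso H F').hom.app L ≫ (adj.homEquiv _ _).symm f)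
  refine ⟨adj.homEquiv _ _ ((M.compIso H F').inv.app L ≫ g), ?_⟩
  rw [← Adjunction.homEquiv_naturality_right, Category.assoc, hg]
  simp

/-- Post-composition with q is bijective on morphisms from the objects HL, hence by adjunction so is
post-composition with F(q). Lifting the identity of FL gives a section s, and covering FS by some HL
shows that s is a two-sided inverse. -/
theorem isIso_map {j : C} {F : i ⟶ j} (hF : ann M ι j F) : IsIso ((M.actF F).map q) := by
  obtain ⟨s, hs⟩ := h.exists_lift_act hD hq hF (𝟙 (M.act F L))
  have hFS : presented ι L j (M.act F S.obj) := presented_act ((hD i _).mp S.property) F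
  obtain ⟨H, c, hH, hc⟩ := h.exists_cover hD ⟨_, (hD j _).mpr hFS⟩
  refine ⟨s, ?_, hs⟩
  rw [← sub_eq_zero, ← cancel_epi c, comp_zero]
  refine h.map_eq_zero_of_comp hD hq hH _ ?_
  rw [Category.assoc, sub_comp, Category.assoc, hs]
  simp

end Simple

end IsCellDatum

end

end PreTwoRep

/-! ### Cokernels in full subcategories, and evaluation at S -/

section

variable {A : Type u₁} [Category.{v₁} A] [Preadditive A]

theorem nonempty_isColimit_of_iso {X Y X' Y' Z : A} {f : X ⟶ Y} {f' : X' ⟶ Y'} (a : X ≅ X')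
    (b : Y ≅ Y') (hab : f ≫ b.hom = a.hom ≫ f') {π : Y ⟶ Z} {w : f ≫ π = 0}
    (hc : Nonempty (IsColimit (CokernelCofork.ofπ π w))) :
    ∃ w' : f' ≫ b.inv ≫ π = 0, Nonempty (IsColimit (CokernelCofork.ofπ (b.inv ≫ π) w')) := by
  have hab' : f' ≫ b.inv = a.inv ≫ f := by
    rw [Iso.comp_inv_eq, Category.assoc, hab, Iso.inv_hom_id_assoc]
  have : Epi π := Cofork.IsColimit.epi hc.some
  refine ⟨by rw [← Category.assoc, hab', Category.assoc, w, comp_zero],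
    ⟨CokernelCofork.IsColimit.ofπ' _ _ fun {W} t ht => ?_⟩⟩
  have ht' : f ≫ b.hom ≫ t = 0 := by
    rw [← Category.assoc, hab, Category.assoc, ht, comp_zero]
  refine ⟨hc.some.desc (CokernelCofork.ofπ _ ht'), ?_⟩
  have h1 : π ≫ hc.some.desc (CokernelCofork.ofπ _ ht') = b.hom ≫ t :=
    hc.some.fac _ WalkingParallelPair.one
  rw [Category.assoc, h1, Iso.inv_hom_id_assoc]

variable {D : ObjectProperty A}

theorem nonempty_isColimit_homMk {X Y Z : D.FullSubcategory} {f : X ⟶ Y} {π : Y ⟶ Z}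
    (w : f ≫ π = 0) {w' : f.hom ≫ π.hom = 0}
    (hc : Nonempty (IsColimit (CokernelCofork.ofπ π.hom w'))) :
    Nonempty (IsColimit (CokernelCofork.ofπ π w)) := by
  have : Epi π.hom := Cofork.IsColimit.epi hc.some
  have : Epi π := D.ι.epi_of_epi_map (inferInstanceAs (Epi π.hom))
  refine ⟨CokernelCofork.IsColimit.ofπ' _ _ fun {W} t ht => ?_⟩
  have ht' : f.hom ≫ t.hom = 0 := congrArg (fun z => z.hom) ht
  refine ⟨ObjectProperty.homMk (hc.some.desc (CokernelCofork.ofπ _ ht')), ?_⟩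
  apply ObjectProperty.hom_ext
  exact hc.some.fac _ WalkingParallelPair.one

/-- The inclusion of D is not known to preserve cokernels. It preserves this one, since the ambient
cokernel lies in D and both have the universal property there. -/
theorem nonempty_isColimit_hom {X Y Z : D.FullSubcategory} {f : X ⟶ Y} {π : Y ⟶ Z}
    {w : f ≫ π = 0} (hc : Nonempty (IsColimit (CokernelCofork.ofπ π w))) [HasCokernel f.hom]
    (hD : D (cokernel f.hom)) :
    ∃ w' : f.hom ≫ π.hom = 0, Nonempty (IsColimit (CokernelCofork.ofπ π.hom w')) := by
  have w' : f.hom ≫ π.hom = 0 := congrArg (fun z => z.hom) w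
  let Q : D.FullSubcategory := ⟨_, hD⟩
  let c : Y ⟶ Q := ObjectProperty.homMk (cokernel.π f.hom)
  have hfc : f ≫ c = 0 := by
    apply ObjectProperty.hom_ext
    exact cokernel.condition f.hom
  let d : Z ⟶ Q := hc.some.desc (CokernelCofork.ofπ c hfc)
  have hd : π ≫ d = c := hc.some.fac _ WalkingParallelPair.one
  have hd' : π.hom ≫ d.hom = cokernel.π f.hom := congrArg (fun z => z.hom) hd
  let e : Q ⟶ Z := ObjectProperty.homMk (cokernel.desc f.hom π.hom w')
  have he : c ≫ e = π := by
    apply ObjectProperty.hom_ext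
    exact cokernel.π_desc _ _ _
  have : Epi π := Cofork.IsColimit.epi hc.some
  have hde : d ≫ e = 𝟙 Z := by
    rw [← cancel_epi π, ← Category.assoc, hd, he, Category.comp_id]
  have hde' : d.hom ≫ e.hom = 𝟙 Z.obj := congrArg (fun z => z.hom) hde
  refine ⟨w', ⟨Cofork.IsColimit.mk' _ fun s => ⟨d.hom ≫ cokernel.desc f.hom s.π ?_, ?_, ?_⟩⟩⟩
  · rw [s.condition, zero_comp]
  · change π.hom ≫ _ = _
    rw [← Category.assoc, hd', cokernel.π_desc]
  · intro m hm
    have hm' : π.hom ≫ m = s.π := hm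
    have h1 : cokernel.desc f.hom s.π (by rw [s.condition, zero_comp]) = e.hom ≫ m := by
      rw [← cancel_epi (cokernel.π f.hom), cokernel.π_desc, ← Category.assoc]
      change _ = (cokernel.π f.hom ≫ cokernel.desc f.hom π.hom w') ≫ m
      rw [cokernel.π_desc, hm']
    rw [h1, ← Category.assoc, hde']
    exact (Category.id_comp m).symm

end

namespace PreTwoRep

section

variable {C : Type u} [Bicategory.{w, v} C] [∀ i j : C, Preadditive (i ⟶ j)]
  [∀ i j : C, HasZeroObject (i ⟶ j)] [∀ i j : C, HasBinaryBiproducts (i ⟶ j)]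
  {M : PreTwoRep.{w, v, u, v₁, u₁} C} [M.IsAdditive] [M.HasAdjoints]
  [∀ j, IsFiniteLength (M.obj j)] {i : C}

namespace IsCellDatum

variable {P K L : M.obj i} {ι : K ⟶ P} {p : K ⟶ L} {G : i ⟶ i} (h : M.IsCellDatum ι p G)
  {D : ∀ j : C, ObjectProperty (M.obj j)} (hD : ∀ j X, D j X ↔ presented ι L j X)
  {S : (D i).FullSubcategory}

/-- Evaluation at `S`, with values in full subcategories stable under the action. -/
def evalFull (hst : ∀ (j l : C) (F : j ⟶ l) (X : M.obj j), D j X → D l (M.act F X))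
    (S : (D i).FullSubcategory) (j : C) : (i ⟶ j) ⥤ (D j).FullSubcategory :=
  (D j).lift (M.evalFunctor S.obj j) fun F => hst _ _ F _ S.property

include h hD

/-- The isomorphisms HS ≅ HL induced by q are natural in H, so each property is checked at L, where
relative projectivity and fullness are known. -/
theorem isPresenting [Simple S] {q : S.obj ⟶ L} (hq : IsSimpleTop q)
    (hst : ∀ (j l : C) (F : j ⟶ l) (X : M.obj j), D j X → D l (M.act F X)) (j : C) :
    IsPresenting (evalFull hst S j) (ann M ι j) := by
  obtain ⟨θ, hθ⟩ : ∃ θ : ∀ {H : i ⟶ j}, ann M ι j H → (M.act H S.obj ≅ M.act H L),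
      ∀ {H H' : i ⟶ j} (hH : ann M ι j H) (hH' : ann M ι j H') (α : H ⟶ H'),
        M.act₂ α S.obj ≫ (θ hH').hom = (θ hH).hom ≫ M.act₂ α L :=
    ⟨fun hH => @asIso _ _ _ _ _ (h.isIso_map hD hq hH),
      fun _ _ α => (act₂_naturality M α q).symm⟩
  have hθ' : ∀ {H H' : i ⟶ j} (hH : ann M ι j H) (hH' : ann M ι j H') (α : H ⟶ H'),
      M.act₂ α L ≫ (θ hH').symm.hom = (θ hH).symm.hom ≫ M.act₂ α S.obj := by
    intro H H' hH hH' α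
    rw [Iso.symm_hom, Iso.symm_hom, Iso.comp_inv_eq, Category.assoc, hθ hH hH' α,
      Iso.inv_hom_id_assoc]
  have hcoker : ∀ {H₁ H₀ : i ⟶ j} (_ : ann M ι j H₁) (_ : ann M ι j H₀) (α : H₁ ⟶ H₀),
      D j (cokernel (M.act₂ α S.obj)) := by
    intro H₁ H₀ h₁ h₀ α
    obtain ⟨w', hc⟩ := nonempty_isColimit_of_iso _ _ (hθ h₁ h₀ α)
      (w := cokernel.condition _) ⟨cokernelIsCokernel (M.act₂ α S.obj)⟩
    exact (hD j _).mpr ⟨H₁, H₀, α, _, w', h₁, h₀, hc⟩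
  have hcol : ∀ {H₁ H₀ : i ⟶ j} {Z : (D j).FullSubcategory} (h₁ : ann M ι j H₁)
      (h₀ : ann M ι j H₀) (α : H₁ ⟶ H₀) (π : (evalFull hst S j).obj H₀ ⟶ Z)
      (w : (evalFull hst S j).map α ≫ π = 0) (_ : Nonempty (IsColimit (CokernelCofork.ofπ π w))),
      ∃ (π' : M.act H₀ L ⟶ Z.obj) (w' : M.act₂ α L ≫ π' = 0), (θ h₀).hom ≫ π' = π.hom ∧
        Nonempty (IsColimit (CokernelCofork.ofπ π' w')) := by
    intro H₁ H₀ Z h₁ h₀ α π w hc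
    have : HasCokernel ((evalFull hst S j).map α).hom :=
      inferInstanceAs (HasCokernel (M.act₂ α S.obj))
    obtain ⟨w₁, hc₁⟩ := nonempty_isColimit_hom hc (hcoker h₁ h₀ α)
    obtain ⟨w₂, hc₂⟩ := nonempty_isColimit_of_iso _ _ (hθ h₁ h₀ α) hc₁
    exact ⟨_, w₂, Iso.hom_inv_id_assoc _ _, hc₂⟩
  exact
    { full := by
        intro H H' hH hH' φ
        obtain ⟨φ', hφ⟩ : ∃ φ' : M.act H S.obj ⟶ M.act H' S.obj, φ' = φ.hom := ⟨φ.hom, rfl⟩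
        obtain ⟨α, hα⟩ := h.exists_act₂ hH hH' ((θ hH).inv ≫ φ' ≫ (θ hH').hom)
        refine ⟨α, ObjectProperty.hom_ext _ (Eq.trans ?_ hφ)⟩
        change M.act₂ α S.obj = φ'
        rw [← cancel_mono (θ hH').hom, hθ hH hH', hα, Iso.hom_inv_id_assoc]
      presentation := by
        intro Z
        obtain ⟨H₁, H₀, α, π, w, h₁, h₀, hc⟩ := (hD j _).mp Z.property
        obtain ⟨w', hc'⟩ := nonempty_isColimit_of_iso _ _ (hθ' h₁ h₀ α) hc
        exact ⟨H₁, H₀, α, ObjectProperty.homMk _, ObjectProperty.hom_ext _ w', h₁, h₀,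
          nonempty_isColimit_homMk _ hc'⟩
      lift := by
        intro H H₁ H₀ Z α π w hH h₁ h₀ hc f
        obtain ⟨π', w', hπ', hc'⟩ := hcol h₁ h₀ α π w hc
        have := Cofork.IsColimit.epi hc'.some
        obtain ⟨f', hf'⟩ : ∃ f' : M.act H S.obj ⟶ Z.obj, f' = f.hom := ⟨f.hom, rfl⟩
        have : Epi π' := this
        obtain ⟨g, hg⟩ := h.exists_lift_of_epi hH (presented_of_ann h₀) π' ((θ hH).inv ≫ f')
        refine ⟨ObjectProperty.homMk ((θ hH).hom ≫ g ≫ (θ h₀).inv),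
          ObjectProperty.hom_ext _ (Eq.trans ?_ hf')⟩
        change ((θ hH).hom ≫ g ≫ (θ h₀).inv) ≫ π.hom = f'
        refine Eq.trans (congrArg (fun z => ((θ hH).hom ≫ g ≫ (θ h₀).inv) ≫ z) hπ'.symm) ?_
        rw [Category.assoc, Category.assoc, Iso.inv_hom_id_assoc, hg, Iso.hom_inv_id_assoc]
      exact := by
        intro H H₁ H₀ Z α π w hH h₁ h₀ hc g hg
        obtain ⟨π', w', hπ', hc'⟩ := hcol h₁ h₀ α π w hc
        obtain ⟨g', hg'⟩ : ∃ g' : M.act H S.obj ⟶ M.act H₀ S.obj, g' = g.hom := ⟨g.hom, rfl⟩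
        have hg₀ : g' ≫ (θ h₀).hom ≫ π' = 0 := by
          rw [hπ', hg']
          exact congrArg (fun z => z.hom) hg
        obtain ⟨t, ht⟩ := h.exists_lift_of_exact hH h₁ α _ w' hc'
          ((θ hH).inv ≫ g' ≫ (θ h₀).hom) (by
            rw [Category.assoc, Category.assoc, hg₀, comp_zero])
        refine ⟨ObjectProperty.homMk ((θ hH).hom ≫ t ≫ (θ h₁).inv),
          ObjectProperty.hom_ext _ (Eq.trans ?_ hg')⟩
        change ((θ hH).hom ≫ t ≫ (θ h₁).inv) ≫ M.act₂ α S.obj = g'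
        have h2 : (θ h₁).inv ≫ M.act₂ α S.obj = M.act₂ α L ≫ (θ h₀).inv := (hθ' h₁ h₀ α).symm
        rw [Category.assoc, Category.assoc, h2, ← Category.assoc t, ht]
        simp
      hasCokernel := by
        intro H₁ H₀ α h₁ h₀
        have w : (evalFull hst S j).map α ≫
            (ObjectProperty.homMk (cokernel.π (M.act₂ α S.obj)) :
              _ ⟶ (⟨_, hcoker h₁ h₀ α⟩ : (D j).FullSubcategory)) = 0 :=
          ObjectProperty.hom_ext _ (cokernel.condition (M.act₂ α S.obj))
        exact HasColimit.mk ⟨_, (nonempty_isColimit_homMk w (w' := cokernel.condition _)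
          ⟨cokernelIsCokernel (M.act₂ α S.obj)⟩).some⟩ }

end IsCellDatum

end

end PreTwoRep

/-! ### Direct summands of direct sums, expressed by decompositions of the identity -/

section AddClosure

variable {D : Type u₁} [Category.{v₁} D] [Preadditive D]

theorem addClosure_iff [HasFiniteBiproducts D] {S : ObjectProperty D} {X : D} :
    addClosure S X ↔ ∃ (n : ℕ) (f : Fin n → D) (s : ∀ a, X ⟶ f a) (r : ∀ a, f a ⟶ X),
      (∀ a, S (f a)) ∧ ∑ a, s a ≫ r a = 𝟙 X := by
  constructor
  · rintro ⟨n, f, b, hf, ⟨hb⟩, ⟨r⟩⟩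
    refine ⟨n, f, fun a => r.i ≫ b.π a, fun a => b.ι a ≫ r.r, hf, ?_⟩
    have h1 : ∑ a, b.π a ≫ b.ι a = 𝟙 b.pt := IsBilimit.total hb
    calc _ = r.i ≫ (∑ a, b.π a ≫ b.ι a) ≫ r.r := by rw [sum_comp, comp_sum]; simp
      _ = _ := by rw [h1, Category.id_comp, r.retract]
  · rintro ⟨n, f, s, r, hf, h⟩
    refine ⟨n, f, biproduct.bicone f, hf, ⟨biproduct.isBilimit f⟩,
      ⟨⟨biproduct.lift s, biproduct.desc r, ?_⟩⟩⟩
    rw [← h]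
    exact biproduct.lift_desc

theorem addClosure_isAdditivelyClosed [HasFiniteBiproducts D] (S : ObjectProperty D) :
    IsAdditivelyClosed (addClosure S) := by
  intro H n f s r hf h
  simp only [addClosure_iff] at hf
  choose m g s' r' hg h' using hf
  let e := Fintype.equivFin (Σ a, Fin (m a))
  refine addClosure_iff.mpr ⟨_, fun x => g (e.symm x).1 (e.symm x).2,
    fun x => s (e.symm x).1 ≫ s' (e.symm x).1 (e.symm x).2,
    fun x => r' (e.symm x).1 (e.symm x).2 ≫ r (e.symm x).1, fun x => hg _ _, ?_⟩
  rw [Equiv.sum_comp e.symm fun y => (s y.1 ≫ s' y.1 y.2) ≫ r' y.1 y.2 ≫ r y.1,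
    Fintype.sum_sigma, ← h]
  refine Finset.sum_congr rfl fun a _ => ?_
  rw [← Category.id_comp (r a), ← h' a, sum_comp, comp_sum]
  simp

theorem IsAdditivelyClosed.comap {V : Type u₂} [Category.{v₂} V] [Preadditive V] (Φ : V ⥤ D)
    [Φ.Additive] {T : ObjectProperty D} (hT : IsAdditivelyClosed T) :
    IsAdditivelyClosed fun X => T (Φ.obj X) := by
  intro H n f s r hf h
  refine hT _ n _ (fun a => Φ.map (s a)) (fun a => Φ.map (r a)) hf ?_
  rw [← Φ.map_id, ← h, Φ.map_sum]
  simp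

theorem IsAdditivelyClosed.le_of_indecomposable {V : Type u₁} [Category.{v₁} V] [Preadditive V]
    (k : Type*) [Field k] [Linear k V] [HasZeroObject V] [HasBinaryBiproducts V]
    [hV : IsFinitaryCategory k V] {T U : ObjectProperty V} (hT : IsAdditivelyClosed T)
    (hU : IsAdditivelyClosed U) (h : ∀ X, Indecomposable X → T X → U X) (X : V) (hX : T X) :
    U X := by
  refine indecomposable_induction k hV.fin (fun H => T H → U H) ?_ ?_ ?_ h X hX
  · rintro X Y ⟨e⟩ hX hY
    exact hU.of_iso e (hX (hT.of_iso e.symm hY))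
  · exact fun X hX _ => hU.of_isZero hX
  · intro X Y hX hY hXY
    exact hU.of_biprod (hX (hT.of_retract ⟨biprod.inl, biprod.fst, by simp⟩ hXY))
      (hY (hT.of_retract ⟨biprod.inr, biprod.snd, by simp⟩ hXY))

end AddClosure

/-! ### The right preorder and right cells -/

section LeR

variable {C : Type u} [Bicategory.{w, v} C]

theorem LeR.refl {i j : C} (F : i ⟶ j) : LeR F F :=
  ⟨𝟙 j, ⟨⟨(ρ_ F).inv, (ρ_ F).hom, by simp⟩⟩⟩

theorem LeR.trans {i j l m : C} {F : i ⟶ j} {G : i ⟶ l} {H : i ⟶ m} (h : LeR F G)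
    (h' : LeR G H) : LeR F H := by
  obtain ⟨A, ⟨r⟩⟩ := h
  obtain ⟨B, ⟨s⟩⟩ := h'
  exact ⟨A ≫ B, ⟨(s.trans (r.map (postcomp i B))).trans (Retract.ofIso (α_ F A B))⟩⟩

theorem IsRightCell.leR [∀ i j : C, Preadditive (i ⟶ j)] [∀ i j : C, HasZeroObject (i ⟶ j)]
    [∀ i j : C, HasBinaryBiproducts (i ⟶ j)] {i : C} {R : ∀ j : C, ObjectProperty (i ⟶ j)}
    (h : IsRightCell R) {j l : C} {F : i ⟶ j} {G : i ⟶ l} (hF : R j F) (hG : R l G) :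
    LeR F G := by
  obtain ⟨m, E, hE, hR⟩ := h
  exact (((hR _ _).mp hF).2.2).trans ((hR _ _).mp hG).2.1

theorem IsRightCell.mem [∀ i j : C, Preadditive (i ⟶ j)] [∀ i j : C, HasZeroObject (i ⟶ j)]
    [∀ i j : C, HasBinaryBiproducts (i ⟶ j)] {i : C} {R : ∀ j : C, ObjectProperty (i ⟶ j)}
    (h : IsRightCell R) {j l : C} {F : i ⟶ j} {G : i ⟶ l} (hF : R j F) (hG : Indecomposable G)
    (hFG : LeR F G) (hGF : LeR G F) : R l G := by
  obtain ⟨m, E, hE, hR⟩ := h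
  obtain ⟨-, h1, h2⟩ := (hR _ _).mp hF
  exact (hR _ _).mpr ⟨hG, h1.trans hFG, hGF.trans h2⟩

theorem IsRightCell.exists_mem [∀ i j : C, Preadditive (i ⟶ j)] [∀ i j : C, HasZeroObject (i ⟶ j)]
    [∀ i j : C, HasBinaryBiproducts (i ⟶ j)] {i : C} {R : ∀ j : C, ObjectProperty (i ⟶ j)}
    (h : IsRightCell R) : ∃ (j : C) (F : i ⟶ j), R j F := by
  obtain ⟨m, E, hE, hR⟩ := h
  exact ⟨m, E, (hR _ _).mpr ⟨hE, .refl E, .refl E⟩⟩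

theorem IsRightCell.indecomposable [∀ i j : C, Preadditive (i ⟶ j)]
    [∀ i j : C, HasZeroObject (i ⟶ j)]
    [∀ i j : C, HasBinaryBiproducts (i ⟶ j)] {i : C} {R : ∀ j : C, ObjectProperty (i ⟶ j)}
    (h : IsRightCell R) {j : C} {F : i ⟶ j} (hF : R j F) : Indecomposable F := by
  obtain ⟨m, E, hE, hR⟩ := h
  exact ((hR _ _).mp hF).1

end LeR

/-! ### Members of the cell as the 1-morphisms killing P/K but not L -/

namespace PreTwoRep

section

variable {C : Type u} [Bicategory.{w, v} C] [∀ i j : C, Preadditive (i ⟶ j)]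
  [∀ i j : C, HasZeroObject (i ⟶ j)] [∀ i j : C, HasBinaryBiproducts (i ⟶ j)]
  {M : PreTwoRep.{w, v, u, v₁, u₁} C} [M.IsAdditive] [M.HasAdjoints]
  [∀ j, IsFiniteLength (M.obj j)] {i : C}

theorem isZero_act_leR {j l : C} {F : i ⟶ j} {G : i ⟶ l} (hFG : LeR F G) {X : M.obj i}
    (h : IsZero (M.act F X)) : IsZero (M.act G X) := by
  obtain ⟨H, ⟨r⟩⟩ := hFG
  exact isZero_act_retract (isZero_act_comp h H) r

theorem act₂_comp_assoc {j : C} {F G H : i ⟶ j} (α : F ⟶ G) (β : G ⟶ H) (X : M.obj i)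
    {Z : M.obj j} (f : M.act H X ⟶ Z) :
    M.act₂ (α ≫ β) X ≫ f = M.act₂ α X ≫ M.act₂ β X ≫ f := by
  rw [act₂_comp, Category.assoc]

/-- A 1-morphism annihilating `P / K` is a summand of a multiple of any 1-morphism `G` such that
`G P` covers the simple top of `K`. -/
theorem IsFreeOn.leR_of_isSimpleTop {P K L : M.obj i} (hP : M.IsFreeOn P) {ι : K ⟶ P} [Mono ι]
    {p : K ⟶ L} (hp : IsSimpleTop p) {G : i ⟶ i} (e : M.act G P ⟶ L) [Epi e] {j : C} {F : i ⟶ j}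
    (hF : IsZero (M.act F (cokernel ι))) : LeR G F := by
  have := hp.1
  have := hp.2.1
  have := hP.projective_act G
  have := hP.projective_act F
  have := IsCellDatum.isIso_of_ann (M := M) hF
  -- Proper subobjects of K die under p, so a lift of the epimorphism e along p is itself epi.
  have hepi : Epi (Projective.factorThru e p) := by
    by_contra hne
    have h1 := hp.2.2 _ _ hne
    rw [Projective.factorThru_comp] at h1
    apply id_nonzero L
    rw [← cancel_epi e, h1, zero_comp, zero_comp]
  -- Applying F to GP → K and using FK = FP makes FP a quotient of F(GP), hence a summand since FP
  -- is projective.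
  let f : M.act (G ≫ F) P ⟶ M.act F P :=
    (M.compIso G F).hom.app P ≫ (M.actF F).map (Projective.factorThru e p) ≫ (M.actF F).map ι
  have : Epi f := inferInstance
  refine ⟨F, hP.nonempty_retract (Projective.factorThru (𝟙 _) f) f ?_⟩
  rw [Projective.factorThru_comp]
  infer_instance

namespace IsCellDatum

variable {P K L : M.obj i} {ι : K ⟶ P} {p : K ⟶ L} {G : i ⟶ i} (h : M.IsCellDatum ι p G)

include h

/-- The nonzero projection FP → FL transposes, along an adjunction F' ⊣ F, to a nonzero morphism
F'FP → L, which exhibits G as a summand of F' ∘ F. -/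
theorem leR_top {j : C} {F : i ⟶ j} (hF : ann M ι j F) (hL : ¬ IsZero (M.act F L)) :
    LeR F G := by
  obtain ⟨F', -, ⟨adj⟩⟩ := HasAdjoints.exists_adjoint (M := M) F
  have := h.epi_proj hF
  refine ⟨F', h.nonempty_retract_of_ne_zero
    ((M.compIso F F').hom.app P ≫ (adj.homEquiv _ _).symm (h.proj F)) fun h0 => hL ?_⟩
  rw [← comp_zero (X := M.act (F ≫ F') P) (f := (M.compIso F F').hom.app P),
    cancel_epi] at h0
  have h1 : h.proj F = 0 := by
    apply (adj.homEquiv _ _).symm.injective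
    rw [h0]
    simp [Adjunction.homEquiv_counit]
  rw [IsZero.iff_id_eq_zero, ← cancel_epi (h.proj F), h1]
  simp

theorem top_leR {j : C} {F : i ⟶ j} (hF : ann M ι j F) : LeR G F := by
  obtain ⟨e, he⟩ := h.exists_epi
  have := h.mono
  exact h.free.leR_of_isSimpleTop h.top e hF

section Cell

variable (k : Type*) [Field k] [∀ i j : C, Linear k (i ⟶ j)]
  [∀ i j : C, IsFinitaryCategory k (i ⟶ j)]
  {R : ∀ j : C, ObjectProperty (i ⟶ j)} (hR : IsRightCell R)
  (hann : ∀ j F, R j F → ann M ι j F) (hnz : ∀ j F, R j F → ¬ IsZero (M.act F L))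

include hR hann hnz

theorem top_mem (hG : Indecomposable G) : R i G := by
  obtain ⟨j, F, hF⟩ := hR.exists_mem
  exact hR.mem hF hG (h.leR_top (hann _ _ hF) (hnz _ _ hF)) (h.top_leR (hann _ _ hF))

/-- Both F and any member E of the cell are equivalent to G for the right preorder, by `leR_top` and
`top_leR`. -/
theorem mem_of_ann {j : C} {F : i ⟶ j} (hF : Indecomposable F) (hF' : ann M ι j F)
    (hL : ¬ IsZero (M.act F L)) : R j F := by
  obtain ⟨l, E, hE⟩ := hR.exists_mem
  exact hR.mem hE hF ((h.leR_top (hann _ _ hE) (hnz _ _ hE)).trans (h.top_leR hF'))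
    ((h.leR_top hF' hL).trans (h.top_leR (hann _ _ hE)))

include k

theorem addClosure_act {j : C} {H : i ⟶ j} (hH : ann M ι j H) :
    addClosure (fun Y => ∃ F : i ⟶ j, R j F ∧ Nonempty (Y ≅ M.act F L)) (M.act H L) := by
  have := Abelian.hasFiniteBiproducts (C := M.obj j)
  have hcl := addClosure_isAdditivelyClosed
    (fun Y => ∃ F : i ⟶ j, R j F ∧ Nonempty (Y ≅ M.act F L))
  refine IsAdditivelyClosed.le_of_indecomposable k (ann_isAdditivelyClosed ι j)
    (hcl.comap (M.evalFunctor L j)) (fun F hF hF' => ?_) H hH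
  by_cases hL : IsZero (M.act F L)
  · exact hcl.of_isZero hL
  · exact addClosure_iff.mpr ⟨1, fun _ => M.act F L, fun _ => 𝟙 _, fun _ => 𝟙 _,
      fun _ => ⟨F, h.mem_of_ann hR hann hnz hF hF' hL, ⟨Iso.refl _⟩⟩, by
        rw [Fin.sum_univ_one]
        exact Category.id_comp _⟩

omit k h hR hnz in
theorem exists_retract_of_addClosure {j : C} {X : M.obj j}
    (hX : addClosure (fun Y => ∃ F : i ⟶ j, R j F ∧ Nonempty (Y ≅ M.act F L)) X) :
    ∃ H, ann M ι j H ∧ Nonempty (Retract X (M.act H L)) := by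
  have := hasFiniteBiproducts_of_binary (V := i ⟶ j)
  have := Abelian.hasFiniteBiproducts (C := M.obj j)
  obtain ⟨n, f, s, r, hf, hsr⟩ := addClosure_iff.mp hX
  choose F hF e using hf
  let e' := fun a => (e a).some
  refine ⟨⨁ F, (ann_isAdditivelyClosed ι j).of_biproduct F fun a => hann _ _ (hF a),
    ⟨⟨∑ a, s a ≫ (e' a).hom ≫ M.act₂ (biproduct.ι F a) L,
      ∑ a, M.act₂ (biproduct.π F a) L ≫ (e' a).inv ≫ r a, ?_⟩⟩⟩
  rw [sum_comp, ← hsr]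
  refine Finset.sum_congr rfl fun a _ => ?_
  rw [comp_sum, Finset.sum_eq_single a]
  · simp only [Category.assoc]
    rw [← act₂_comp_assoc, biproduct.ι_π_self, act₂_id]
    simp
  · intro b _ hb
    simp only [Category.assoc]
    rw [← act₂_comp_assoc, biproduct.ι_π_ne _ hb.symm]
    have : M.act₂ (0 : F a ⟶ F b) L = 0 := (M.evalFunctor L j).map_zero _ _
    rw [this]
    simp
  · simp

/-- The two sides differ in allowing summands of values at L and arbitrary morphisms between them.
Summands are enlarged to full values H₁L and H₀L, and morphisms between these come from 2-morphisms.
-/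
theorem presented_iff {j : C} {X : M.obj j} : presented ι L j X ↔
    ∃ (X₁ X₀ : M.obj j) (a : X₁ ⟶ X₀) (π : X₀ ⟶ X) (w : a ≫ π = 0),
      addClosure (fun Y => ∃ F : i ⟶ j, R j F ∧ Nonempty (Y ≅ M.act F L)) X₁ ∧
      addClosure (fun Y => ∃ F : i ⟶ j, R j F ∧ Nonempty (Y ≅ M.act F L)) X₀ ∧
      Nonempty (IsColimit (CokernelCofork.ofπ π w)) := by
  constructor
  · rintro ⟨H₁, H₀, α, π, w, h₁, h₀, hc⟩
    exact ⟨_, _, _, π, w, h.addClosure_act k hR hann hnz h₁, h.addClosure_act k hR hann hnz h₀, hc⟩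
  · rintro ⟨X₁, X₀, a, π, w, h₁, h₀, ⟨hc⟩⟩
    obtain ⟨H₁, h₁, ⟨r₁⟩⟩ := exists_retract_of_addClosure hann h₁
    obtain ⟨H₀, h₀, ⟨r₀⟩⟩ := exists_retract_of_addClosure hann h₀
    have h₂ := (ann_isAdditivelyClosed ι j).of_biprod h₁ h₀
    -- On H₁ this is the original relation transported to H₀L; on the extra copy of H₀ it is the
    -- complementary idempotent, which removes the part of H₀L outside X₀.
    obtain ⟨α, hα⟩ := h.exists_act₂ h₂ h₀ (M.act₂ biprod.fst L ≫ r₁.r ≫ a ≫ r₀.i +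
      M.act₂ biprod.snd L ≫ (𝟙 _ - r₀.r ≫ r₀.i))
    have : Epi π := Cofork.IsColimit.epi hc
    have w' : M.act₂ α L ≫ r₀.r ≫ π = 0 := by
      rw [hα]
      simp [w]
    refine ⟨H₁ ⊞ H₀, H₀, α, r₀.r ≫ π, w', h₂, h₀,
      ⟨CokernelCofork.IsColimit.ofπ' _ _ fun {Z} t ht => ?_⟩⟩
    have hl : M.act₂ biprod.inl L ≫ M.act₂ α L = r₁.r ≫ a ≫ r₀.i := by
      rw [hα, comp_add, ← act₂_comp_assoc, ← act₂_comp_assoc, biprod.inl_fst, biprod.inl_snd,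
        act₂_id]
      have : M.act₂ (0 : H₁ ⟶ H₀) L = 0 := (M.evalFunctor L j).map_zero _ _
      rw [this]
      simp
    have hr : M.act₂ biprod.inr L ≫ M.act₂ α L = 𝟙 _ - r₀.r ≫ r₀.i := by
      rw [hα, comp_add, ← act₂_comp_assoc, ← act₂_comp_assoc, biprod.inr_fst, biprod.inr_snd,
        act₂_id]
      have : M.act₂ (0 : H₀ ⟶ H₁) L = 0 := (M.evalFunctor L j).map_zero _ _
      rw [this]
      simp
    have hat : a ≫ r₀.i ≫ t = 0 := by
      rw [← cancel_epi r₁.r, comp_zero]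
      calc _ = (M.act₂ biprod.inl L ≫ M.act₂ α L) ≫ t := by rw [hl]; simp
        _ = 0 := by rw [Category.assoc, ht, comp_zero]
    have hrt : r₀.r ≫ r₀.i ≫ t = t := by
      have : (𝟙 _ - r₀.r ≫ r₀.i) ≫ t = 0 := by rw [← hr, Category.assoc, ht, comp_zero]
      rw [sub_comp, Category.id_comp, sub_eq_zero] at this
      rw [← Category.assoc, ← this]
    refine ⟨hc.desc (CokernelCofork.ofπ _ hat), ?_⟩
    have h1 : π ≫ hc.desc (CokernelCofork.ofπ _ hat) = r₀.i ≫ t :=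
      hc.fac _ WalkingParallelPair.one
    rw [Category.assoc, h1, hrt]

end Cell

end IsCellDatum

end

/-! ### Existence of the subobject K -/

section

variable {C : Type u} [Bicategory.{w, v} C] [∀ i j : C, Preadditive (i ⟶ j)]
  [∀ i j : C, HasZeroObject (i ⟶ j)] [∀ i j : C, HasBinaryBiproducts (i ⟶ j)]
  {M : PreTwoRep.{w, v, u, v₁, u₁} C} [M.IsAdditive] [M.HasAdjoints]
  [∀ j, IsFiniteLength (M.obj j)] {i : C}

theorem isZero_act_cokernel_iff {j : C} (F : i ⟶ j) {X Y : M.obj i} (f : X ⟶ Y) :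
    IsZero (M.act F (cokernel f)) ↔ Epi ((M.actF F).map f) := by
  constructor
  · intro h
    exact epi_of_isZero_cokernel' _
      (CokernelCofork.mapIsColimit _ (cokernelIsCokernel f) (M.actF F)) h
  · intro h
    rw [IsZero.iff_id_eq_zero, ← cancel_epi ((M.actF F).map (cokernel.π f)),
      ← cancel_epi ((M.actF F).map f), ← Category.assoc, ← Functor.map_comp, cokernel.condition]
    simp

theorem epi_map_kernel_ι {j : C} (F : i ⟶ j) {X Y : M.obj i} (p : X ⟶ Y) [Epi p]
    (h : IsZero (M.act F Y)) : Epi ((M.actF F).map (kernel.ι p)) := by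
  refine (isZero_act_cokernel_iff F _).mp ?_
  exact h.of_iso ((M.actF F).mapIso
    (IsColimit.coconePointUniqueUpToIso (cokernelIsCokernel (kernel.ι p))
      (Abelian.epiIsCokernelOfKernel _ (limit.isLimit _))))

/-- There is a smallest subobject which becomes everything under the action of `F`. -/
theorem exists_minimal_subobject {j : C} (F : i ⟶ j) (P : M.obj i) :
    ∃ (K : M.obj i) (ι : K ⟶ P), Mono ι ∧ Epi ((M.actF F).map ι) ∧
      ∀ (Y : M.obj i) (f : Y ⟶ K), Epi ((M.actF F).map (f ≫ ι)) → Epi f := by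
  let s : Set (Subobject P) := {A | Epi ((M.actF F).map A.arrow)}
  have hs : s.Nonempty := ⟨⊤, by
    have : IsIso (⊤ : Subobject P).arrow := inferInstance
    change Epi _
    infer_instance⟩
  obtain ⟨A, hA, hmin⟩ := WellFounded.has_min
    (inferInstance : WellFoundedLT (Subobject P)).wf s hs
  refine ⟨_, A.arrow, inferInstance, hA, fun Y f hf => ?_⟩
  let B : Subobject P := Subobject.mk (image.ι f ≫ A.arrow)
  have hB : B ∈ s := by
    have h1 : f ≫ A.arrow = (factorThruImage f ≫ (Subobject.underlyingIso
        (image.ι f ≫ A.arrow)).inv) ≫ B.arrow := by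
      simp [B]
    rw [h1, Functor.map_comp] at hf
    exact @epi_of_epi _ _ _ _ _ _ _ hf
  have hle : B ≤ A := Subobject.mk_le_of_comm (image.ι f) rfl
  have hBA : B = A := by
    by_contra hne
    exact hmin B hB (lt_of_le_of_ne hle hne)
  have hiso : IsIso (B.ofLE A hle) := by
    have := Subobject.isoOfEq B A hBA
    exact ⟨A.ofLE B hBA.ge, by simp, by simp⟩
  have h2 : B.ofLE A hle = (Subobject.underlyingIso (image.ι f ≫ A.arrow)).hom ≫ image.ι f := by
    rw [← cancel_mono A.arrow]
    simp [B]
  have h3 : Epi (image.ι f) := by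
    rw [h2] at hiso
    exact epi_of_epi (Subobject.underlyingIso (image.ι f ≫ A.arrow)).hom _
  rw [← image.fac f]
  infer_instance

/-- If F kills L, then the kernel of p still fills FP under F, so by minimality it is all of K. -/
theorem isZero_of_minimal {j : C} {F : i ⟶ j} {P K L : M.obj i} {ι : K ⟶ P}
    (hι : Epi ((M.actF F).map ι))
    (hmin : ∀ (Y : M.obj i) (f : Y ⟶ K), Epi ((M.actF F).map (f ≫ ι)) → Epi f)
    (p : K ⟶ L) [Epi p] (h : IsZero (M.act F L)) : IsZero L := by
  have := epi_map_kernel_ι F p h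
  have := hmin _ (kernel.ι p) (by rw [Functor.map_comp]; infer_instance)
  rw [IsZero.iff_id_eq_zero, ← cancel_epi p, ← cancel_epi (kernel.ι p), ← Category.assoc,
    kernel.condition]
  simp

/-- A functor annihilating all simple subquotients annihilates the object. -/
theorem isZero_act_of_subquotients {j : C} {F : i ⟶ j} {Q : M.obj i}
    (h : ∀ (A S : M.obj i) (m : A ⟶ Q) (e : A ⟶ S), Mono m → Epi e → Simple S →
      IsZero (M.act F S)) : IsZero (M.act F Q) := by
  obtain ⟨K, ι, hι, hF, hmin⟩ := exists_minimal_subobject F Q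
  -- A nonzero K would have a simple quotient; F kills it as a subquotient of Q, against minimality.
  have hK : IsZero K := by
    by_contra hK
    obtain ⟨S, p, hp, hS⟩ := exists_epi_simple K hK
    exact Simple.not_isZero S (isZero_of_minimal hF hmin p (h K S ι p hι hp hS))
  rw [IsZero.iff_id_eq_zero, ← cancel_epi ((M.actF F).map ι)]
  exact (isZero_act F hK).eq_of_src _ _

theorem isZero_act_subquotient {j : C} {F : i ⟶ j} {Q A S : M.obj i} (m : A ⟶ Q) [Mono m]
    (e : A ⟶ S) [Epi e] (h : IsZero (M.act F Q)) : IsZero (M.act F S) := by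
  have hA : IsZero (M.act F A) := by
    rw [IsZero.iff_id_eq_zero, ← cancel_mono ((M.actF F).map m)]
    exact h.eq_of_tgt _ _
  rw [IsZero.iff_id_eq_zero, ← cancel_epi ((M.actF F).map e)]
  exact hA.eq_of_src _ _

/-- If f : Y → K does not die in L, lift FP → FL through FY to an endomorphism θ of FP over FL. By
locality θ is invertible, the alternative giving FL = 0; so FY fills FP, and minimality of K makes f
epi. -/
theorem IsFreeOn.isSimpleTop {P K L : M.obj i} (hP : M.IsFreeOn P) {j : C} {F : i ⟶ j}
    (hloc : HasLocalEnd F) {ι : K ⟶ P} [Mono ι] (hι : Epi ((M.actF F).map ι))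
    (hmin : ∀ (Y : M.obj i) (f : Y ⟶ K), Epi ((M.actF F).map (f ≫ ι)) → Epi f)
    (p : K ⟶ L) [Epi p] [Simple L] : IsSimpleTop p := by
  refine ⟨inferInstance, inferInstance, fun Y f hf => ?_⟩
  by_contra hne
  refine hf (hmin Y f ?_)
  have : IsIso ((M.actF F).map ι) := isIso_of_mono_of_epi _
  have := hP.projective_act F
  have : Epi (f ≫ p) := epi_of_nonzero_to_simple hne
  let q : M.act F P ⟶ M.act F L := inv ((M.actF F).map ι) ≫ (M.actF F).map p
  have : Epi q := inferInstance
  let s : M.act F P ⟶ M.act F Y := Projective.factorThru q ((M.actF F).map (f ≫ p))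
  have hs : s ≫ (M.actF F).map (f ≫ p) = q := Projective.factorThru_comp _ _
  let θ : M.act F P ⟶ M.act F P := s ≫ (M.actF F).map (f ≫ ι)
  have hθ : θ ≫ q = q := by
    have h1 : (M.actF F).map (f ≫ ι) ≫ q = (M.actF F).map (f ≫ p) := by simp [q]
    rw [Category.assoc, h1, hs]
  rcases hP.hasLocalEnd hloc θ (𝟙 _ - θ) (by rw [add_sub_cancel]; infer_instance) with h1 | h1
  · have : Epi (s ≫ (M.actF F).map (f ≫ ι)) := inferInstanceAs (Epi θ)
    exact epi_of_epi s _
  · exfalso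
    have h2 : (𝟙 _ - θ) ≫ q = 0 := by rw [sub_comp, hθ, Category.id_comp, sub_self]
    rw [← comp_zero (X := M.act F P) (f := 𝟙 _ - θ), cancel_epi] at h2
    refine Simple.not_isZero L (isZero_of_minimal hι hmin p ?_)
    rw [IsZero.iff_id_eq_zero, ← cancel_epi q, h2]
    simp

variable (k : Type*) [Field k] [∀ i j : C, Linear k (i ⟶ j)]
  [∀ i j : C, IsFinitaryCategory k (i ⟶ j)]

include k

theorem hasLocalEnd_of_indecomposable {j : C} {F : i ⟶ j} (hF : Indecomposable F) :
    HasLocalEnd F := by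
  have hV : IsFinitaryCategory k (i ⟶ j) := inferInstance
  have := hV.idem
  have := hV.fin F F
  exact isIso_or_isIso_of_isIso_add k hF

/-- The F with Hom(FP, L) = 0 form an additively closed class; if it contained all indecomposables
it would contain everything, against the existence of a cover of L. -/
theorem IsFreeOn.exists_indecomposable {P : M.obj i} (hP : M.IsFreeOn P) {j : C} {L : M.obj j}
    [Simple L] : ∃ (G : i ⟶ j) (e : M.act G P ⟶ L), Indecomposable G ∧ Epi e := by
  by_contra hcon
  push Not at hcon
  obtain ⟨F, f, hf⟩ := hP.cover L
  have h0 : ∀ f : M.act F P ⟶ L, f = 0 := by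
    refine IsAdditivelyClosed.le_of_indecomposable k (T := ⊤)
      (U := fun F => ∀ f : M.act F P ⟶ L, f = 0) (fun _ _ _ _ _ _ _ => trivial) ?_ ?_ F trivial
    · intro H n g s r hg h g'
      have h1 : M.act₂ (∑ a, s a ≫ r a) P ≫ g' = g' := by
        rw [h, act₂_id, Category.id_comp]
      have h2 : M.act₂ (∑ a, s a ≫ r a) P = ∑ a, M.act₂ (s a ≫ r a) P :=
        (M.evalFunctor P j).map_sum _ _
      rw [← h1, h2, sum_comp]
      refine Finset.sum_eq_zero fun a _ => ?_
      rw [act₂_comp_assoc, hg a (M.act₂ (r a) P ≫ g'), comp_zero]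
    · intro G hG _ e
      by_contra hne
      exact hcon G e hG (epi_of_nonzero_to_simple hne)
  apply id_nonzero L
  rw [← cancel_epi f, h0 f]
  simp

/-- K is chosen minimal for a single F in R. The members of a right cell annihilate the same
objects, so the conclusions hold for all of R. -/
theorem IsFreeOn.exists_cellDatum {P : M.obj i} (hP : M.IsFreeOn P)
    {R : ∀ j : C, ObjectProperty (i ⟶ j)} (hR : IsRightCell R) :
    ∃ (K L : M.obj i) (ι : K ⟶ P) (p : K ⟶ L) (G : i ⟶ i), Mono ι ∧ IsSimpleTop p ∧
      Indecomposable G ∧ (∃ e : M.act G P ⟶ L, Epi e) ∧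
      (∀ j F, R j F → IsZero (M.act F (cokernel ι))) ∧
      ∀ j F, R j F → ¬ IsZero (M.act F L) := by
  obtain ⟨j, F, hF⟩ := hR.exists_mem
  obtain ⟨K, ι, hι, hιF, hmin⟩ := exists_minimal_subobject F P
  -- Otherwise FP = 0, and faithfulness of evaluation at P would give F = 0.
  have hK : ¬ IsZero K := by
    intro hK
    have hFP : IsZero (M.act F P) := by
      rw [IsZero.iff_id_eq_zero, ← cancel_epi ((M.actF F).map ι)]
      exact (isZero_act F hK).eq_of_src _ _
    apply (hR.indecomposable hF).1
    have := hP.faithful j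
    rw [IsZero.iff_id_eq_zero]
    exact (M.evalFunctor P j).map_injective (hFP.eq_of_src _ _)
  obtain ⟨L, p, hp, hL⟩ := exists_epi_simple K hK
  obtain ⟨G, e, hG, he⟩ := hP.exists_indecomposable k (L := L)
  refine ⟨K, L, ι, p, G, hι, hP.isSimpleTop
    (hasLocalEnd_of_indecomposable k (hR.indecomposable hF)) hιF hmin p, hG, ⟨e, he⟩,
    fun l H hH => isZero_act_leR (hR.leR hF hH) ((isZero_act_cokernel_iff F ι).mpr hιF),
    fun l H hH h0 => Simple.not_isZero L
      (isZero_of_minimal hιF hmin p (isZero_act_leR (hR.leR hH hF) h0))⟩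

end

end PreTwoRep

/-! ### From the presenting criterion to generation and module categories -/

section

variable {V : Type u₁} [Category.{v₁} V] [Preadditive V] {D : Type u₂} [Category.{v₂} D]
  [Preadditive D]

theorem IsPresenting.of_iso {Φ Ψ : V ⥤ D} {T : ObjectProperty V} (h : IsPresenting Φ T)
    (e : Φ ≅ Ψ) : IsPresenting Ψ T where
  full {H H'} hH hH' φ := by
    obtain ⟨α, hα⟩ := h.full hH hH' (e.hom.app H ≫ φ ≫ e.inv.app H')
    refine ⟨α, ?_⟩
    rw [← cancel_epi (e.hom.app H), ← e.hom.naturality, hα]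
    simp
  presentation Z := by
    obtain ⟨H₁, H₀, α, π, w, h₁, h₀, hc⟩ := h.presentation Z
    obtain ⟨w', hc'⟩ := nonempty_isColimit_of_iso (e.app H₁) (e.app H₀) (e.hom.naturality α) hc
    exact ⟨H₁, H₀, α, _, w', h₁, h₀, hc'⟩
  lift {H H₁ H₀ Z} α π w hH h₁ h₀ hc f := by
    obtain ⟨w', hc'⟩ := nonempty_isColimit_of_iso (e.app H₁).symm (e.app H₀).symm
      (e.inv.naturality α) hc
    obtain ⟨g, hg⟩ := h.lift α _ w' hH h₁ h₀ hc' (e.hom.app H ≫ f)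
    refine ⟨e.inv.app H ≫ g ≫ e.hom.app H₀, ?_⟩
    have hg' : g ≫ e.hom.app H₀ ≫ π = e.hom.app H ≫ f := hg
    rw [Category.assoc, Category.assoc, hg', Iso.inv_hom_id_app_assoc]
  exact {H H₁ H₀ Z} α π w hH h₁ h₀ hc g hg := by
    obtain ⟨w', hc'⟩ := nonempty_isColimit_of_iso (e.app H₁).symm (e.app H₀).symm
      (e.inv.naturality α) hc
    obtain ⟨t, ht⟩ := h.exact α _ w' hH h₁ h₀ hc' (e.hom.app H ≫ g ≫ e.inv.app H₀) (by
      simp [hg])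
    refine ⟨e.inv.app H ≫ t ≫ e.hom.app H₁, ?_⟩
    rw [Category.assoc, Category.assoc, ← e.hom.naturality, ← Category.assoc t, ht]
    simp
  hasCokernel {H₁ H₀} α h₁ h₀ := by
    have := h.hasCokernel α h₁ h₀
    obtain ⟨w', hc'⟩ := nonempty_isColimit_of_iso (e.app H₁) (e.app H₀) (e.hom.naturality α)
      (w := cokernel.condition _) ⟨cokernelIsCokernel (Φ.map α)⟩
    exact HasColimit.mk ⟨_, hc'.some⟩

end

namespace PreTwoRep

section

variable {C : Type u} [Bicategory.{w, v} C] [∀ i j : C, Preadditive (i ⟶ j)]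
  [∀ i j : C, HasZeroObject (i ⟶ j)] [∀ i j : C, HasBinaryBiproducts (i ⟶ j)]
  {M : PreTwoRep.{w, v, u, v₁, u₁} C} {i : C} (k : Type*) [Field k] [∀ i j : C, Linear k (i ⟶ j)]
  [∀ i j : C, IsFinitaryCategory k (i ⟶ j)] {X : M.obj i}
  [∀ j, (M.evalFunctor X j).Additive] {T : ∀ j : C, ObjectProperty (i ⟶ j)}
  (h : ∀ j, IsPresenting (M.evalFunctor X j) (T j))

include k h

theorem generates_of_isPresenting : M.Generates X := by
  intro j Z W
  obtain ⟨u, v, π, ρ, wπ, wρ, ⟨hπ⟩, ⟨hρ⟩, hsurj⟩ := (h j).exists_generating k Z W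
  let p : EnvelopeValue X u Z := ⟨π, wπ, hπ⟩
  let q : EnvelopeValue X v W := ⟨ρ, wρ, hρ⟩
  refine ⟨u, v, p, q, fun f => ?_⟩
  obtain ⟨φ, hφ⟩ := hsurj f
  have : Epi π := Cofork.IsColimit.epi hπ
  refine ⟨φ, ?_⟩
  rw [← cancel_epi π, hφ]
  exact π_envelopeEval p q φ

theorem isTwoRep_of_isPresenting (hT : ∀ j, IsAdditivelyClosed (T j)) : IsTwoRep k M :=
  fun j => (h j).exists_equivalence k (hT j)

end

end PreTwoRep

section Freyd

variable {V : Type u₁} [Category.{v₁} V] [Preadditive V]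
  {W : Type u₂} [Category.{v₂} W] [Preadditive W]

theorem frHom_add {A B A' B' : V} (a : A ⟶ B) (a' : A' ⟶ B') (l l' : A ⟶ A') (r r' : B ⟶ B')
    (w : l ≫ a' = a ≫ r) (w' : l' ≫ a' = a ≫ r') : frHom a a' l r w + frHom a a' l' r' w' =
      frHom a a' (l + l') (r + r') (by rw [add_comp, comp_add, w, w']) :=
  ((RightFreyd.quotient V).map_add (f := Arrow.homMk' l r w) (g := Arrow.homMk' l' r' w')).symm

theorem frHom_ext {A B A' B' : V} {a : A ⟶ B} {a' : A' ⟶ B'} {l l' : A ⟶ A'} {r r' : B ⟶ B'}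
    {w : l ≫ a' = a ≫ r} {w' : l' ≫ a' = a ≫ r'} (h : r = r') :
    frHom a a' l r w = frHom a a' l' r' w' := by
  rw [← sub_eq_zero, frHom_sub, frHom_eq_zero_iff]
  exact ⟨0, by simp [h]⟩

instance (T : V ⥤ W) [T.Additive] : (freydMap T).Additive where
  map_add {X Y f g} := by
    obtain ⟨A, B, x, rfl⟩ := exists_frObj X
    obtain ⟨A', B', y, rfl⟩ := exists_frObj Y
    obtain ⟨l, r, w, rfl⟩ := exists_frHom x y f
    obtain ⟨l', r', w', rfl⟩ := exists_frHom x y g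
    rw [frHom_add]
    have hT : ∀ (l : A ⟶ A') (r : B ⟶ B') (w : l ≫ y = x ≫ r), (freydMap T).map
        (frHom x y l r w) = frHom (T.map x) (T.map y) (T.map l) (T.map r)
          (by rw [← T.map_comp, w, T.map_comp]) := fun _ _ _ => rfl
    rw [hT, hT, hT]
    exact (frHom_congr _ _ T.map_add T.map_add).trans (frHom_add _ _ _ _ _ _ _ _).symm

end Freyd

/-! ### The principal 2-representation -/

section Principal

open PreTwoRep

variable {C : Type u} [Bicategory.{w, v} C] [Bicategory.Strict C]
  [∀ i j : C, Preadditive (i ⟶ j)] [IsBiadditive C]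

instance (i : C) : (principal i).IsAdditive where
  map_add {j l} F := inferInstanceAs (freydMap (postcomp i F)).Additive
  act₂_add {j l F G} α β X := by
    obtain ⟨A, B, a, rfl⟩ := exists_frObj X
    change (whiskNat i (α + β)).app (frObj a) =
      (whiskNat i α).app (frObj a) + (whiskNat i β).app (frObj a)
    rw [whiskNat_app, whiskNat_app, whiskNat_app]
    exact (frHom_congr _ _ (IsBiadditive.whiskerLeft_add _ _ _)
      (IsBiadditive.whiskerLeft_add _ _ _)).trans (frHom_add _ _ _ _ _ _ _ _).symm

variable [∀ i j : C, HasZeroObject (i ⟶ j)]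

open ZeroObject

/-- The value of `F` at `P_𝟙` is `P_F`. -/
noncomputable def principalEvalIso (i j : C) :
    (principal i).evalFunctor (principalObj (𝟙 i)) j ≅ RightFreyd.functor (i ⟶ j) :=
  have h0 : ∀ F : i ⟶ j, (0 : (0 : i ⟶ i) ⟶ 𝟙 i) ▷ F = 0 := fun F =>
    (postcomp i F).map_zero _ _
  NatIso.ofComponents (fun F =>
    { hom := frHom ((0 : (0 : i ⟶ i) ⟶ 𝟙 i) ▷ F) (0 : (0 : i ⟶ j) ⟶ F) 0 (λ_ F).hom
        (by simp [h0 F])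
      inv := frHom (0 : (0 : i ⟶ j) ⟶ F) ((0 : (0 : i ⟶ i) ⟶ 𝟙 i) ▷ F) 0 (λ_ F).inv (by simp)
      hom_inv_id := by
        refine (frHom_comp _ _ _ _ _ _ _ _ _).trans (Eq.trans ?_ (frHom_id _).symm)
        exact frHom_ext (by simp)
      inv_hom_id := by
        refine (frHom_comp _ _ _ _ _ _ _ _ _).trans (Eq.trans ?_ (frHom_id _).symm)
        exact frHom_ext (by simp) }) (by
    intro F G α
    refine (frHom_comp _ _ _ _ _ _ _ _ _).trans (Eq.trans ?_ (frHom_comp _ _ _ _ _ _ _ _ _).symm)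
    exact frHom_ext (leftUnitor_naturality α))

variable [∀ i j : C, HasBinaryBiproducts (i ⟶ j)]

theorem isPresenting_principal (i j : C) :
    IsPresenting ((principal i).evalFunctor (principalObj (𝟙 i)) j) ⊤ :=
  isPresenting_freyd.of_iso (principalEvalIso i j).symm

theorem isFreeOn_principal (i : C) : (principal i).IsFreeOn (principalObj (𝟙 i)) where
  projective := ⟨fun {X Y} f e he => @exists_lift_of_epi (i ⟶ i) _ _ _ _ _ X Y e he f⟩
  full j := by
    have : (RightFreyd.functor (i ⟶ j)).Full := inferInstance
    exact @Functor.Full.of_iso _ _ _ _ _ _ this (principalEvalIso i j).symm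
  faithful j := by
    have : (RightFreyd.functor (i ⟶ j)).Faithful := inferInstance
    exact @Functor.Faithful.of_iso _ _ _ _ _ _ this (principalEvalIso i j).symm
  cover {j} X := by
    obtain ⟨H₁, H₀, α, π, w, -, -, ⟨hc⟩⟩ := (isPresenting_principal i j).presentation X
    exact ⟨H₀, π, Cofork.IsColimit.epi hc⟩

variable (k : Type*) [Field k] [∀ i j : C, Linear k (i ⟶ j)]

instance [h : IsFinitary k C] (i j : C) : IsFinitaryCategory k (i ⟶ j) where
  idem := h.isIdempotentComplete i j
  fin := h.finite_hom
  indec := h.finite_indecomposables i j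

theorem isTwoRep_principal [IsFinitary k C] (i : C) : IsTwoRep k (principal i) :=
  isTwoRep_of_isPresenting k (isPresenting_principal i) fun _ _ _ _ _ _ _ _ => trivial

theorem generates_principal [IsFinitary k C] (i : C) :
    (principal i).Generates (principalObj (𝟙 i)) :=
  generates_of_isPresenting k (isPresenting_principal i)

include k

/-- The abelian structure and the chain conditions are transported from the module category found in
`isTwoRep_principal`. -/
theorem isFiniteLength_principal [IsFinitary k C] (i j : C) :
    IsFiniteLength ((principal i).obj j) := by
  obtain ⟨A, _, _, hA, ⟨e⟩⟩ := isTwoRep_principal k i j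
  have : IsNoetherianRing A := isNoetherian_of_tower k inferInstance
  have : IsArtinianRing A := IsArtinianRing.of_finite k A
  exact isFiniteLength_of_isEquivalence e.functor

/-- F* is right adjoint to F; applied to F* and combined with F** ≅ F, the same fact makes F* left
adjoint to F. -/
theorem hasAdjoints_of_isFiat [h : IsFiat k C] (M : PreTwoRep.{w, v, u, v₁, u₁} C) :
    M.HasAdjoints where
  exists_adjoint F := by
    obtain ⟨star, h1, -, -, h2⟩ := h.exists_star
    obtain ⟨a⟩ := h2 F
    obtain ⟨b⟩ := h2 (star F)
    obtain ⟨e⟩ := h1 F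
    exact ⟨star F, ⟨CategoryTheory.Adjunction.ofCat (M.mapAdjunction a)⟩,
      ⟨(CategoryTheory.Adjunction.ofCat (M.mapAdjunction b)).ofNatIsoRight (Cat.Hom.toNatIso (M.map₂Iso e))⟩⟩

end Principal

/-! ### Cell 2-representations -/

section Cell

open PreTwoRep

variable {C : Type u} [Bicategory.{w, v} C] [Bicategory.Strict C]
  [∀ i j : C, Preadditive (i ⟶ j)] [IsBiadditive C]
  [∀ i j : C, HasZeroObject (i ⟶ j)] [∀ i j : C, HasBinaryBiproducts (i ⟶ j)]
  {i : C} {R : ∀ j : C, ObjectProperty (i ⟶ j)}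
  {K L : (principal i).obj i} {ι : K ⟶ principalObj (𝟙 i)} {p : K ⟶ L} {G : i ⟶ i}

instance (hst : IsCellStable R L) (S : (cellRep R L hst).obj i) (j : C) :
    ((cellRep R L hst).evalFunctor S j).Additive where
  map_add {_ _ α β} := ObjectProperty.hom_ext (cellProp R L j)
    (IsAdditive.act₂_add (M := principal i) α β
      (ObjectProperty.FullSubcategory.obj (P := cellProp R L i) S))

section

variable [(principal i).HasAdjoints] [∀ j, IsFiniteLength ((principal i).obj j)]

/-- F is exact, so killing all simple subquotients of P/K amounts to killing P/K. -/
theorem IsCellSubobject.ann (h : IsCellSubobject R ι p G) (j : C) (F : i ⟶ j) (hF : R j F) :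
    IsCellDatum.ann (principal i) ι j F :=
  isZero_act_of_subquotients fun _ _ m e hm he hS =>
    h.annihilated (cokernel.π ι) (cokernel.condition ι) ⟨cokernelIsCokernel ι⟩ m hm e he hS j F hF

variable (k : Type*) [Field k] [∀ i j : C, Linear k (i ⟶ j)]
  [∀ i j : C, IsFinitaryCategory k (i ⟶ j)]

include k

theorem IsCellSubobject.isCellDatum (h : IsCellSubobject R ι p G) (hR : IsRightCell R) :
    (principal i).IsCellDatum ι p G := by
  have := h.mono
  obtain ⟨e, he⟩ := h.exists_epi
  let φ : (principal i).act G (principalObj (𝟙 i)) ≅ principalObj G := (principalEvalIso i i).app G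
  let e' : (principal i).act G (principalObj (𝟙 i)) ⟶ L := φ.hom ≫ e
  have he' : Epi e' := epi_comp _ _
  refine
    { free := isFreeOn_principal i
      mono := h.mono
      top := h.isSimpleTop
      hasLocalEnd := hasLocalEnd_of_indecomposable k h.indecomposable
      exists_epi := ⟨e', he'⟩
      not_isZero := fun h0 => ?_ }
  -- A member F of R satisfies G ≤ F, so GL = 0 would imply FL = 0.
  obtain ⟨j, F, hF⟩ := hR.exists_mem
  exact h.not_annihilated j F hF (isZero_act_leR
    ((isFreeOn_principal i).leR_of_isSimpleTop h.isSimpleTop e' (h.ann j F hF)) h0)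

theorem exists_isCellSubobject (hR : IsRightCell R) :
    ∃ (K L : (principal i).obj i) (ι : K ⟶ principalObj (𝟙 i)) (p : K ⟶ L) (G : i ⟶ i),
      IsCellSubobject R ι p G := by
  obtain ⟨K, L, ι, p, G, hι, hp, hG, ⟨e, he⟩, hann, hnz⟩ :=
    (isFreeOn_principal i).exists_cellDatum k hR
  let φ : (principal i).act G (principalObj (𝟙 i)) ≅ principalObj G := (principalEvalIso i i).app G
  refine ⟨K, L, ι, p, G, ⟨hι, ?_, hp, hG, ⟨φ.inv ≫ e, epi_comp _ _⟩, hnz⟩⟩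
  rintro Q A S q hq ⟨hc⟩ m hm e he hS j F hF
  have hQ : IsZero ((principal i).act F Q) := (hann j F hF).of_iso
    (((principal i).actF F).mapIso (IsColimit.coconePointUniqueUpToIso hc (colimit.isColimit _)))
  exact isZero_act_subquotient m e hQ

variable (h : IsCellSubobject R ι p G) (hR : IsRightCell R)

include h hR

theorem IsCellSubobject.cellProp_iff (j : C) (X : (principal i).obj j) :
    cellProp R L j X ↔ presented ι L j X :=
  ((h.isCellDatum k hR).presented_iff k hR h.ann h.not_annihilated).symm

theorem IsCellSubobject.isCellStable : IsCellStable R L := by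
  intro j l F X hX
  rw [h.cellProp_iff k hR] at hX ⊢
  exact presented_act hX F

theorem IsCellSubobject.ann_top : IsCellDatum.ann (principal i) ι i G :=
  h.ann i G ((h.isCellDatum k hR).top_mem hR h.ann h.not_annihilated h.indecomposable)

theorem IsCellSubobject.exists_isCellSimple (hst : IsCellStable R L) :
    ∃ S : (cellRep R L hst).obj i, IsCellSimple S := by
  obtain ⟨S, hS, hq⟩ := (h.isCellDatum k hR).exists_simple (h.cellProp_iff k hR)
    (h.ann_top k hR)
  exact ⟨S, hS, hq⟩

theorem IsCellSubobject.isPresenting (hst : IsCellStable R L) {S : (cellRep R L hst).obj i}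
    (hS : IsCellSimple S) (j : C) :
    IsPresenting ((cellRep R L hst).evalFunctor S j) (IsCellDatum.ann (principal i) ι j) := by
  obtain ⟨hS, q, hq⟩ := hS
  have : Simple (C := (cellProp R L i).FullSubcategory) S := hS
  exact (h.isCellDatum k hR).isPresenting (h.cellProp_iff k hR) hq hst j

end

end Cell

end Fiat

/-! ### The main theorem -/

theorem proposition8 {k : Type*} [Field k] [IsAlgClosed k] {C : Type u} [Bicategory.{w, v} C]
    [Bicategory.Strict C] [∀ i j : C, Preadditive (i ⟶ j)] [∀ i j : C, Linear k (i ⟶ j)]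
    [∀ i j : C, HasZeroObject (i ⟶ j)] [∀ i j : C, HasBinaryBiproducts (i ⟶ j)]
    [Fiat.IsBiadditive C] [Fiat.IsFiat k C] :
    (∀ i : C, Fiat.IsTwoRep k (Fiat.principal i) ∧
      (Fiat.principal i).Generates (Fiat.principalObj (𝟙 i)) ∧ (Fiat.principal i).IsCyclic) ∧
    ∀ (i : C) (R : ∀ j : C, ObjectProperty (i ⟶ j)), Fiat.IsRightCell R →
      (∃ (K L : (Fiat.principal i).obj i) (ι : K ⟶ Fiat.principalObj (𝟙 i)) (p : K ⟶ L)
        (G : i ⟶ i), Fiat.IsCellSubobject R ι p G) ∧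
      ∀ (K L : (Fiat.principal i).obj i) (ι : K ⟶ Fiat.principalObj (𝟙 i)) (p : K ⟶ L)
        (G : i ⟶ i), Fiat.IsCellSubobject R ι p G →
        ∃ h : Fiat.IsCellStable R L,
          Fiat.IsTwoRep k (Fiat.cellRep R L h) ∧
          (∃ S : (Fiat.cellRep R L h).obj i, Fiat.IsCellSimple S) ∧
          (∀ S : (Fiat.cellRep R L h).obj i, Fiat.IsCellSimple S →
            (Fiat.cellRep R L h).Generates S) ∧
          (Fiat.cellRep R L h).IsCyclic ∧ (Fiat.cellRep R L h).IsQuasiSimple := by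
  refine ⟨fun i => ⟨Fiat.isTwoRep_principal k i, Fiat.generates_principal k i, i, _,
    Fiat.generates_principal k i⟩, fun i R hR => ?_⟩
  have := Fiat.hasAdjoints_of_isFiat k (Fiat.principal i)
  have := Fiat.isFiniteLength_principal k i
  refine ⟨Fiat.exists_isCellSubobject k hR, fun K L ι p G h => ?_⟩
  have hst := h.isCellStable k hR
  obtain ⟨S, hS⟩ := h.exists_isCellSimple k hR hst
  have hgen : ∀ S : (Fiat.cellRep R L hst).obj i, Fiat.IsCellSimple S →
      (Fiat.cellRep R L hst).Generates S := fun S hS =>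
    Fiat.PreTwoRep.generates_of_isPresenting k (h.isPresenting k hR hst hS)
  have hsimple : Simple S := hS.1
  exact ⟨hst, Fiat.PreTwoRep.isTwoRep_of_isPresenting k (h.isPresenting k hR hst hS)
      (Fiat.PreTwoRep.IsCellDatum.ann_isAdditivelyClosed ι), ⟨S, hS⟩, hgen, ⟨i, S, hgen S hS⟩,
    ⟨i, S, Simple.not_isZero S⟩, i, S, hsimple, hgen S hS⟩
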